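/- Throughout, the model is the randomized word RAM: a fixed program (not depending on the input) works on words of $\Theta(\log n+\log|\Sigma|)$ bits, elementary word operations (addition, truncated subtraction, multiplication, division with remainder, comparison, indirect memory access, reading one character of an input string at a computed position, drawing a uniformly random word) take unit time, and the input strings are given by random access without any preprocessing. $\mathrm{ED}(A,B)$ denotes the edit distance, i.e. the least number of single-character insertions, deletions and substitutions that turn $A$ into $B$. **Theorem.** There are a program $P$ of the randomized word RAM and constants $c\in\mathbb N$, $C>0$ such that the following holds for all integers $n,k,\ell$ with $1\le k\le n$ and $\sqrt k\le \ell\le n$, every finite alphabet $\Sigma=\{0,\dots,|\Sigma|-1\}$ and all strings $A,B\in\Sigma^n$. Given $n,|\Sigma|,k,\ell$ and random access to $A$ and $B$: 1. $P$ always halts after at most $C\log^c(n+2)\cdot\dfrac{(n+k^2)\sqrt k}{\ell}$ steps, whatever the random words are; 2. if $\mathrm{ED}(A,B)\le \dfrac{k}{C\log^c(n+2)}$, then $P$ outputs SMALL with probability at least $1-\frac1n$; 3. if $\mathrm{ED}(A,B)\ge C\,k\ell$, then $P$ outputs LARGE with probability at least $1-\frac1n$. That is, one can distinguish $\mathrm{ED}(A,B)\le\tilde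 O(k)$ from $\mathrm{ED}(A,B)\ge\tilde\Omega(k\ell)$ in $\tilde O\big((n+k^2)\sqrt k/\ell\big)$ time with probability at least $1-\frac1n$. -/

import Mathlib

open MeasureTheory

/-! ## Edit distance -/

/-- One edit operation on a string: insert, delete or substitute a single character. -/
inductive EditStep {α : Type*} : List α → List α → Prop
  | insert (u v : List α) (a : α) : EditStep (u ++ v) (u ++ a :: v)
  | delete (u v : List α) (a : α) : EditStep (u ++ a :: v) (u ++ v)
  | subst (u v : List α) (a b : α) : EditStep (u ++ a :: v) (u ++ b :: v)

/-- `EditsIn d x y`: the string `x` can be turned into `y` by exactly `d` edit operations. -/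
inductive EditsIn {α : Type*} : ℕ → List α → List α → Prop
  | refl (x : List α) : EditsIn 0 x x
  | tail {d : ℕ} {x y z : List α} : EditsIn d x y → EditStep y z → EditsIn (d + 1) x z

/-- The edit distance: the least number of insertions, deletions and substitutions
that turn `x` into `y`. -/
noncomputable def editDist {α : Type*} (x y : List α) : ℕ :=
  sInf {d | EditsIn d x y}

theorem EditsIn.trans {α : Type*} {d e : ℕ} {x y z : List α}
    (h : EditsIn d x y) (h' : EditsIn e y z) : EditsIn (d + e) x z := by
  induction h' with
  | refl => exact h
  | tail _ st ih => exact EditsIn.tail (ih h) st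

/-- Any string can be turned into any other one, so the infimum in `editDist` is attained. -/
theorem exists_editsIn {α : Type*} (x y : List α) : ∃ d, EditsIn d x y := by
  have del : ∀ x : List α, ∃ d, EditsIn d x [] := by
    intro x
    induction x with
    | nil => exact ⟨0, .refl _⟩
    | cons a x ih =>
      obtain ⟨d, hd⟩ := ih
      exact ⟨_, EditsIn.trans (.tail (.refl _) (EditStep.delete [] x a)) hd⟩
  have ins : ∀ y : List α, ∃ d, EditsIn d [] y := by
    intro y
    induction y with
    | nil => exact ⟨0, .refl _⟩
    | cons a y ih =>
      obtain ⟨d, hd⟩ := ih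
      exact ⟨_, EditsIn.tail hd (EditStep.insert [] y a)⟩
  obtain ⟨d, hd⟩ := del x
  obtain ⟨e, he⟩ := ins y
  exact ⟨_, hd.trans he⟩

theorem editsIn_editDist {α : Type*} (x y : List α) : EditsIn (editDist x y) x y :=
  Nat.sInf_mem (s := {d | EditsIn d x y}) (exists_editsIn x y)

/-! ## A randomized word RAM with random access to two read-only input strings -/

namespace WordRAM

/-- The arithmetic and comparison operations on words. -/
inductive Op
  | add | sub | mul | div | mod | lt | eq

/-- Expressions: constants, registers, operations, memory cells (indirect addressing) and
characters of the two input strings, at a computed position. -/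
inductive Expr
  | const (v : ℕ)
  | reg (x : ℕ)
  | op (o : Op) (a b : Expr)
  | load (a : Expr)
  | charA (a : Expr)
  | charB (a : Expr)

/-- Programs. A program is a finite object and uses finitely many registers. -/
inductive Cmd
  /-- `x := a` -/
  | assign (x : ℕ) (a : Expr)
  /-- `mem[a] := b` -/
  | store (a b : Expr)
  /-- `x :=` a fresh uniformly random word -/
  | rand (x : ℕ)
  | seq (p q : Cmd)
  /-- `if a ≠ 0 then p else q` -/
  | ite (a : Expr) (p q : Cmd)
  /-- `while a ≠ 0 do p` -/
  | while (a : Expr) (p : Cmd)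

/-- What a run of a program depends on, apart from the initial registers: the word size in bits,
the two input strings (as functions of the position), and the sequence of random words. -/
structure Env where
  wordSize : ℕ
  charA : ℕ → ℕ
  charB : ℕ → ℕ
  coin : ℕ → Fin (2 ^ wordSize)

/-- Registers, memory, and the number of random words drawn so far. -/
structure State where
  reg : ℕ → ℕ
  mem : ℕ → ℕ
  drawn : ℕ

/-- Value of an operation before reduction modulo the word length; subtraction is truncated at
`0`, division by `0` gives `0`, and comparisons give `1` (true) or `0` (false). -/
def Op.eval : Op → ℕ → ℕ → ℕ
  | .add, a, b => a + b
  | .sub, a, b => a - b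
  | .mul, a, b => a * b
  | .div, a, b => a / b
  | .mod, a, b => a % b
  | .lt, a, b => if a < b then 1 else 0
  | .eq, a, b => if a = b then 1 else 0

/-- Value of an expression; every computed value is reduced modulo `2 ^ wordSize`. -/
def Expr.eval (E : Env) (s : State) : Expr → ℕ
  | .const v => v % 2 ^ E.wordSize
  | .reg x => s.reg x
  | .op o a b => o.eval (a.eval E s) (b.eval E s) % 2 ^ E.wordSize
  | .load a => s.mem (a.eval E s)
  | .charA a => E.charA (a.eval E s)
  | .charB a => E.charB (a.eval E s)

/-- Time to evaluate an expression: one step for every node. -/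
def Expr.cost : Expr → ℕ
  | .const _ => 1
  | .reg _ => 1
  | .op _ a b => a.cost + b.cost + 1
  | .load a => a.cost + 1
  | .charA a => a.cost + 1
  | .charB a => a.cost + 1

/-- `Exec E p s s' t`: started in the state `s`, the program `p` halts in the state `s'`
after `t` steps. -/
inductive Exec (E : Env) : Cmd → State → State → ℕ → Prop
  | assign (x : ℕ) (a : Expr) (s : State) :
      Exec E (.assign x a) s { s with reg := Function.update s.reg x (a.eval E s) } (a.cost + 1)
  | store (a b : Expr) (s : State) :
      Exec E (.store a b) s
        { s with mem := Function.update s.mem (a.eval E s) (b.eval E s) } (a.cost + b.cost + 1)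
  | rand (x : ℕ) (s : State) :
      Exec E (.rand x) s
        { s with reg := Function.update s.reg x (E.coin s.drawn), drawn := s.drawn + 1 } 1
  | seq {p q : Cmd} {s s' s'' : State} {t t' : ℕ} :
      Exec E p s s' t → Exec E q s' s'' t' → Exec E (.seq p q) s s'' (t + t')
  | ite_true {a : Expr} {p q : Cmd} {s s' : State} {t : ℕ} :
      a.eval E s ≠ 0 → Exec E p s s' t → Exec E (.ite a p q) s s' (a.cost + 1 + t)
  | ite_false {a : Expr} {p q : Cmd} {s s' : State} {t : ℕ} :
      a.eval E s = 0 → Exec E q s s' t → Exec E (.ite a p q) s s' (a.cost + 1 + t)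
  | while_true {a : Expr} {p : Cmd} {s s' s'' : State} {t t' : ℕ} :
      a.eval E s ≠ 0 → Exec E p s s' t → Exec E (.while a p) s' s'' t' →
      Exec E (.while a p) s s'' (a.cost + 1 + t + t')
  | while_false {a : Expr} {p : Cmd} {s : State} :
      a.eval E s = 0 → Exec E (.while a p) s s (a.cost + 1)

/-- For given random words a run has at most one outcome. -/
theorem Exec.unique {E : Env} {p : Cmd} {s s₁ : State} {t₁ : ℕ} (h₁ : Exec E p s s₁ t₁) :
    ∀ {s₂ : State} {t₂ : ℕ}, Exec E p s s₂ t₂ → s₁ = s₂ ∧ t₁ = t₂ := by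
  induction h₁ with
  | assign => intro _ _ h; cases h; exact ⟨rfl, rfl⟩
  | store => intro _ _ h; cases h; exact ⟨rfl, rfl⟩
  | rand => intro _ _ h; cases h; exact ⟨rfl, rfl⟩
  | seq _ _ ih ih' =>
    intro _ _ h
    cases h with
    | seq g g' =>
      obtain ⟨rfl, rfl⟩ := ih g
      obtain ⟨rfl, rfl⟩ := ih' g'
      exact ⟨rfl, rfl⟩
  | ite_true ha _ ih =>
    intro _ _ h
    cases h with
    | ite_true _ g => obtain ⟨rfl, rfl⟩ := ih g; exact ⟨rfl, rfl⟩
    | ite_false hb _ => exact absurd hb ha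
  | ite_false ha _ ih =>
    intro _ _ h
    cases h with
    | ite_true hb _ => exact absurd ha hb
    | ite_false _ g => obtain ⟨rfl, rfl⟩ := ih g; exact ⟨rfl, rfl⟩
  | while_true ha _ _ ih ih' =>
    intro _ _ h
    cases h with
    | while_true _ g g' =>
      obtain ⟨rfl, rfl⟩ := ih g
      obtain ⟨rfl, rfl⟩ := ih' g'
      exact ⟨rfl, rfl⟩
    | while_false hb => exact absurd hb ha
  | while_false ha =>
    intro _ _ h
    cases h with
    | while_true hb _ _ => exact absurd ha hb
    | while_false _ => exact ⟨rfl, rfl⟩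

/-- The law of the random words: independent, uniform on all words of `w` bits. -/
noncomputable def coinLaw (w : ℕ) : Measure (ℕ → Fin (2 ^ w)) :=
  Measure.infinitePi fun _ => (PMF.uniformOfFintype (Fin (2 ^ w))).toMeasure

end WordRAM

/-! ## Algorithms for gap edit distance -/

/-- The character at position `i` (counted from `0`) of a string of length `n` over the alphabet
`{0, …, σ - 1}`; positions out of range hold the extra symbol `σ`. -/
def charAt {n σ : ℕ} (A : Fin n → Fin σ) (i : ℕ) : ℕ :=
  if h : i < n then A ⟨i, h⟩ else σ

/-- Words of `κ` times the bit length of `n + σ`, that is, of `Θ(log n + log σ)` bits. -/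
def wordBits (κ n σ : ℕ) : ℕ := κ * Nat.size (n + σ)

/-- The environment of a run on the input strings `A`, `B`, with random words `ω`. -/
def gapEnv (κ : ℕ) {n σ : ℕ} (A B : Fin n → Fin σ)
    (ω : ℕ → Fin (2 ^ wordBits κ n σ)) : WordRAM.Env where
  wordSize := wordBits κ n σ
  charA := charAt A
  charB := charAt B
  coin := ω

/-- At the start the registers `0, 1, 2, 3` hold `n, σ, k, ℓ`; all other registers and the whole
memory are `0`. In particular nothing about `A` and `B` has been preprocessed. -/
def gapInit (n σ k ℓ : ℕ) : WordRAM.State where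
  reg := fun x => if x = 0 then n else if x = 1 then σ else if x = 2 then k
    else if x = 3 then ℓ else 0
  mem := fun _ => 0
  drawn := 0

/-- With the random words `ω`, the program halts after at most `T` steps. -/
def HaltsWithin (P : WordRAM.Cmd) (κ k ℓ : ℕ) {n σ : ℕ} (A B : Fin n → Fin σ)
    (ω : ℕ → Fin (2 ^ wordBits κ n σ)) (T : ℝ) : Prop :=
  ∃ (s : WordRAM.State) (t : ℕ),
    WordRAM.Exec (gapEnv κ A B ω) P (gapInit n σ k ℓ) s t ∧ (t : ℝ) ≤ T

/-- The two possible answers: small or large edit distance. -/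
inductive Answer
  | small | large

/-- The encoding of the answers in register `0`. -/
def Answer.code : Answer → ℕ
  | .small => 1
  | .large => 0

/-- With the random words `ω`, the program halts with the answer `b` in register `0`. -/
def Outputs (P : WordRAM.Cmd) (κ k ℓ : ℕ) {n σ : ℕ} (A B : Fin n → Fin σ)
    (ω : ℕ → Fin (2 ^ wordBits κ n σ)) (b : Answer) : Prop :=
  ∃ (s : WordRAM.State) (t : ℕ),
    WordRAM.Exec (gapEnv κ A B ω) P (gapInit n σ k ℓ) s t ∧ s.reg 0 = b.code

/-- The probability, over the random words, that the program answers `b`. -/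
noncomputable def probOutputs (P : WordRAM.Cmd) (κ k ℓ : ℕ) {n σ : ℕ} (A B : Fin n → Fin σ)
    (b : Answer) : ENNReal :=
  WordRAM.coinLaw (wordBits κ n σ) {ω | Outputs P κ k ℓ A B ω b}

/-- Edit distance of two strings of length `n`. -/
noncomputable def stringED {n σ : ℕ} (A B : Fin n → Fin σ) : ℕ :=
  editDist (List.ofFn A) (List.ofFn B)

/-!
Restricting an alignment to shifts `|s| ≤ K`, where `K ≈ k`, turns it into a path in the array of
the mismatches `A i ≠ B (i + s)`; a path pays for these mismatches and for its changes of shift. Up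
to a factor `2` and an additive `3 K`, the least cost of a path is the edit distance.

Cut the positions into about `ℓ` blocks, and bisect these down to length at most `2 K`. A block is
heavy if its cost is at least `2 K`. Since joining optimal paths of neighbouring blocks costs at
most `2 K`, only a heavy block can exceed `2 K` by more than its two halves do, and then by at most
`4 K` more, while the blocks of the lowest level do not exceed `2 K` at all. So if the total cost is
more than a constant times `K ℓ`, then one of the logarithmically many levels has at least about
`ℓ / log n` heavy blocks, and on each level the program draws enough random blocks to meet one.

A drawn block is inspected only at one random position in each group of about `√k / log n`
consecutive positions. With high probability the sample meets every stretch of a single shift with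
`√K` mismatches; then a path of sampled cost less than `√K` has true cost less than `2 K`, so that
a heavy block has sampled cost at least `√K`. If on the other hand the edit distance is small, then
few blocks have cost at least `√K`, and by Markov's inequality a run draws one of them with
probability at most `1 / 2`. About `log n` independent runs make both errors at most `1 / n`.
-/

/-! ### Costs of paths -/

theorem sum_range_mul {M : Type*} [AddCommMonoid M] (f : ℕ → M) (m b : ℕ) :
    ∑ i ∈ Finset.range (m * b), f i =
      ∑ j ∈ Finset.range m, ∑ t ∈ Finset.range b, f (j * b + t) := by
  induction m with
  | zero => simp
  | succ m ih => rw [Nat.succ_mul, Finset.sum_range_add, ih, Finset.sum_range_succ]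

section PathCost

/-- The cost on the positions `x ≤ i < y` of the path that uses the shift `p i` at position `i`:
its local costs `c i (p i)` plus its total variation. In the application `c i s` says whether the
characters matched by shift `s` at position `i` differ, and the cost counts edits. -/
def pathCost (c : ℕ → ℕ → ℕ) (p : ℕ → ℕ) (x y : ℕ) : ℕ :=
  ∑ i ∈ Finset.Ico x y, (c i (p i) + Nat.dist (p i) (p (i + 1)))

/-- The least cost on `x ≤ i < y` of a path whose shifts are at most `m`. -/
noncomputable def minCost (c : ℕ → ℕ → ℕ) (m x y : ℕ) : ℕ :=
  ⨅ p : {p : ℕ → ℕ // ∀ i, p i ≤ m}, pathCost c p x y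

/-- The least cost of a path on the `j`-th block of length `b`. -/
noncomputable def blockCost (c : ℕ → ℕ → ℕ) (m b j : ℕ) : ℕ :=
  minCost c m (j * b) ((j + 1) * b)

/-- The blocks of length `b`, among the first `N`, on which every path costs at least `h`. -/
noncomputable def heavyBlocks (c : ℕ → ℕ → ℕ) (m h b N : ℕ) : Finset ℕ :=
  {j ∈ Finset.range N | h ≤ blockCost c m b j}

variable {c c' : ℕ → ℕ → ℕ} {p p' : ℕ → ℕ} {m x y z : ℕ}

theorem pathCost_self (c : ℕ → ℕ → ℕ) (p : ℕ → ℕ) (x : ℕ) : pathCost c p x x = 0 := by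
  simp [pathCost]

theorem pathCost_add (c : ℕ → ℕ → ℕ) (p : ℕ → ℕ) (hxy : x ≤ y) (hyz : y ≤ z) :
    pathCost c p x y + pathCost c p y z = pathCost c p x z :=
  Finset.sum_Ico_consecutive _ hxy hyz

theorem pathCost_succ (c : ℕ → ℕ → ℕ) (p : ℕ → ℕ) (hxy : x ≤ y) :
    pathCost c p x (y + 1) = pathCost c p x y + (c y (p y) + Nat.dist (p y) (p (y + 1))) :=
  Finset.sum_Ico_succ_top hxy _

theorem pathCost_congr (hc : ∀ i, x ≤ i → i < y → c i = c' i)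
    (hp : ∀ i, x ≤ i → i ≤ y → p i = p' i) : pathCost c p x y = pathCost c' p' x y := by
  refine Finset.sum_congr rfl fun i hi => ?_
  rw [Finset.mem_Ico] at hi
  rw [hc i hi.1 hi.2, hp i hi.1 hi.2.le, hp (i + 1) (by omega) (by omega)]

theorem pathCost_mono (hc : ∀ i s, c i s ≤ c' i s) : pathCost c p x y ≤ pathCost c' p x y :=
  Finset.sum_le_sum fun _ _ => Nat.add_le_add_right (hc _ _) _

theorem minCost_le_pathCost (c : ℕ → ℕ → ℕ) (hp : ∀ i, p i ≤ m) (x y : ℕ) :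
    minCost c m x y ≤ pathCost c p x y :=
  ciInf_le' (fun q : {q : ℕ → ℕ // ∀ i, q i ≤ m} => pathCost c q x y) ⟨p, hp⟩

theorem exists_pathCost_eq_minCost (c : ℕ → ℕ → ℕ) (m x y : ℕ) :
    ∃ p : ℕ → ℕ, (∀ i, p i ≤ m) ∧ pathCost c p x y = minCost c m x y := by
  have : Nonempty {p : ℕ → ℕ // ∀ i, p i ≤ m} := ⟨fun _ => 0, fun _ => Nat.zero_le _⟩
  obtain ⟨⟨p, hp⟩, h⟩ :=
    ciInf_mem fun p : {p : ℕ → ℕ // ∀ i, p i ≤ m} => pathCost c p x y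
  exact ⟨p, hp, h⟩

theorem minCost_mono (hc : ∀ i s, c i s ≤ c' i s) : minCost c m x y ≤ minCost c' m x y := by
  obtain ⟨p, hp, h⟩ := exists_pathCost_eq_minCost c' m x y
  exact (minCost_le_pathCost c hp x y).trans ((pathCost_mono hc).trans h.le)

theorem minCost_le_length (hc : ∀ i s, c i s ≤ 1) (m x y : ℕ) : minCost c m x y ≤ y - x := by
  refine (minCost_le_pathCost c (p := fun _ => 0) (fun _ => Nat.zero_le m) x y).trans ?_
  simpa [pathCost, Nat.dist_self] using
    Finset.sum_le_card_nsmul (Finset.Ico x y) (fun i => c i 0) 1 fun i _ => hc i 0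

theorem minCost_self (c : ℕ → ℕ → ℕ) (m x : ℕ) : minCost c m x x = 0 :=
  Nat.le_zero.1 <| (minCost_le_pathCost c (p := fun _ => 0) (fun _ => Nat.zero_le m) x x).trans
    (pathCost_self c _ x).le

theorem minCost_mono_right (c : ℕ → ℕ → ℕ) (m : ℕ) (hxy : x ≤ y) (hyz : y ≤ z) :
    minCost c m x y ≤ minCost c m x z := by
  obtain ⟨p, hp, h⟩ := exists_pathCost_eq_minCost c m x z
  rw [← h, ← pathCost_add c p hxy hyz]
  exact (minCost_le_pathCost c hp x y).trans (Nat.le_add_right _ _)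

theorem pathCost_ite_lt_le (c : ℕ → ℕ → ℕ) (hp : ∀ i, p i ≤ m) (hp' : ∀ i, p' i ≤ m)
    (x y : ℕ) : pathCost c (fun i => if i < y then p i else p' i) x y ≤ pathCost c p x y + m := by
  rcases le_or_gt y x with hyx | hxy
  · simp [pathCost, Finset.Ico_eq_empty_of_le hyx]
  obtain ⟨y, rfl⟩ := Nat.exists_eq_add_one_of_ne_zero (Nat.ne_zero_of_lt hxy)
  have hcongr : pathCost c (fun i => if i < y + 1 then p i else p' i) x y = pathCost c p x y :=
    pathCost_congr (fun _ _ _ => rfl) fun i _ hi => if_pos (Nat.lt_succ_of_le hi)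
  have hjump : Nat.dist (p y) (p' (y + 1)) ≤ m := by
    have := hp y
    have := hp' (y + 1)
    unfold Nat.dist
    omega
  rw [pathCost_succ _ _ (by omega), pathCost_succ _ _ (by omega), hcongr]
  simp only [Nat.lt_succ_self, if_true, lt_irrefl, if_false]
  omega

theorem minCost_le_add_add (c : ℕ → ℕ → ℕ) (m : ℕ) (hxy : x ≤ y) (hyz : y ≤ z) :
    minCost c m x z ≤ minCost c m x y + minCost c m y z + m := by
  obtain ⟨p, hp, hpc⟩ := exists_pathCost_eq_minCost c m x y
  obtain ⟨q, hq, hqc⟩ := exists_pathCost_eq_minCost c m y z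
  have hpq : ∀ i, (if i < y then p i else q i) ≤ m := fun i => by
    split_ifs
    exacts [hp i, hq i]
  refine (minCost_le_pathCost c hpq x z).trans ?_
  have hleft := pathCost_ite_lt_le c hp hq x y
  have hright : pathCost c (fun i => if i < y then p i else q i) y z = pathCost c q y z :=
    pathCost_congr (fun _ _ _ => rfl) fun i hi _ => if_neg (not_lt.2 hi)
  rw [← pathCost_add c _ hxy hyz]
  omega

theorem minCost_mul_le_sum_blockCost (c : ℕ → ℕ → ℕ) (m b J : ℕ) :
    minCost c m 0 (J * b) ≤ ∑ j ∈ Finset.range J, blockCost c m b j + J * m := by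
  induction J with
  | zero => simp [minCost_self]
  | succ J ih =>
    have hglue := minCost_le_add_add c m (Nat.zero_le (J * b)) (Nat.mul_le_mul_right b J.le_succ)
    rw [Nat.succ_eq_add_one] at hglue
    rw [Finset.sum_range_succ, blockCost, Nat.succ_mul J m]
    omega

theorem sum_pathCost_blocks (c : ℕ → ℕ → ℕ) (p : ℕ → ℕ) (b J : ℕ) :
    ∑ j ∈ Finset.range J, pathCost c p (j * b) ((j + 1) * b) = pathCost c p 0 (J * b) := by
  induction J with
  | zero => simp [pathCost_self]
  | succ J ih =>
    rw [Finset.sum_range_succ, ih,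
      pathCost_add c p (Nat.zero_le _) (Nat.mul_le_mul_right b J.le_succ)]

theorem card_heavyBlocks_mul_le_minCost (c : ℕ → ℕ → ℕ) (m h b N : ℕ) :
    (heavyBlocks c m h b N).card * h ≤ minCost c m 0 (N * b) := by
  obtain ⟨p, hp, hpc⟩ := exists_pathCost_eq_minCost c m 0 (N * b)
  calc (heavyBlocks c m h b N).card * h
      ≤ ∑ j ∈ heavyBlocks c m h b N, pathCost c p (j * b) ((j + 1) * b) :=
        Finset.card_nsmul_le_sum _ _ h fun j hj =>
          (Finset.mem_filter.1 hj).2.trans (minCost_le_pathCost c hp _ _)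
    _ ≤ ∑ j ∈ Finset.range N, pathCost c p (j * b) ((j + 1) * b) :=
        Finset.sum_le_sum_of_subset (Finset.filter_subset _ _)
    _ = minCost c m 0 (N * b) := by rw [sum_pathCost_blocks, hpc]

end PathCost

section SampledCost

variable {c : ℕ → ℕ → ℕ} {p : ℕ → ℕ} {S : Set ℕ} {m q x y : ℕ}

/-- The set `S` meets the costly positions of every stretch of a single shift `s ≤ m` inside
`x ≤ i < y` that costs at least `q`. A random sample of density about `1 / q` has this property. -/
def HitsStretches (S : Set ℕ) (c : ℕ → ℕ → ℕ) (m q x y : ℕ) : Prop :=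
  ∀ u v s, x ≤ u → v ≤ y → s ≤ m → q ≤ ∑ i ∈ Finset.Ico u v, c i s →
    ∃ i ∈ S, u ≤ i ∧ i < v ∧ c i s ≠ 0

theorem HitsStretches.pathCost_lt (hS : HitsStretches S c m q x y) (hp : ∀ i, p i ≤ m) {u v : ℕ}
    (hu : x ≤ u) (hv : v ≤ y) (hconst : ∀ i, u ≤ i → i ≤ v → p i = p v)
    (hzero : pathCost (S.indicator c) p u v = 0) : pathCost c p u v < q := by
  have hsum : pathCost c p u v = ∑ i ∈ Finset.Ico u v, c i (p v) := by
    refine Finset.sum_congr rfl fun i hi => ?_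
    rw [Finset.mem_Ico] at hi
    rw [hconst i hi.1 hi.2.le, hconst (i + 1) (by omega) (by omega), Nat.dist_self, add_zero]
  by_contra! hq
  obtain ⟨i, hiS, hui, hiv, hi⟩ := hS u v (p v) hu hv (hp v) (hsum ▸ hq)
  have hterm := Finset.sum_eq_zero_iff.1 hzero i (Finset.mem_Ico.2 ⟨hui, hiv⟩)
  rw [Set.indicator_of_mem hiS, Nat.add_eq_zero_iff, hconst i hui hiv.le] at hterm
  exact hi hterm.1

/-- Cut the path after each step with positive sampled cost: between two cuts the shift is constant
and no mismatch is sampled, so that the true cost is less than `q`. -/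
theorem HitsStretches.exists_stretch (hc : ∀ i s, c i s ≤ 1) (hS : HitsStretches S c m q x y)
    (hp : ∀ i, p i ≤ m) {z : ℕ} (hxz : x ≤ z) (hzy : z ≤ y) :
    ∃ u, x ≤ u ∧ u ≤ z ∧ (∀ i, u ≤ i → i ≤ z → p i = p z) ∧
      pathCost (S.indicator c) p u z = 0 ∧
      pathCost c p x u ≤ (q + 1) * pathCost (S.indicator c) p x u := by
  induction z, hxz using Nat.le_induction with
  | base => exact ⟨x, le_rfl, le_rfl, fun i h h' => by rw [le_antisymm h' h], by
      simp [pathCost_self]⟩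
  | succ z hxz ih =>
    obtain ⟨u, hxu, huz, hconst, hzero, hle⟩ := ih (by omega)
    by_cases hstep : S.indicator c z (p z) + Nat.dist (p z) (p (z + 1)) = 0
    · have hz : p z = p (z + 1) := Nat.eq_of_dist_eq_zero (by omega)
      refine ⟨u, hxu, by omega, fun i hi hi' => ?_, ?_, hle⟩
      · rcases Nat.lt_or_ge z i with h | h
        · rw [le_antisymm hi' h]
        · rw [hconst i hi h, hz]
      · rw [pathCost_succ _ _ huz, hzero, hstep]
    · refine ⟨z + 1, by omega, le_rfl, fun i h h' => by rw [le_antisymm h' h],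
        pathCost_self _ _ _, ?_⟩
      have hlt := hS.pathCost_lt hp hxu (by omega) hconst hzero
      have hcz := hc z (p z)
      rw [pathCost_succ c p hxz, pathCost_succ _ p hxz, ← pathCost_add c p hxu huz,
        ← pathCost_add _ p hxu huz, hzero]
      have : q ≤ q * (S.indicator c z (p z) + Nat.dist (p z) (p (z + 1))) :=
        Nat.le_mul_of_pos_right _ (Nat.pos_of_ne_zero hstep)
      nlinarith

theorem HitsStretches.minCost_le (hc : ∀ i s, c i s ≤ 1) (hS : HitsStretches S c m q x y)
    (hxy : x ≤ y) : minCost c m x y ≤ (q + 1) * minCost (S.indicator c) m x y + q := by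
  obtain ⟨p, hp, hpc⟩ := exists_pathCost_eq_minCost (S.indicator c) m x y
  obtain ⟨u, hxu, huy, hconst, hzero, hle⟩ := hS.exists_stretch hc hp hxy le_rfl
  have hlt := hS.pathCost_lt hp hxu le_rfl hconst hzero
  refine (minCost_le_pathCost c hp x y).trans ?_
  rw [← hpc, ← pathCost_add c p hxu huy, ← pathCost_add _ p hxu huy, hzero, add_zero]
  omega

end SampledCost

section DyadicBlocks

variable {c : ℕ → ℕ → ℕ} {m b n : ℕ}

theorem blockCost_two_mul_le (c : ℕ → ℕ → ℕ) (m b j : ℕ) :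
    blockCost c m (2 * b) j ≤ blockCost c m b (2 * j) + blockCost c m b (2 * j + 1) + m := by
  have hstart : j * (2 * b) = 2 * j * b := by ring
  have hend : (j + 1) * (2 * b) = (2 * j + 1 + 1) * b := by ring
  rw [blockCost, hstart, hend]
  exact minCost_le_add_add c m (Nat.mul_le_mul_right b (by omega))
    (Nat.mul_le_mul_right b (by omega))

theorem sum_excess_two_mul_le (c : ℕ → ℕ → ℕ) (m b J : ℕ) :
    ∑ j ∈ Finset.range J, (blockCost c m (2 * b) j - m) ≤
      ∑ j ∈ Finset.range (2 * J), (blockCost c m b j - m) +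
        2 * m * (heavyBlocks c m m (2 * b) J).card := by
  have hpairs : ∑ j ∈ Finset.range (2 * J), (blockCost c m b j - m) =
      ∑ j ∈ Finset.range J,
        ((blockCost c m b (2 * j) - m) + (blockCost c m b (2 * j + 1) - m)) := by
    simp [mul_comm 2, sum_range_mul, Finset.sum_range_succ]
  rw [hpairs, heavyBlocks, Finset.card_filter, Finset.mul_sum, ← Finset.sum_add_distrib]
  refine Finset.sum_le_sum fun j _ => ?_
  have := blockCost_two_mul_le c m b j
  split_ifs <;> omega

theorem sum_excess_le_card_heavyBlocks (hc : ∀ i s, c i s ≤ 1) (hb : b ≤ m) (U J : ℕ) :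
    ∑ j ∈ Finset.range J, (blockCost c m (b * 2 ^ U) j - m) ≤
      2 * m * ∑ u ∈ Finset.Ico 1 (U + 1),
        (heavyBlocks c m m (b * 2 ^ u) (J * 2 ^ (U - u))).card := by
  induction U generalizing J with
  | zero =>
    refine (Finset.sum_eq_zero fun j _ => ?_).le.trans (Nat.zero_le _)
    have := minCost_le_length hc m (j * b) ((j + 1) * b)
    rw [Nat.succ_mul, Nat.add_sub_cancel_left] at this
    rw [pow_zero, mul_one, blockCost, Nat.succ_mul]
    omega
  | succ U ih =>
    have hlower : ∑ u ∈ Finset.Ico 1 (U + 1),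
        (heavyBlocks c m m (b * 2 ^ u) (2 * J * 2 ^ (U - u))).card =
        ∑ u ∈ Finset.Ico 1 (U + 1),
          (heavyBlocks c m m (b * 2 ^ u) (J * 2 ^ (U + 1 - u))).card := by
      refine Finset.sum_congr rfl fun u hu => ?_
      rw [Nat.succ_sub (Nat.lt_succ_iff.1 (Finset.mem_Ico.1 hu).2), pow_succ,
        show 2 * J * 2 ^ (U - u) = J * (2 ^ (U - u) * 2) by ring]
    rw [Finset.sum_Ico_succ_top (by omega), ← hlower, Nat.sub_self, pow_zero, mul_one, mul_add,
      show b * 2 ^ (U + 1) = 2 * (b * 2 ^ U) by ring]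
    exact (sum_excess_two_mul_le c m (b * 2 ^ U) J).trans (Nat.add_le_add_right (ih (2 * J)) _)

theorem minCost_le_card_heavyBlocks (hc : ∀ i s, c i s ≤ 1) (hb : b ≤ m) {U J : ℕ}
    (hn : n ≤ J * (b * 2 ^ U)) : minCost c m 0 n ≤ 2 * m * (J +
      ∑ u ∈ Finset.Ico 1 (U + 1), (heavyBlocks c m m (b * 2 ^ u) (J * 2 ^ (U - u))).card) := by
  set B := b * 2 ^ U
  calc minCost c m 0 n ≤ minCost c m 0 (J * B) := minCost_mono_right c m (Nat.zero_le _) hn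
    _ ≤ ∑ j ∈ Finset.range J, blockCost c m B j + J * m := minCost_mul_le_sum_blockCost c m B J
    _ ≤ ∑ j ∈ Finset.range J, ((blockCost c m B j - m) + m) + J * m := by
      gcongr
      omega
    _ = 2 * m * J + ∑ j ∈ Finset.range J, (blockCost c m B j - m) := by
      rw [Finset.sum_add_distrib, Finset.sum_const, Finset.card_range, smul_eq_mul]
      ring
    _ ≤ _ := by
      rw [mul_add]
      exact Nat.add_le_add_left (sum_excess_le_card_heavyBlocks hc hb U J) _

theorem exists_le_mul_card_heavyBlocks (hc : ∀ i s, c i s ≤ 1) (hb : b ≤ m) {U J l : ℕ}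
    (hn : n ≤ J * (b * 2 ^ U)) (hcost : 2 * m * (J + l) < minCost c m 0 n) :
    ∃ u ≤ U, l ≤ U * (heavyBlocks c m m (b * 2 ^ u) (J * 2 ^ (U - u))).card := by
  by_contra! hfew
  have hsum : ∑ u ∈ Finset.Ico 1 (U + 1), (heavyBlocks c m m (b * 2 ^ u) (J * 2 ^ (U - u))).card
      ≤ l := by
    rcases Nat.eq_zero_or_pos U with rfl | hU
    · simp
    refine le_of_mul_le_mul_left ?_ hU
    calc U * ∑ u ∈ Finset.Ico 1 (U + 1), (heavyBlocks c m m (b * 2 ^ u) (J * 2 ^ (U - u))).card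
        ≤ (Finset.Ico 1 (U + 1)).card • l := by
          rw [Finset.mul_sum]
          exact Finset.sum_le_card_nsmul _ _ l fun u hu =>
            (hfew u (Nat.lt_succ_iff.1 (Finset.mem_Ico.1 hu).2)).le
      _ = U * l := by simp
  exact hcost.not_ge <| (minCost_le_card_heavyBlocks hc hb hn).trans <|
    Nat.mul_le_mul_left _ (Nat.add_le_add_left hsum J)

end DyadicBlocks

/-! ### Alignments and shifts -/

section EditAlignment

variable {α : Type*}

/-- Alignments of two strings with `d` edits, by recursion on the strings. Unlike a sequence of
edit steps, an alignment visits the positions from left to right, so that it can be read as a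
path of shifts. -/
inductive EditAlignment : ℕ → List α → List α → Prop
  | nil : EditAlignment 0 [] []
  | keep (a : α) {d : ℕ} {x y : List α} : EditAlignment d x y → EditAlignment d (a :: x) (a :: y)
  | subst (a b : α) {d : ℕ} {x y : List α} :
      EditAlignment d x y → EditAlignment (d + 1) (a :: x) (b :: y)
  | delete (a : α) {d : ℕ} {x y : List α} : EditAlignment d x y → EditAlignment (d + 1) (a :: x) y
  | insert (b : α) {d : ℕ} {x y : List α} : EditAlignment d x y → EditAlignment (d + 1) x (b :: y)

/-- A single edit, located by recursion on the string rather than by a decomposition `u ++ v`. -/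
inductive HeadEdit : List α → List α → Prop
  | insert (a : α) (y : List α) : HeadEdit y (a :: y)
  | delete (a : α) (y : List α) : HeadEdit (a :: y) y
  | subst (a b : α) (y : List α) : HeadEdit (a :: y) (b :: y)
  | cons (a : α) {y z : List α} : HeadEdit y z → HeadEdit (a :: y) (a :: z)

theorem HeadEdit.append_left {y z : List α} (h : HeadEdit y z) (u : List α) :
    HeadEdit (u ++ y) (u ++ z) := by
  induction u with
  | nil => exact h
  | cons a u ih => exact .cons a ih

theorem EditStep.headEdit {y z : List α} (h : EditStep y z) : HeadEdit y z := by
  cases h with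
  | insert u v a => exact (HeadEdit.insert a v).append_left u
  | delete u v a => exact (HeadEdit.delete a v).append_left u
  | subst u v a b => exact (HeadEdit.subst a b v).append_left u

theorem EditAlignment.refl (x : List α) : EditAlignment 0 x x := by
  induction x with
  | nil => exact .nil
  | cons a x ih => exact .keep a ih

theorem EditAlignment.headEdit {d : ℕ} {x y z : List α} (h : EditAlignment d x y)
    (e : HeadEdit y z) : ∃ d' ≤ d + 1, EditAlignment d' x z := by
  induction h generalizing z with
  | nil => cases e with
    | insert a _ => exact ⟨1, le_rfl, .insert a .nil⟩
  | keep a h ih => cases e with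
    | insert b _ => exact ⟨_, le_rfl, .insert b (.keep a h)⟩
    | delete _ _ => exact ⟨_, le_rfl, .delete a h⟩
    | subst _ b _ => exact ⟨_, le_rfl, .subst a b h⟩
    | cons _ e => obtain ⟨d', hd, h'⟩ := ih e; exact ⟨d', hd, .keep a h'⟩
  | subst a b h ih => cases e with
    | insert b' _ => exact ⟨_, le_rfl, .insert b' (.subst a b h)⟩
    | delete _ _ => exact ⟨_, Nat.le_succ _, .delete a h⟩
    | subst _ b' _ => exact ⟨_, Nat.le_succ _, .subst a b' h⟩
    | cons _ e =>
      obtain ⟨d', hd, h'⟩ := ih e; exact ⟨d' + 1, Nat.succ_le_succ hd, .subst a b h'⟩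
  | delete a _ ih =>
    obtain ⟨d', hd, h'⟩ := ih e; exact ⟨d' + 1, Nat.succ_le_succ hd, .delete a h'⟩
  | insert b h ih => cases e with
    | insert b' _ => exact ⟨_, le_rfl, .insert b' (.insert b h)⟩
    | delete _ _ => exact ⟨_, by omega, h⟩
    | subst _ b' _ => exact ⟨_, Nat.le_succ _, .insert b' h⟩
    | cons _ e => obtain ⟨d', hd, h'⟩ := ih e; exact ⟨d' + 1, Nat.succ_le_succ hd, .insert b h'⟩

theorem EditsIn.exists_alignment {d : ℕ} {x y : List α} (h : EditsIn d x y) :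
    ∃ d' ≤ d, EditAlignment d' x y := by
  induction h with
  | refl x => exact ⟨0, le_rfl, .refl x⟩
  | tail _ st ih =>
    obtain ⟨d', hd, h'⟩ := ih
    obtain ⟨d'', hd', h''⟩ := h'.headEdit st.headEdit
    exact ⟨d'', by omega, h''⟩

open Classical in
/-- Whether position `i` of `x` disagrees with position `i + t` of `y`. A negative position agrees
with nothing; two positions past the end agree. -/
noncomputable def shiftMismatch (x y : List α) (i : ℕ) (t : ℤ) : ℕ :=
  if ∃ j : ℕ, (j : ℤ) = i + t ∧ x[i]? = y[j]? then 0 else 1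

/-- The cost of matching position `i` of `x` with position `i + t i` of `y` for all `i < N`: one
for every mismatch, plus the total variation of `t`, starting from the shift `0`. -/
noncomputable def shiftCost (x y : List α) (t : ℕ → ℤ) (N : ℕ) : ℕ :=
  (t 0).natAbs + ∑ i ∈ Finset.range N, (shiftMismatch x y i (t i) + (t (i + 1) - t i).natAbs)

theorem shiftMismatch_le_one (x y : List α) (i : ℕ) (t : ℤ) : shiftMismatch x y i t ≤ 1 := by
  unfold shiftMismatch; split_ifs <;> simp

theorem shiftMismatch_le_of_imp {x y x' y' : List α} {i i' : ℕ} {t t' : ℤ}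
    (h : ∀ j : ℕ, (j : ℤ) = i + t → x[i]? = y[j]? →
      ∃ j' : ℕ, (j' : ℤ) = i' + t' ∧ x'[i']? = y'[j']?) :
    shiftMismatch x' y' i' t' ≤ shiftMismatch x y i t := by
  by_cases hxy : ∃ j : ℕ, (j : ℤ) = i + t ∧ x[i]? = y[j]?
  · obtain ⟨j, hj, hij⟩ := hxy
    exact (if_pos (h j hj hij)).trans_le (Nat.zero_le _)
  · exact (shiftMismatch_le_one _ _ _ _).trans (if_neg hxy).ge

theorem natAbs_le_shiftCost (x y : List α) (t : ℕ → ℤ) (N : ℕ) :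
    (t N).natAbs ≤ shiftCost x y t N := by
  induction N with
  | zero => exact Nat.le_add_right _ _
  | succ N ih => simp only [shiftCost, Finset.sum_range_succ] at ih ⊢; omega

theorem shiftCost_add_one_le {x y x' y' : List α} {t : ℕ → ℤ}
    (hm : ∀ i, shiftMismatch x' y' i (t i + 1) ≤ shiftMismatch x y i (t i)) (N : ℕ) :
    shiftCost x' y' (fun i => t i + 1) N ≤ shiftCost x y t N + 1 := by
  have := Finset.sum_le_sum fun i (_ : i ∈ Finset.range N) =>
    Nat.add_le_add_right (hm i) (t (i + 1) - t i).natAbs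
  simp only [shiftCost, add_sub_add_right_eq_sub]
  omega

/-- The sequence of shifts that starts with `0` and continues with `t`, translated by `e`. -/
def consShift (t : ℕ → ℤ) (e : ℤ) : ℕ → ℤ
  | 0 => 0
  | i + 1 => t i + e

theorem shiftCost_consShift_le {x y x' y' : List α} {t : ℕ → ℤ} {e : ℤ}
    (hm : ∀ i, shiftMismatch x' y' (i + 1) (t i + e) ≤ shiftMismatch x y i (t i)) (N : ℕ) :
    shiftCost x' y' (consShift t e) (N + 1) ≤
      shiftCost x y t N + e.natAbs + shiftMismatch x' y' 0 0 := by
  have := Finset.sum_le_sum fun i (_ : i ∈ Finset.range N) =>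
    Nat.add_le_add_right (hm i) (t (i + 1) - t i).natAbs
  simp only [shiftCost, Finset.sum_range_succ', consShift, add_sub_add_right_eq_sub,
    Int.natAbs_zero, sub_zero]
  omega

theorem shiftCost_le_succ (x y : List α) (t : ℕ → ℤ) (N : ℕ) :
    shiftCost x y t N ≤ shiftCost x y t (N + 1) := by
  simp only [shiftCost, Finset.sum_range_succ]; omega

theorem EditAlignment.exists_shiftCost_le {d : ℕ} {x y : List α} (h : EditAlignment d x y) :
    ∃ t : ℕ → ℤ, ∀ N, shiftCost x y t N ≤ 2 * d := by
  have push {x y : List α} {t : ℕ → ℤ} {D : ℕ} (h : ∀ N, shiftCost x y t (N + 1) ≤ D) (N : ℕ) :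
      shiftCost x y t N ≤ D := (shiftCost_le_succ x y t N).trans (h N)
  induction h with
  | nil => exact ⟨fun _ => 0, fun N => by simp [shiftCost, shiftMismatch]⟩
  | @keep a _ x y _ ih =>
    obtain ⟨t, ht⟩ := ih
    refine ⟨consShift t 0, push fun N => ?_⟩
    have hcons := shiftCost_consShift_le (x' := a :: x) (y' := a :: y) (e := 0)
      (fun i => shiftMismatch_le_of_imp (t := t i)
        fun j hj hij => ⟨j + 1, by push_cast; omega, by simpa using hij⟩) N
    have hhead : shiftMismatch (a :: x) (a :: y) 0 0 = 0 := if_pos ⟨0, by simp, by simp⟩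
    exact (hcons.trans_eq (by simp [hhead])).trans (ht N)
  | @subst a b _ x y _ ih =>
    obtain ⟨t, ht⟩ := ih
    refine ⟨consShift t 0, push fun N => ?_⟩
    have hcons := shiftCost_consShift_le (x' := a :: x) (y' := b :: y) (e := 0)
      (fun i => shiftMismatch_le_of_imp (t := t i)
        fun j hj hij => ⟨j + 1, by push_cast; omega, by simpa using hij⟩) N
    have := shiftMismatch_le_one (a :: x) (b :: y) 0 0
    have := ht N
    omega
  | @delete a _ x y _ ih =>
    obtain ⟨t, ht⟩ := ih
    refine ⟨consShift t (-1), push fun N => ?_⟩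
    have hcons := shiftCost_consShift_le (x' := a :: x) (y' := y) (e := -1)
      (fun i => shiftMismatch_le_of_imp (t := t i)
        fun j hj hij => ⟨j, by push_cast; omega, by simpa using hij⟩) N
    have := shiftMismatch_le_one (a :: x) y 0 0
    have := ht N
    omega
  | @insert b _ x y _ ih =>
    obtain ⟨t, ht⟩ := ih
    refine ⟨fun i => t i + 1, fun N => ?_⟩
    have hcons := shiftCost_add_one_le (x' := x) (y' := b :: y)
      (fun i => shiftMismatch_le_of_imp (t := t i)
        fun j hj hij => ⟨j + 1, by push_cast; omega, by simpa using hij⟩) N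
    have := ht N
    omega

end EditAlignment

section EditDist

variable {α : Type*}

theorem EditStep.symm {x y : List α} (h : EditStep x y) : EditStep y x := by
  cases h with
  | insert u v a => exact .delete u v a
  | delete u v a => exact .insert u v a
  | subst u v a b => exact .subst u v b a

theorem EditsIn.symm {d : ℕ} {x y : List α} (h : EditsIn d x y) : EditsIn d y x := by
  induction h with
  | refl x => exact .refl x
  | tail _ st ih => exact add_comm _ 1 ▸ (EditsIn.tail (.refl _) st.symm).trans ih

theorem editDist_le {d : ℕ} {x y : List α} (h : EditsIn d x y) : editDist x y ≤ d :=
  Nat.sInf_le h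

theorem editDist_comm (x y : List α) : editDist x y = editDist y x :=
  (editDist_le (editsIn_editDist y x).symm).antisymm (editDist_le (editsIn_editDist x y).symm)

theorem editDist_triangle (x y z : List α) :
    editDist x z ≤ editDist x y + editDist y z :=
  editDist_le ((editsIn_editDist x y).trans (editsIn_editDist y z))

theorem editDist_self (x : List α) : editDist x x = 0 :=
  Nat.le_zero.1 (editDist_le (.refl x))

theorem editDist_le_one {x y : List α} (h : EditStep x y) : editDist x y ≤ 1 :=
  editDist_le (.tail (.refl x) h)

theorem editDist_append_toList_le_one (x : List α) (a : Option α) :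
    editDist x (x ++ a.toList) ≤ 1 := by
  cases a with
  | none => simp [editDist_self]
  | some a => simpa using editDist_le_one (EditStep.insert x [] a)

theorem editDist_append_singleton_le (x y : List α) (a : α) :
    editDist (x ++ [a]) (y ++ [a]) ≤ editDist x y := by
  refine editDist_le ?_
  generalize editDist x y = d, editsIn_editDist x y = h
  induction h with
  | refl => exact .refl _
  | tail _ st ih =>
    refine .tail ih ?_
    cases st with
    | insert u v b => simpa using EditStep.insert u (v ++ [a]) b
    | delete u v b => simpa using EditStep.delete u (v ++ [a]) b
    | subst u v b b' => simpa using EditStep.subst u (v ++ [a]) b b'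

theorem editDist_append_toList_le [DecidableEq α] (x y : List α) (a b : Option α) :
    editDist (x ++ a.toList) (y ++ b.toList) ≤ editDist x y + if a = b then 0 else 1 := by
  have hxa : editDist (x ++ a.toList) x ≤ 1 := by
    rw [editDist_comm]; exact editDist_append_toList_le_one x a
  have hyb := editDist_append_toList_le_one y b
  match a, b with
  | none, none => simp
  | none, some b =>
    simpa using (editDist_triangle x y (y ++ [b])).trans (Nat.add_le_add_left hyb _)
  | some a, none =>
    simpa [add_comm] using (editDist_triangle (x ++ [a]) x y).trans (Nat.add_le_add_right hxa _)
  | some a, some b =>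
    have happ := editDist_append_singleton_le x y a
    have hsub : editDist (y ++ [a]) (y ++ [b]) ≤ 1 := editDist_le_one (.subst y [] a b)
    have htri := editDist_triangle (x ++ [a]) (y ++ [a]) (y ++ [b])
    by_cases hab : a = b
    · simpa [← hab] using happ
    · simpa [hab] using htri.trans (Nat.add_le_add happ hsub)

theorem editDist_take_take_le (y : List α) (i j : ℕ) :
    editDist (y.take i) (y.take j) ≤ Nat.dist i j := by
  wlog hij : i ≤ j generalizing i j
  · rw [editDist_comm, Nat.dist_comm]
    exact this j i (Nat.le_of_not_le hij)
  induction j, hij using Nat.le_induction with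
  | base => simp [editDist_self]
  | succ j hij ih =>
    have htri := editDist_triangle (y.take i) (y.take j) (y.take (j + 1))
    have hstep : editDist (y.take j) (y.take (j + 1)) ≤ 1 := by
      rw [List.take_add_one]; exact editDist_append_toList_le_one _ _
    rw [Nat.dist_eq_sub_of_le (by omega)] at ih ⊢
    omega

/-- Whether the shift `s` mismatches position `i`. A shift is stored with the offset `k`, so that
`s` stands for the signed shift `s - k`; positions before the start of `g` are read as `g 0`. -/
def mismatch {β : Type*} [DecidableEq β] (f g : ℕ → β) (k i s : ℕ) : ℕ :=
  if f i = g (i + s - k) then 0 else 1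

theorem mismatch_le_one {β : Type*} [DecidableEq β] (f g : ℕ → β) (k i s : ℕ) :
    mismatch f g k i s ≤ 1 := by
  unfold mismatch; split_ifs <;> norm_num

variable [DecidableEq α]

theorem minCost_mismatch_le_two_mul_editDist {x y : List α} {k : ℕ}
    (hk : 2 * editDist x y ≤ k) (N : ℕ) :
    minCost (mismatch (fun i => x[i]?) (fun j => y[j]?) k) (2 * k) 0 N ≤ 2 * editDist x y := by
  obtain ⟨d, hd, hal⟩ := (editsIn_editDist x y).exists_alignment
  obtain ⟨t, ht⟩ := hal.exists_shiftCost_le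
  have ht_le (i : ℕ) : (t i).natAbs ≤ k := by
    have := (natAbs_le_shiftCost x y t i).trans (ht i); omega
  calc minCost (mismatch (fun i => x[i]?) (fun j => y[j]?) k) (2 * k) 0 N
      ≤ pathCost (mismatch (fun i => x[i]?) (fun j => y[j]?) k) (fun i => (k + t i).toNat) 0 N :=
        minCost_le_pathCost _ (fun i => by have := ht_le i; omega) 0 N
    _ ≤ shiftCost x y t N := by
        rw [pathCost, ← Finset.range_eq_Ico]
        refine (Finset.sum_le_sum fun i _ => add_le_add ?_ ?_).trans (Nat.le_add_left _ _)
        · unfold shiftMismatch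
          split_ifs with hi
          · obtain ⟨j, hj, hij⟩ := hi
            have hidx : i + (k + t i).toNat - k = j := by have := ht_le i; omega
            exact (if_pos (hij.trans (by rw [hidx]))).le
          · exact mismatch_le_one _ _ _ _ _
        · unfold Nat.dist; omega
    _ ≤ 2 * editDist x y := (ht N).trans (Nat.mul_le_mul_left 2 hd)

theorem editDist_take_le_pathCost {x y : List α} {k : ℕ} {p : ℕ → ℕ} (hp : p 0 ≤ 2 * k) (m : ℕ) :
    editDist (x.take m) (y.take (m + p m - k)) ≤
      pathCost (mismatch (fun i => x[i]?) (fun j => y[j]?) k) p 0 m + k + min m k := by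
  induction m with
  | zero =>
    have := editDist_take_take_le y 0 (0 + p 0 - k)
    rw [Nat.dist_eq_sub_of_le (by omega)] at this
    rw [List.take_zero] at this ⊢
    omega
  | succ m ih =>
    have hdist : Nat.dist (m + 1 + p m - k) (m + 1 + p (m + 1) - k) ≤
        Nat.dist (p m) (p (m + 1)) := by unfold Nat.dist; omega
    have hshift := (editDist_take_take_le y (m + 1 + p m - k) (m + 1 + p (m + 1) - k)).trans hdist
    have htri := editDist_triangle (x.take (m + 1)) (y.take (m + 1 + p m - k))
      (y.take (m + 1 + p (m + 1) - k))
    rw [pathCost_succ _ _ (Nat.zero_le m)]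
    suffices editDist (x.take (m + 1)) (y.take (m + 1 + p m - k)) ≤
        editDist (x.take m) (y.take (m + p m - k)) +
          mismatch (fun i => x[i]?) (fun j => y[j]?) k m (p m) + (min (m + 1) k - min m k) by omega
    rcases Nat.lt_or_ge (m + p m) k with hlt | hge
    · have hdel := editDist_append_toList_le_one (x.take m) x[m]?
      rw [← List.take_add_one, editDist_comm] at hdel
      have := editDist_triangle (x.take (m + 1)) (x.take m) (y.take 0)
      rw [show m + p m - k = 0 by omega, show m + 1 + p m - k = 0 by omega]
      omega
    · rw [show m + 1 + p m - k = m + p m - k + 1 by omega, List.take_add_one, List.take_add_one]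
      exact (editDist_append_toList_le _ _ _ _).trans (Nat.le_add_right _ _)

theorem editDist_le_minCost {x y : List α} (hxy : x.length = y.length) (k : ℕ) :
    editDist x y ≤
      minCost (mismatch (fun i => x[i]?) (fun j => y[j]?) k) (2 * k) 0 x.length + 3 * k := by
  obtain ⟨p, hp, hcost⟩ := exists_pathCost_eq_minCost
    (mismatch (fun i => x[i]?) (fun j => y[j]?) k) (2 * k) 0 x.length
  have hpath := editDist_take_le_pathCost (x := x) (y := y) (hp 0) x.length
  have hend := editDist_take_take_le y (x.length + p x.length - k) x.length
  have hdist : Nat.dist (x.length + p x.length - k) x.length ≤ k := by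
    have := hp x.length
    unfold Nat.dist; omega
  have htri := editDist_triangle x (y.take (x.length + p x.length - k)) y
  rw [List.take_length] at hpath
  rw [hxy, List.take_length, ← hxy] at hend
  omega

theorem charAt_eq_charAt_iff {n σ : ℕ} (A B : Fin n → Fin σ) (i j : ℕ) :
    charAt A i = charAt B j ↔ (List.ofFn A)[i]? = (List.ofFn B)[j]? := by
  by_cases hi : i < n <;> by_cases hj : j < n
  · simp [charAt, hi, hj, Fin.ext_iff]
  · simp [charAt, hi, hj, (A ⟨i, hi⟩).isLt.ne]
  · simp [charAt, hi, hj, (B ⟨j, hj⟩).isLt.ne']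
  · simp [charAt, hi, hj]

theorem mismatch_charAt {n σ : ℕ} (A B : Fin n → Fin σ) (k : ℕ) :
    mismatch (charAt A) (charAt B) k =
      mismatch (fun i => (List.ofFn A)[i]?) (fun j => (List.ofFn B)[j]?) k := by
  funext i s
  simp only [mismatch, charAt_eq_charAt_iff]

theorem minCost_charAt_le_two_mul_stringED {n σ : ℕ} {A B : Fin n → Fin σ} {k : ℕ}
    (hk : 2 * stringED A B ≤ k) (N : ℕ) :
    minCost (mismatch (charAt A) (charAt B) k) (2 * k) 0 N ≤ 2 * stringED A B := by
  rw [mismatch_charAt]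
  exact minCost_mismatch_le_two_mul_editDist hk N

theorem stringED_le_minCost {n σ : ℕ} (A B : Fin n → Fin σ) (k : ℕ) :
    stringED A B ≤ minCost (mismatch (charAt A) (charAt B) k) (2 * k) 0 n + 3 * k := by
  have := editDist_le_minCost (x := List.ofFn A) (y := List.ofFn B) (by simp) k
  rwa [List.length_ofFn, ← mismatch_charAt] at this

end EditDist

/-! ### Uniform random words -/

section UniformResidues

variable {W N : ℕ} {bad : Finset ℕ}

theorem card_mul_le_card_filter_mod_mem (W : ℕ) (hbad : ∀ b ∈ bad, b < N) :
    bad.card * (W / N) ≤ (Finset.univ.filter fun v : Fin W => (v : ℕ) % N ∈ bad).card := by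
  rw [← Finset.card_range (W / N), ← Finset.card_product]
  refine Finset.card_le_card_of_surjOn (fun v : Fin W => ((v : ℕ) % N, (v : ℕ) / N)) ?_
  rintro ⟨b, q⟩ hbq
  obtain ⟨hb, hq⟩ : b ∈ bad ∧ q < W / N := by simpa using hbq
  have hbN := hbad b hb
  have hlt : b + N * q < W := by
    have := (Nat.mul_le_mul_left N (Nat.succ_le_of_lt hq)).trans (Nat.mul_div_le W N)
    rw [Nat.mul_succ] at this
    omega
  refine ⟨⟨b + N * q, hlt⟩, ?_, ?_⟩
  · simpa [Nat.mod_eq_of_lt hbN] using hb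
  · simp [Nat.mod_eq_of_lt hbN, Nat.add_mul_div_left _ _ (Nat.zero_lt_of_lt hbN),
      Nat.div_eq_of_lt hbN]

theorem card_filter_mod_mem_le (W N : ℕ) (bad : Finset ℕ) :
    (Finset.univ.filter fun v : Fin W => (v : ℕ) % N ∈ bad).card ≤ bad.card * (W / N + 1) := by
  rw [← Finset.card_range (W / N + 1), ← Finset.card_product]
  refine Finset.card_le_card_of_injOn (fun v => ((v : ℕ) % N, (v : ℕ) / N)) ?_ ?_
  · intro v hv
    simp only [Finset.coe_filter, Finset.mem_univ, true_and, Set.mem_ofPred_eq] at hv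
    simp only [Finset.coe_product, Set.mem_prod, Finset.mem_coe, Finset.mem_range]
    exact ⟨hv, Nat.lt_succ_of_le (Nat.div_le_div_right v.2.le)⟩
  · intro v _ v' _ h
    simp only [Prod.mk.injEq] at h
    refine Fin.ext ?_
    rw [← Nat.mod_add_div (v : ℕ) N, h.1, h.2, Nat.mod_add_div]

variable [NeZero W]

theorem toMeasure_uniformOfFintype_fin (p : Fin W → Prop) [DecidablePred p] :
    (PMF.uniformOfFintype (Fin W)).toMeasure {v | p v} =
      ENNReal.ofReal ((Finset.univ.filter p).card / W) := by
  have hcard : Fintype.card {v | p v} = (Finset.univ.filter p).card := by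
    rw [← Set.toFinset_card]; congr 1; ext; simp
  rw [PMF.toMeasure_uniformOfFintype_apply _ MeasurableSet.of_discrete, hcard, Fintype.card_fin,
    ENNReal.ofReal_div_of_pos (by exact_mod_cast NeZero.pos W), ENNReal.ofReal_natCast,
    ENNReal.ofReal_natCast]

theorem uniform_mod_mem_le (hN : 0 < N) (hW : N ≤ W) (bad : Finset ℕ) :
    (PMF.uniformOfFintype (Fin W)).toMeasure {v | (v : ℕ) % N ∈ bad} ≤
      ENNReal.ofReal (2 * bad.card / N) := by
  rw [toMeasure_uniformOfFintype_fin]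
  refine ENNReal.ofReal_le_ofReal ?_
  have hdiv : W / N + 1 ≤ 2 * (W / N) := by have := Nat.div_pos hW hN; omega
  have hcount : (Finset.univ.filter fun v : Fin W => (v : ℕ) % N ∈ bad).card * N ≤
      2 * bad.card * W := calc
    _ ≤ bad.card * (2 * (W / N)) * N :=
      Nat.mul_le_mul_right N ((card_filter_mod_mem_le W N bad).trans (Nat.mul_le_mul_left _ hdiv))
    _ = 2 * bad.card * (W / N * N) := by ring
    _ ≤ _ := Nat.mul_le_mul_left _ (Nat.div_mul_le_self W N)
  rw [div_le_div_iff₀ (by exact_mod_cast NeZero.pos W) (by exact_mod_cast hN)]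
  exact_mod_cast hcount

theorem uniform_mod_notMem_le (hN : 0 < N) (hW : N ≤ W) (hbad : ∀ b ∈ bad, b < N) :
    (PMF.uniformOfFintype (Fin W)).toMeasure {v | (v : ℕ) % N ∉ bad} ≤
      ENNReal.ofReal (Real.exp (-(bad.card / (2 * N)))) := by
  rw [toMeasure_uniformOfFintype_fin]
  refine ENNReal.ofReal_le_ofReal (le_trans ?_ (Real.one_sub_le_exp_neg _))
  have hWN : W ≤ 2 * N * (W / N) := by
    have := Nat.div_add_mod W N
    have := Nat.mod_lt W hN
    have := Nat.mul_le_mul_left N (Nat.div_pos hW hN)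
    nlinarith
  have hcount : bad.card * W ≤
      2 * N * (Finset.univ.filter fun v : Fin W => (v : ℕ) % N ∈ bad).card := calc
    _ ≤ bad.card * (2 * N * (W / N)) := Nat.mul_le_mul_left _ hWN
    _ = 2 * N * (bad.card * (W / N)) := by ring
    _ ≤ _ := Nat.mul_le_mul_left _ (card_mul_le_card_filter_mod_mem W hbad)
  have hcompl := Finset.card_filter_add_card_filter_not (s := Finset.univ)
    (fun v : Fin W => (v : ℕ) % N ∈ bad)
  rw [Finset.card_univ, Fintype.card_fin] at hcompl
  have hN' : (0 : ℝ) < 2 * N := by exact_mod_cast Nat.mul_pos two_pos hN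
  have hW' : (0 : ℝ) < W := by exact_mod_cast NeZero.pos W
  rw [div_le_iff₀ hW', sub_mul, one_mul, div_mul_eq_mul_div, le_sub_iff_add_le]
  calc _ ≤ ((Finset.univ.filter fun v : Fin W => (v : ℕ) % N ∉ bad).card : ℝ) +
        (Finset.univ.filter fun v : Fin W => (v : ℕ) % N ∈ bad).card := by
        gcongr
        rw [div_le_iff₀' hN']
        exact_mod_cast hcount
    _ = W := by rw [add_comm]; exact_mod_cast hcompl

end UniformResidues

namespace WordRAM

instance (w : ℕ) : IsProbabilityMeasure (coinLaw w) := by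
  unfold coinLaw; infer_instance

theorem coinLaw_forall_mem {ι : Type*} {w : ℕ} {s : Finset ι} {idx : ι → ℕ}
    (hidx : Set.InjOn idx s) (T : ι → Set (Fin (2 ^ w))) :
    coinLaw w {ω | ∀ i ∈ s, ω (idx i) ∈ T i} =
      ∏ i ∈ s, (PMF.uniformOfFintype (Fin (2 ^ w))).toMeasure (T i) := by
  classical
  rcases isEmpty_or_nonempty ι with hι | hι
  · simp [Finset.eq_empty_of_isEmpty s]
  have hinv (i) (hi : i ∈ s) : Function.invFunOn idx s (idx i) = i :=
    hidx.leftInvOn_invFunOn hi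
  have hcyl : {ω : ℕ → Fin (2 ^ w) | ∀ i ∈ s, ω (idx i) ∈ T i} =
      (s.image idx : Set ℕ).pi fun j => T (Function.invFunOn idx s j) := by
    ext ω
    simp only [Set.mem_ofPred_eq, Set.mem_pi, Finset.coe_image, Set.forall_mem_image,
      Finset.mem_coe]
    exact forall₂_congr fun i hi => by rw [hinv i hi]
  rw [hcyl, coinLaw, Measure.infinitePi_pi _ fun _ _ => MeasurableSet.of_discrete,
    Finset.prod_image hidx]
  exact Finset.prod_congr rfl fun i hi => by rw [hinv i hi]

theorem coinLaw_forall_exists_mem_le {ι : Type*} {w : ℕ} {I : Finset ι} {R : ℕ}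
    {idx : ℕ → ι → ℕ} (hidx : ∀ r < R, ∀ r' < R, ∀ a ∈ I, ∀ a' ∈ I, idx r a = idx r' a' → r = r')
    (T : ι → Set (Fin (2 ^ w))) :
    coinLaw w {ω | ∀ r < R, ∃ a ∈ I, ω (idx r a) ∈ T a} ≤
      (∑ a ∈ I, (PMF.uniformOfFintype (Fin (2 ^ w))).toMeasure (T a)) ^ R := by
  classical
  have hsub : {ω : ℕ → Fin (2 ^ w) | ∀ r < R, ∃ a ∈ I, ω (idx r a) ∈ T a} ⊆
      ⋃ f ∈ Fintype.piFinset fun _ : Fin R => I,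
        {ω | ∀ r ∈ Finset.univ, ω (idx r (f r)) ∈ T (f r)} := by
    intro ω hω
    choose f hfI hfT using fun r : Fin R => hω r r.2
    simp only [Set.mem_iUnion]
    exact ⟨f, Fintype.mem_piFinset.2 hfI, fun r _ => hfT r⟩
  calc coinLaw w {ω | ∀ r < R, ∃ a ∈ I, ω (idx r a) ∈ T a}
      ≤ ∑ f ∈ Fintype.piFinset fun _ : Fin R => I,
          coinLaw w {ω | ∀ r ∈ Finset.univ, ω (idx r (f r)) ∈ T (f r)} :=
        (measure_mono hsub).trans (measure_biUnion_finset_le _ _)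
    _ = ∑ f ∈ Fintype.piFinset fun _ : Fin R => I,
          ∏ r, (PMF.uniformOfFintype (Fin (2 ^ w))).toMeasure (T (f r)) := by
        refine Finset.sum_congr rfl fun f hf => coinLaw_forall_mem (fun r _ r' _ h => ?_) _
        rw [Fintype.mem_piFinset] at hf
        exact Fin.ext (hidx r r.2 r' r'.2 _ (hf r) _ (hf r') h)
    _ = _ := by
        rw [Finset.sum_prod_piFinset I
          fun _ : Fin R => fun a => (PMF.uniformOfFintype (Fin (2 ^ w))).toMeasure (T a),
          Finset.prod_const, Finset.card_univ, Fintype.card_fin]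

theorem coinLaw_forall_mod_notMem_le {w N R : ℕ} (hN : 0 < N) (hW : N ≤ 2 ^ w) {idx : ℕ → ℕ}
    (hidx : Function.Injective idx) {bad : ℕ → Finset ℕ} (hbad : ∀ i, ∀ b ∈ bad i, b < N) :
    coinLaw w {ω | ∀ i < R, (ω (idx i) : ℕ) % N ∉ bad i} ≤
      ENNReal.ofReal (Real.exp (-((∑ i ∈ Finset.range R, (bad i).card : ℕ) / (2 * N)))) := by
  have hprod := coinLaw_forall_mem (s := Finset.range R) hidx.injOn
    fun i => {v : Fin (2 ^ w) | (v : ℕ) % N ∉ bad i}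
  simp only [Finset.mem_range, Set.mem_ofPred_eq] at hprod
  rw [hprod]
  refine (Finset.prod_le_prod' fun i _ => uniform_mod_notMem_le hN hW (hbad i)).trans_eq ?_
  rw [← ENNReal.ofReal_prod_of_nonneg fun i _ => (Real.exp_pos _).le, ← Real.exp_sum,
    Finset.sum_neg_distrib, ← Finset.sum_div, Nat.cast_sum]

/-! ### Execution of programs -/

instance : Add Expr := ⟨.op .add⟩
instance : Sub Expr := ⟨.op .sub⟩
instance : Mul Expr := ⟨.op .mul⟩
instance : Div Expr := ⟨.op .div⟩
instance : Mod Expr := ⟨.op .mod⟩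
instance (v : ℕ) : OfNat Expr v := ⟨.const v⟩

/-- Comparison of two expressions. -/
def Expr.lt (a b : Expr) : Expr := .op .lt a b

/-- Equality test of two expressions. -/
def Expr.beq (a b : Expr) : Expr := .op .eq a b

/-- The minimum of two expressions, by truncated subtraction. -/
def Expr.min (a b : Expr) : Expr := a - (a - b)

/-- The negation of a truth value. -/
def Expr.not (a : Expr) : Expr := a.beq 0

/-- The conjunction of two truth values. -/
def Expr.and (a b : Expr) : Expr := a * b

/-- The disjunction of two truth values. -/
def Expr.or (a b : Expr) : Expr := (0 : Expr).lt (a + b)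

open Classical in
/-- The truth value of a proposition, in the encoding of the comparison operations. -/
noncomputable def truth (p : Prop) : ℕ := if p then 1 else 0

theorem truth_true {p : Prop} (h : p) : truth p = 1 := if_pos h

theorem truth_false {p : Prop} (h : ¬ p) : truth p = 0 := if_neg h

theorem truth_le_one (p : Prop) : truth p ≤ 1 := by
  unfold truth; split_ifs <;> norm_num

theorem truth_congr {p q : Prop} (h : p ↔ q) : truth p = truth q := by rw [propext h]

section eval

variable {E : Env} {s : State} {a b : Expr} {x y : ℕ}

theorem eval_ofNat {v : ℕ} (h : ofNat(v) < 2 ^ E.wordSize) :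
    Expr.eval E s ofNat(v) = ofNat(v) :=
  Nat.mod_eq_of_lt h

theorem eval_add (ha : a.eval E s = x) (hb : b.eval E s = y) (h : x + y < 2 ^ E.wordSize) :
    (a + b).eval E s = x + y := by
  subst ha hb; exact Nat.mod_eq_of_lt h

theorem eval_mul (ha : a.eval E s = x) (hb : b.eval E s = y) (h : x * y < 2 ^ E.wordSize) :
    (a * b).eval E s = x * y := by
  subst ha hb; exact Nat.mod_eq_of_lt h

theorem eval_sub (ha : a.eval E s = x) (hb : b.eval E s = y) (h : x < 2 ^ E.wordSize) :
    (a - b).eval E s = x - y := by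
  subst ha hb; exact Nat.mod_eq_of_lt ((Nat.sub_le _ _).trans_lt h)

theorem eval_div (ha : a.eval E s = x) (hb : b.eval E s = y) (h : x < 2 ^ E.wordSize) :
    (a / b).eval E s = x / y := by
  subst ha hb; exact Nat.mod_eq_of_lt ((Nat.div_le_self _ _).trans_lt h)

theorem eval_mod (ha : a.eval E s = x) (hb : b.eval E s = y) (h : x < 2 ^ E.wordSize) :
    (a % b).eval E s = x % y := by
  subst ha hb; exact Nat.mod_eq_of_lt ((Nat.mod_le _ _).trans_lt h)

theorem eval_lt (ha : a.eval E s = x) (hb : b.eval E s = y) (h : 1 < 2 ^ E.wordSize) :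
    (a.lt b).eval E s = truth (x < y) := by
  have : (Op.eval .lt x y) % 2 ^ E.wordSize = truth (x < y) := by
    rw [Op.eval, truth]; split_ifs <;> exact Nat.mod_eq_of_lt (by omega)
  subst ha hb; exact this

theorem eval_beq (ha : a.eval E s = x) (hb : b.eval E s = y) (h : 1 < 2 ^ E.wordSize) :
    (a.beq b).eval E s = truth (x = y) := by
  have : (Op.eval .eq x y) % 2 ^ E.wordSize = truth (x = y) := by
    rw [Op.eval, truth]; split_ifs <;> exact Nat.mod_eq_of_lt (by omega)
  subst ha hb; exact this

theorem eval_not {p : Prop} (ha : a.eval E s = truth p) (h : 1 < 2 ^ E.wordSize) :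
    a.not.eval E s = truth (¬ p) := by
  rw [Expr.not, eval_beq ha (eval_ofNat (by omega)) h]
  by_cases hp : p <;> simp [truth, hp]

theorem eval_and {p q : Prop} (ha : a.eval E s = truth p) (hb : b.eval E s = truth q)
    (h : 1 < 2 ^ E.wordSize) : (a.and b).eval E s = truth (p ∧ q) := by
  have hle := Nat.mul_le_mul (truth_le_one p) (truth_le_one q)
  rw [Expr.and, eval_mul ha hb (by omega)]
  by_cases hp : p <;> by_cases hq : q <;> simp [truth, hp, hq]

theorem eval_or {p q : Prop} (ha : a.eval E s = truth p) (hb : b.eval E s = truth q)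
    (h : 2 < 2 ^ E.wordSize) : (a.or b).eval E s = truth (p ∨ q) := by
  have hle := add_le_add (truth_le_one p) (truth_le_one q)
  rw [Expr.or, eval_lt (eval_ofNat (by omega)) (eval_add ha hb (by omega)) (by omega)]
  by_cases hp : p <;> by_cases hq : q <;> simp [truth, hp, hq]

theorem eval_min (ha : a.eval E s = x) (hb : b.eval E s = y) (h : x < 2 ^ E.wordSize) :
    (a.min b).eval E s = min x y := by
  have := eval_sub ha (eval_sub ha hb h) h
  rw [Expr.min, this]; omega

theorem eval_load (ha : a.eval E s = x) : (Expr.load a).eval E s = s.mem x := by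
  subst ha; rfl

theorem eval_charA (ha : a.eval E s = x) : (Expr.charA a).eval E s = E.charA x := by
  subst ha; rfl

theorem eval_charB (ha : a.eval E s = x) : (Expr.charB a).eval E s = E.charB x := by
  subst ha; rfl

end eval

/-- Started in `s`, the program `p` halts after at most `T` steps in a state that satisfies `Q`. -/
def Runs (E : Env) (p : Cmd) (s : State) (T : ℕ) (Q : State → Prop) : Prop :=
  ∃ s' t, Exec E p s s' t ∧ t ≤ T ∧ Q s'

namespace Runs

variable {E : Env} {p q : Cmd} {s : State} {a b : Expr} {T T' : ℕ} {Q Q' : State → Prop}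

theorem mono (h : Runs E p s T Q) (hT : T ≤ T') (hQ : ∀ s', Q s' → Q' s') :
    Runs E p s T' Q' := by
  obtain ⟨s', t, he, ht, hq⟩ := h
  exact ⟨s', t, he, ht.trans hT, hQ _ hq⟩

theorem assign {x v : ℕ} (hv : a.eval E s = v)
    (hQ : Q { s with reg := Function.update s.reg x v }) :
    Runs E (.assign x a) s (a.cost + 1) Q := by
  subst hv; exact ⟨_, _, .assign x a s, le_rfl, hQ⟩

theorem store {u v : ℕ} (hu : a.eval E s = u) (hv : b.eval E s = v)
    (hQ : Q { s with mem := Function.update s.mem u v }) :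
    Runs E (.store a b) s (a.cost + b.cost + 1) Q := by
  subst hu hv; exact ⟨_, _, .store a b s, le_rfl, hQ⟩

theorem rand {x : ℕ} (hQ : Q { s with
      reg := Function.update s.reg x (E.coin s.drawn), drawn := s.drawn + 1 }) :
    Runs E (.rand x) s 1 Q := ⟨_, _, .rand x s, le_rfl, hQ⟩

theorem seq (h : Runs E p s T fun s' => Runs E q s' T' Q) : Runs E (.seq p q) s (T + T') Q := by
  obtain ⟨s', t, he, ht, s'', t', he', ht', hq⟩ := h
  exact ⟨s'', _, .seq he he', by omega, hq⟩

theorem ite (h : a.eval E s ≠ 0 → Runs E p s T Q) (h' : a.eval E s = 0 → Runs E q s T Q) :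
    Runs E (.ite a p q) s (a.cost + 1 + T) Q := by
  by_cases ha : a.eval E s = 0
  · obtain ⟨s', t, he, ht, hq⟩ := h' ha
    exact ⟨s', _, .ite_false ha he, by omega, hq⟩
  · obtain ⟨s', t, he, ht, hq⟩ := h ha
    exact ⟨s', _, .ite_true ha he, by omega, hq⟩

theorem loop (I : ℕ → State → Prop) (N : ℕ) (h0 : I 0 s)
    (step : ∀ j < N, ∀ s, I j s → a.eval E s ≠ 0 ∧ Runs E p s T (I (j + 1)))
    (hend : ∀ s, I N s → a.eval E s = 0 ∧ Q s) :
    Runs E (.while a p) s (N * (a.cost + 1 + T) + (a.cost + 1)) Q := by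
  have key : ∀ m j, j + m = N → ∀ s, I j s →
      Runs E (.while a p) s (m * (a.cost + 1 + T) + (a.cost + 1)) Q := by
    intro m
    induction m with
    | zero =>
      intro j hj s hs
      rw [add_zero] at hj
      subst hj
      exact ⟨s, _, .while_false (hend s hs).1, by omega, (hend s hs).2⟩
    | succ m ih =>
      intro j hj s hs
      obtain ⟨ha, s', t, he, ht, hI⟩ := step j (by omega) s hs
      obtain ⟨s'', t', he', ht', hq⟩ := ih (j + 1) (by omega) s' hI
      exact ⟨s'', _, .while_true ha he he', by rw [Nat.add_mul]; omega, hq⟩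
  exact key N 0 (by omega) s h0

end Runs

/-- The registers below `m` hold the same values in `s` and in `s'`. -/
def AgreeBelow (m : ℕ) (s s' : State) : Prop := ∀ x < m, s'.reg x = s.reg x

namespace AgreeBelow

variable {m m' x v d : ℕ} {mem : ℕ → ℕ} {s s' s'' : State}

theorem refl (m : ℕ) (s : State) : AgreeBelow m s s := fun _ _ => rfl

theorem trans (h : AgreeBelow m s s') (h' : AgreeBelow m s' s'') : AgreeBelow m s s'' :=
  fun x hx => (h' x hx).trans (h x hx)

theorem mono (h : AgreeBelow m s s') (hm : m' ≤ m) : AgreeBelow m' s s' :=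
  fun x hx => h x (hx.trans_le hm)

theorem update (h : AgreeBelow m s s') (hx : m ≤ x) :
    AgreeBelow m s ⟨Function.update s'.reg x v, mem, d⟩ :=
  fun y hy => (Function.update_of_ne (hy.trans_le hx).ne _ _).trans (h y hy)

end AgreeBelow

/-- The loop `for x = 0, …, b - 1 do p`, with `b` evaluated anew before each pass. -/
def forLt (x : ℕ) (b : Expr) (p : Cmd) : Cmd :=
  .seq (.assign x 0) <| .while ((Expr.reg x).lt b) <| .seq p <| .assign x (.reg x + 1)

theorem Runs.forLt {E : Env} {s : State} {x N T : ℕ} {b : Expr} {p : Cmd}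
    (I : ℕ → State → Prop) (hN : N + 1 < 2 ^ E.wordSize)
    (hb : ∀ s', AgreeBelow x s s' → b.eval E s' = N) (h0 : I 0 s)
    (hI : ∀ j s' v, I j s' → I j { s' with reg := Function.update s'.reg x v })
    (step : ∀ j < N, ∀ s', AgreeBelow x s s' → s'.reg x = j → I j s' →
      Runs E p s' T fun s'' => AgreeBelow (x + 1) s' s'' ∧ I (j + 1) s'') :
    Runs E (forLt x b p) s (N * (b.cost + T + 7) + b.cost + 5) fun s' =>
      AgreeBelow x s s' ∧ I N s' := by
  refine Runs.mono (T := 1 + 1 + (N * (b.cost + 2 + 1 + (T + 4)) + (b.cost + 2 + 1)))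
    (.seq <| .assign (eval_ofNat (by omega)) ?_) (by grind) fun _ h => h
  refine (Runs.loop (fun j s' => AgreeBelow x s s' ∧ s'.reg x = j ∧ I j s') N
    (T := T + 4) ?_ ?_ ?_).mono (by simp only [Expr.lt, Expr.cost]; grind) fun _ h => h
  · exact ⟨(AgreeBelow.refl x s).update le_rfl, Function.update_self .., hI 0 s 0 h0⟩
  · rintro j hj s' ⟨hs', hx, hIj⟩
    constructor
    · rw [eval_lt (a := .reg x) hx (hb s' hs') (by omega), truth_true hj]
      exact one_ne_zero
    refine .seq <| (step j hj s' hs' hx hIj).mono le_rfl fun s'' ⟨hs'', hI''⟩ => ?_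
    refine .assign (v := j + 1) (eval_add (a := .reg x) ((hs'' x x.lt_succ_self).trans hx)
      (eval_ofNat (by omega)) (by omega)) ?_
    exact ⟨(hs'.trans (hs''.mono x.le_succ)).update le_rfl, Function.update_self ..,
      hI (j + 1) s'' (j + 1) hI''⟩
  · rintro s' ⟨hs', hx, hIN⟩
    refine ⟨?_, hs', hIN⟩
    rw [eval_lt (a := .reg x) hx (hb s' hs') (by omega), truth_false (lt_irrefl N)]

end WordRAM

/-! ### The dynamic program -/

section DynamicProgram

/-- The running values of a sweep: from one index to the next the value grows by one or drops to
the entry of `f`. -/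
def sweep (v : ℕ) (f : ℕ → ℕ) : ℕ → ℕ
  | 0 => v
  | j + 1 => min (sweep v f j + 1) (f j)

theorem sweep_succ_le (v : ℕ) (f : ℕ → ℕ) {i j : ℕ} (h : i ≤ j) :
    sweep v f (j + 1) ≤ f i + (j - i) := by
  induction j, h using Nat.le_induction with
  | base => simp [sweep]
  | succ j h ih =>
    have : sweep v f (j + 1 + 1) ≤ sweep v f (j + 1) + 1 := min_le_left _ _
    omega

theorem exists_le_sweep_succ {v : ℕ} {f : ℕ → ℕ} (hv : f 0 ≤ v + 1) (j : ℕ) :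
    ∃ i ≤ j, f i + (j - i) ≤ sweep v f (j + 1) := by
  induction j with
  | zero => exact ⟨0, le_rfl, by simpa [sweep] using hv⟩
  | succ j ih =>
    obtain ⟨i, hi, h⟩ := ih
    rcases min_choice (sweep v f (j + 1) + 1) (f (j + 1)) with h' | h'
    · exact ⟨i, by omega, by rw [sweep, h']; omega⟩
    · exact ⟨j + 1, le_rfl, by rw [sweep, h']; omega⟩

theorem sweep_le {v B : ℕ} {f : ℕ → ℕ} (hv : v ≤ B) {j : ℕ} (hf : ∀ i < j, f i ≤ B) :
    sweep v f j ≤ B := by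
  cases j with
  | zero => exact hv
  | succ j => exact (min_le_right _ _).trans (hf j j.lt_succ_self)

/-- On the shifts at most `m`, `f'` is the infimal convolution of `f + c` with the distance: it
arises from `f` by adding the local costs `c` and then allowing every change of shift. -/
structure Relaxed (c : ℕ → ℕ) (m : ℕ) (f f' : ℕ → ℕ) : Prop where
  le : ∀ s ≤ m, ∀ s' ≤ m, f' s ≤ f s' + c s' + Nat.dist s s'
  exists_le : ∀ s ≤ m, ∃ s' ≤ m, f s' + c s' + Nat.dist s s' ≤ f' s

theorem relaxed_sweep {c f f₁ f₂ : ℕ → ℕ} {m : ℕ} (hc : c 0 ≤ 1)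
    (h₁ : ∀ s ≤ m, f₁ s = sweep (f 0) (fun t => f t + c t) (s + 1))
    (h₂ : ∀ s ≤ m, f₂ s = sweep (f₁ m) (fun t => f₁ (m - t)) (m + 1 - s)) :
    Relaxed c m f f₂ where
  le s hs s' hs' := by
    rw [h₂ s hs, show m + 1 - s = m - s + 1 by omega]
    rcases Nat.le_total s' s with h | h
    · refine (sweep_succ_le _ _ le_rfl).trans ?_
      have := sweep_succ_le (f 0) (fun t => f t + c t) h
      rw [show m - (m - s) = s by omega, h₁ s hs]
      unfold Nat.dist; omega
    · refine (sweep_succ_le (i := m - s') _ _ (by omega)).trans ?_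
      have := sweep_succ_le (f 0) (fun t => f t + c t) (le_refl s')
      rw [show m - (m - s') = s' by omega, h₁ s' hs']
      unfold Nat.dist; omega
  exists_le s hs := by
    rw [h₂ s hs, show m + 1 - s = m - s + 1 by omega]
    obtain ⟨i, hi, h⟩ :=
      exists_le_sweep_succ (v := f₁ m) (f := fun t => f₁ (m - t)) (by simp) (m - s)
    obtain ⟨s', hs', h'⟩ := exists_le_sweep_succ (v := f 0) (f := fun t => f t + c t)
      (Nat.add_le_add_left hc _) (m - i)
    rw [h₁ (m - i) (by omega)] at h
    refine ⟨s', by omega, ?_⟩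
    unfold Nat.dist; omega

/-- The table `f` of the dynamic program holds, for every final shift, the least cost of a path on
`x ≤ i < y`. -/
structure IsTable (c : ℕ → ℕ → ℕ) (m x y : ℕ) (f : ℕ → ℕ) : Prop where
  le : ∀ p : ℕ → ℕ, (∀ i, p i ≤ m) → f (p y) ≤ pathCost c p x y
  exists_path : ∀ s ≤ m, ∃ p : ℕ → ℕ, (∀ i, p i ≤ m) ∧ p y = s ∧ pathCost c p x y ≤ f s
  lipschitz : ∀ s ≤ m, ∀ s' ≤ m, f s ≤ f s' + Nat.dist s s'

namespace IsTable

variable {c : ℕ → ℕ → ℕ} {m x y z : ℕ} {f f' : ℕ → ℕ}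

theorem of_eq_zero (c : ℕ → ℕ → ℕ) (x : ℕ) (hf : ∀ s ≤ m, f s = 0) : IsTable c m x x f where
  le p hp := by rw [hf _ (hp x)]; exact Nat.zero_le _
  exists_path s hs := ⟨fun _ => s, fun _ => hs, rfl, by simp [pathCost_self]⟩
  lipschitz s hs s' _ := by rw [hf s hs]; exact Nat.zero_le _

theorem le_minCost_iff (h : IsTable c m x y f) {r : ℕ} :
    r ≤ minCost c m x y ↔ ∀ s ≤ m, r ≤ f s := by
  constructor
  · intro hr s hs
    obtain ⟨p, hp, -, hcost⟩ := h.exists_path s hs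
    exact hr.trans ((minCost_le_pathCost c hp x y).trans hcost)
  · intro hr
    obtain ⟨p, hp, hcost⟩ := exists_pathCost_eq_minCost c m x y
    exact (hr _ (hp y)).trans ((h.le p hp).trans hcost.le)

theorem le_length (h : IsTable c m x y f) (hc : ∀ i s, c i s ≤ 1) {s : ℕ} (hs : s ≤ m) :
    f s ≤ y - x := by
  refine (h.le (fun _ => s) fun _ => hs).trans ?_
  have := Finset.sum_le_card_nsmul (Finset.Ico x y) (fun i => c i s + Nat.dist s s) 1
    fun i _ => by simpa only [Nat.dist_self, add_zero] using hc i s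
  simpa [pathCost] using this

theorem succ (h : IsTable c m x y f) (hxy : x ≤ y) (hr : Relaxed (c y) m f f') :
    IsTable c m x (y + 1) f' where
  le p hp := by
    have hle := h.le p hp
    have hstep := hr.le (p (y + 1)) (hp _) (p y) (hp _)
    rw [pathCost_succ c p hxy, Nat.dist_comm]
    omega
  exists_path s hs := by
    obtain ⟨s', hs', hle⟩ := hr.exists_le s hs
    obtain ⟨p, hp, hpy, hcost⟩ := h.exists_path s' hs'
    refine ⟨fun j => if j ≤ y then p j else s, fun j => ?_, by simp, ?_⟩
    · dsimp only
      split_ifs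
      exacts [hp j, hs]
    · rw [pathCost_succ c _ hxy, pathCost_congr (c' := c) (p' := p) (fun _ _ _ => rfl)
        fun j _ hj => if_pos hj]
      simp only [le_refl, if_true, hpy, Nat.not_succ_le_self, if_false]
      rw [Nat.dist_comm]
      omega
  lipschitz s hs s' hs' := by
    obtain ⟨t, ht, hle⟩ := hr.exists_le s' hs'
    have := hr.le s hs t ht
    have := Nat.dist.triangle_inequality s s' t
    omega

theorem extend (h : IsTable c m x y f) (hxy : x ≤ y) (hyz : y ≤ z)
    (hc : ∀ i, y ≤ i → i < z → c i = 0) : IsTable c m x z f := by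
  induction z, hyz using Nat.le_induction with
  | base => exact h
  | succ z hyz ih =>
    have hz := ih fun i hi hiz => hc i hi (by omega)
    refine hz.succ (hxy.trans hyz) ?_
    rw [hc z hyz (Nat.lt_succ_self z)]
    exact ⟨h.lipschitz, fun s hs => ⟨s, hs, by simp [Nat.dist_self]⟩⟩

theorem step {i g : ℕ} (h : IsTable c m x y f) (hxy : x ≤ y) (hi : y ≤ i) (hig : i < y + g)
    (hc : ∀ j, y ≤ j → j < y + g → j ≠ i → c j = 0) (hr : Relaxed (c i) m f f') :
    IsTable c m x (y + g) f' :=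
  ((h.extend hxy hi fun j hj hji => hc j hj (by omega) (by omega)).succ (hxy.trans hi) hr).extend
    (by omega) (by omega) fun j hj hjg => hc j (by omega) hjg (by omega)

end IsTable

end DynamicProgram

/-! ### Sampling a block -/

namespace WordRAM

-- Registers are numbered by the nesting of the loops: a loop changes no register below its counter,
-- so that `AgreeBelow` describes what it preserves.
namespace Reg

/-- At the start the length of the strings, at the end the answer. -/
abbrev length : ℕ := 0
/-- The parameter `k`. -/
abbrev budget : ℕ := 2
/-- The parameter `ℓ`. -/
abbrev gap : ℕ := 3
/-- The sampled cost from which on a block is flagged. -/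
abbrev threshold : ℕ := 4
/-- The number of repetitions of the search. -/
abbrev reps : ℕ := 5
/-- The powers of two in the computation of the bit length. -/
abbrev power : ℕ := 6
/-- The bound on the modulus of the shifts. -/
abbrev offset : ℕ := 7
/-- The length of the groups, from each of which one position is sampled. -/
abbrev groupLen : ℕ := 8
/-- The number of groups in a block of the lowest level. -/
abbrev baseGroups : ℕ := 9
/-- The number of blocks sampled on the highest level. -/
abbrev topSamples : ℕ := 10
/-- The length of the blocks of the highest level, relative to those of the lowest one. -/
abbrev topFactor : ℕ := 11
/-- The number of blocks of the highest level. -/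
abbrev topBlocks : ℕ := 12
/-- The counter of the repetitions. -/
abbrev rep : ℕ := 13
/-- Whether one of the repetitions flagged no block. -/
abbrev clean : ℕ := 14
/-- The length of the blocks of the highest level, relative to those of the current one. -/
abbrev factor : ℕ := 15
/-- The number of groups in a block of the current level. -/
abbrev groups : ℕ := 16
/-- The counter of the blocks sampled on the current level. -/
abbrev sample : ℕ := 17
/-- Whether the current repetition has flagged a block. -/
abbrev hit : ℕ := 18
/-- The first position of the current block. -/
abbrev start : ℕ := 19
/-- The counter of the groups of the current block. -/
abbrev group : ℕ := 20
/-- The sampled position in the current group. -/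
abbrev pos : ℕ := 21
/-- The current shift, which is also the address of its table entry. -/
abbrev shift : ℕ := 22
/-- Whether the current block is flagged. -/
abbrev flag : ℕ := 23
/-- The running value of a sweep through the table. -/
abbrev value : ℕ := 24

end Reg

/-- The number of entries of the table: the cell `t` belongs to the shift by `t - offset`. -/
def tableSize : Expr := .reg Reg.offset + .reg Reg.offset + 1

/-- Whether the characters at the current position of the first string and, with the current shift,
of the second string differ. -/
def mismatchExpr : Expr :=
  1 - (Expr.charA (.reg Reg.pos)).beq (.charB (.reg Reg.pos + .reg Reg.shift - .reg Reg.offset))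

/-- Sets the table to `0`. -/
def clearTable : Cmd := forLt Reg.shift tableSize <| .store (.reg Reg.shift) 0

/-- Adds the mismatches at the current position and relaxes the table upwards. -/
def upSweep : Cmd :=
  .seq (.assign Reg.value (.load 0)) <| forLt Reg.shift tableSize <|
    .seq (.assign Reg.value
      ((.reg Reg.value + 1 : Expr).min (.load (.reg Reg.shift) + mismatchExpr))) <|
    .store (.reg Reg.shift) (.reg Reg.value)

/-- Relaxes the table downwards. -/
def downSweep : Cmd :=
  .seq (.assign Reg.shift tableSize) <|
  .seq (.assign Reg.value (.load (.reg Reg.offset + .reg Reg.offset))) <|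
  .while (.reg Reg.shift) <|
    .seq (.assign Reg.shift (.reg Reg.shift - 1)) <|
    .seq (.assign Reg.value ((.reg Reg.value + 1 : Expr).min (.load (.reg Reg.shift)))) <|
    .store (.reg Reg.shift) (.reg Reg.value)

/-- Tests whether all table entries reach the threshold. -/
def checkTable : Cmd :=
  .seq (.assign Reg.flag 1) <| forLt Reg.shift tableSize <|
    .assign Reg.flag
      ((Expr.reg Reg.flag).and ((Expr.load (.reg Reg.shift)).lt (.reg Reg.threshold)).not)

/-- Adds the mismatches at the current position and allows every change of shift. -/
def relaxTable : Cmd := .seq upSweep downSweep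

/-- One step of the dynamic program, at a random position of the current group. -/
def testGroup : Cmd :=
  .seq (.rand Reg.pos) <|
  .seq (.assign Reg.pos (.reg Reg.start + .reg Reg.group * .reg Reg.groupLen +
    .reg Reg.pos % .reg Reg.groupLen)) relaxTable

/-- The dynamic program on a sample of the current block, and the test of its result. -/
def testBlock : Cmd :=
  .seq clearTable <| .seq (forLt Reg.group (.reg Reg.groups) testGroup) checkTable

section tables

variable {E : Env} {s : State} {k : ℕ}

theorem eval_tableSize (h : s.reg Reg.offset = k) (hW : 2 * k + 1 < 2 ^ E.wordSize) :
    tableSize.eval E s = 2 * k + 1 := by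
  rw [tableSize, eval_add (eval_add (a := .reg _) (b := .reg _) h h (by omega))
    (eval_ofNat (by omega)) (by omega), two_mul]

theorem eval_mismatchExpr {i t : ℕ} (hpos : s.reg Reg.pos = i) (hshift : s.reg Reg.shift = t)
    (hoffset : s.reg Reg.offset = k) (hW : i + t + 1 < 2 ^ E.wordSize) :
    mismatchExpr.eval E s = mismatch E.charA E.charB k i t := by
  have hA := eval_charA (E := E) (a := .reg _) hpos
  have hB := eval_charB (E := E) (eval_sub (eval_add (a := .reg _) (b := .reg _) hpos hshift
    (by omega)) (b := .reg _) hoffset (by omega))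
  rw [mismatchExpr, eval_sub (eval_ofNat (by omega)) (eval_beq hA hB (by omega)) (by omega),
    mismatch, truth]
  split_ifs <;> rfl

theorem clearTable_runs (hoffset : s.reg Reg.offset = k) (hW : 2 * k + 2 < 2 ^ E.wordSize) :
    Runs E clearTable s (100 * (2 * k + 1)) fun s' =>
      AgreeBelow Reg.shift s s' ∧ s'.drawn = s.drawn ∧ ∀ t ≤ 2 * k, s'.mem t = 0 := by
  refine (Runs.forLt (fun j s' => s'.drawn = s.drawn ∧ ∀ t < j, s'.mem t = 0) (N := 2 * k + 1)
    (T := 3) hW (fun s' h => eval_tableSize ((h _ (by decide)).trans hoffset) (by omega))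
    ⟨rfl, fun t ht => by omega⟩ (fun _ _ _ h => h) ?_).mono ?_
    fun s' ⟨h, hd, hm⟩ => ⟨h, hd, fun t ht => hm t (by omega)⟩
  · rintro j - s' - hj ⟨hd, hm⟩
    refine Runs.store (b := 0) (u := j) (v := 0) hj (eval_ofNat (by omega)) ⟨fun _ _ => rfl, hd, ?_⟩
    intro t ht
    by_cases htj : t = j
    · simp [htj]
    · simpa [Function.update, htj] using hm t (by omega)
  · rw [show tableSize.cost = 5 from rfl]; omega

theorem upSweep_runs {i B : ℕ} (hoffset : s.reg Reg.offset = k) (hpos : s.reg Reg.pos = i)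
    (hB : ∀ t ≤ 2 * k, s.mem t ≤ B) (hW : i + 2 * k + B + 3 < 2 ^ E.wordSize) :
    Runs E upSweep s (100 * (2 * k + 1)) fun s' =>
      AgreeBelow Reg.shift s s' ∧ s'.drawn = s.drawn ∧ ∀ t ≤ 2 * k, s'.mem t =
        sweep (s.mem 0) (fun t => s.mem t + mismatch E.charA E.charB k i t) (t + 1) := by
  set v := sweep (s.mem 0) (fun t => s.mem t + mismatch E.charA E.charB k i t)
  have hvB : ∀ j ≤ 2 * k + 1, v j ≤ B + 1 := fun j hj =>
    sweep_le ((hB 0 (by omega)).trans (by omega)) fun t ht =>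
      add_le_add (hB t (by omega)) (mismatch_le_one _ _ _ _ _)
  refine (Runs.seq (Runs.assign (v := s.mem 0) (eval_load (eval_ofNat (by omega))) <|
    Runs.forLt (x := Reg.shift) (fun j s' => s'.drawn = s.drawn ∧ s'.reg Reg.value = v j ∧
      (∀ t < j, s'.mem t = v (t + 1)) ∧ ∀ t, j ≤ t → s'.mem t = s.mem t) (N := 2 * k + 1)
    (T := 26) (by omega) ?_ ⟨rfl, rfl, fun t ht => by omega, fun t _ => rfl⟩
    (fun _ _ _ h => h) ?_)).mono ?_ ?_
  · exact fun s' h => eval_tableSize ((h _ (by decide)).trans hoffset) (by omega)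
  · rintro j hj s' hs' hshift ⟨hd, hvalue, hlt, hge⟩
    have hBj := hB j (by omega)
    have hvj := hvB j hj.le
    have hstep := mismatch_le_one E.charA E.charB k i j
    refine .seq (.assign (v := v (j + 1)) ?_ ?_) (T := 23) (T' := 3)
    · refine (eval_min (eval_add (a := .reg _) hvalue (eval_ofNat (by omega)) (by omega))
        (eval_add (eval_load (a := .reg _) hshift) (eval_mismatchExpr
          ((hs' _ (by decide)).trans hpos) hshift ((hs' _ (by decide)).trans hoffset) (by omega))
          (by rw [hge j le_rfl]; omega)) (by omega)).trans ?_
      rw [hge j le_rfl]; rfl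
    · refine .store (u := j) (v := v (j + 1)) hshift rfl
        ⟨(AgreeBelow.refl _ _).update (by decide), hd, rfl, fun t ht => ?_, fun t ht => ?_⟩
      · by_cases htj : t = j
        · simp [htj]
        · simpa [Function.update, htj] using hlt t (by omega)
      · simpa [Function.update, show t ≠ j by omega] using hge t (by omega)
  · rw [show tableSize.cost = 5 from rfl, show (Expr.load 0).cost = 2 from rfl]; omega
  · exact fun s' ⟨h, hd, _, hm, _⟩ =>
      ⟨((AgreeBelow.refl _ _).update (by decide)).trans h, hd, fun t ht => hm t (by omega)⟩

theorem downSweep_runs {B : ℕ} (hoffset : s.reg Reg.offset = k) (hB : ∀ t ≤ 2 * k, s.mem t ≤ B)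
    (hW : 2 * k + B + 2 < 2 ^ E.wordSize) :
    Runs E downSweep s (100 * (2 * k + 1)) fun s' =>
      AgreeBelow Reg.shift s s' ∧ s'.drawn = s.drawn ∧ ∀ t ≤ 2 * k, s'.mem t =
        sweep (s.mem (2 * k)) (fun t => s.mem (2 * k - t)) (2 * k + 1 - t) := by
  set v := sweep (s.mem (2 * k)) (fun t => s.mem (2 * k - t))
  have hvB : ∀ j ≤ 2 * k + 1, v j ≤ B := fun j hj =>
    sweep_le (hB _ le_rfl) fun t _ => hB _ (by omega)
  have hlast : (Expr.load (.reg Reg.offset + .reg Reg.offset)).eval E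
      { s with reg := Function.update s.reg Reg.shift (2 * k + 1) } = v 0 := by
    refine (eval_load (eval_add (a := .reg _) (b := .reg _) hoffset hoffset (by omega))).trans ?_
    rw [← two_mul]
    rfl
  refine (Runs.seq (.assign (eval_tableSize hoffset (by omega)) <| .seq <| .assign hlast <|
    Runs.loop (fun j s' => AgreeBelow Reg.shift s s' ∧ s'.drawn = s.drawn ∧
      s'.reg Reg.shift = 2 * k + 1 - j ∧ s'.reg Reg.value = v j ∧
      (∀ t ≤ 2 * k, 2 * k + 1 - j ≤ t → s'.mem t = v (2 * k + 1 - t)) ∧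
      ∀ t, t < 2 * k + 1 - j → s'.mem t = s.mem t) (2 * k + 1) (T := 4 + (11 + 3))
      ⟨((AgreeBelow.refl _ s).update le_rfl).update (by decide), rfl, rfl, rfl,
        fun t ht ht' => by omega, fun t _ => rfl⟩ ?_ ?_)).mono ?_ fun _ h => h
  · rintro j hj s' ⟨hs', hd, hshift, hvalue, hge, hlt⟩
    have hvj := hvB j hj.le
    have hmem : s'.mem (2 * k - j) = s.mem (2 * k - j) := hlt _ (by omega)
    refine ⟨hshift.trans_ne (by omega), .seq <| .assign (v := 2 * k - j) ?_ <| .seq <|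
      .assign (v := v (j + 1)) ?_ <| Runs.store (u := 2 * k - j) (v := v (j + 1)) rfl rfl ?_⟩
    · rw [eval_sub (a := .reg _) hshift (eval_ofNat (by omega)) (by omega)]; omega
    · exact eval_min (x := v j + 1) (y := s.mem (2 * k - j))
        (eval_add (a := .reg _) hvalue (eval_ofNat (by omega)) (by omega))
        ((eval_load (a := .reg _) rfl).trans hmem) (by omega)
    · refine ⟨(hs'.update le_rfl).update (by decide), hd, ?_, rfl, fun t ht ht' => ?_,
        fun t ht => ?_⟩
      · exact show 2 * k - j = 2 * k + 1 - (j + 1) by omega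
      · rcases eq_or_ne t (2 * k - j) with rfl | htj
        · rw [show 2 * k + 1 - (2 * k - j) = j + 1 by omega]
          simp
        · simpa [Function.update, htj] using hge t ht (by omega)
      · simpa [Function.update, show t ≠ 2 * k - j by omega] using hlt t (by omega)
  · rintro s' ⟨hs', hd, hshift, _, hge, _⟩
    exact ⟨hshift.trans (by omega), hs', hd, fun t ht => hge t ht (by omega)⟩
  · simp only [show tableSize.cost = 5 from rfl,
      show (Expr.load (.reg Reg.offset + .reg Reg.offset)).cost = 4 from rfl,
      show (Expr.reg Reg.shift).cost = 1 from rfl]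
    omega

theorem checkTable_runs {r : ℕ} (hoffset : s.reg Reg.offset = k)
    (hthreshold : s.reg Reg.threshold = r) (hW : 2 * k + 2 < 2 ^ E.wordSize) :
    Runs E checkTable s (100 * (2 * k + 1)) fun s' =>
      AgreeBelow Reg.shift s s' ∧ s'.drawn = s.drawn ∧
        s'.reg Reg.flag = truth (∀ t ≤ 2 * k, r ≤ s.mem t) := by
  refine (Runs.seq (.assign (eval_ofNat (by omega)) <|
    Runs.forLt (x := Reg.shift) (fun j s' => s'.drawn = s.drawn ∧ s'.mem = s.mem ∧
      s'.reg Reg.flag = truth (∀ t < j, r ≤ s.mem t)) (N := 2 * k + 1) (T := 9) (by omega) ?_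
    ⟨rfl, rfl, by simp [truth]⟩ (fun _ _ _ h => h) ?_)).mono ?_ ?_
  · exact fun s' h => eval_tableSize ((h _ (by decide)).trans hoffset) (by omega)
  · rintro j - s' hs' hshift ⟨hd, hmem, hflag⟩
    refine .assign (eval_and (a := .reg _) hflag (eval_not (eval_lt (eval_load (a := .reg _) hshift)
      (b := .reg _) ((hs' _ (by decide)).trans hthreshold) (by omega)) (by omega)) (by omega))
      ⟨(AgreeBelow.refl _ _).update (by decide), hd, hmem, truth_congr ?_⟩
    rw [hmem, not_lt, Nat.forall_lt_succ_right]
  · rw [show tableSize.cost = 5 from rfl, show (1 : Expr).cost = 1 from rfl]; omega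
  · exact fun s' ⟨h, hd, _, hflag⟩ => ⟨((AgreeBelow.refl _ _).update (by decide)).trans h, hd,
      hflag.trans (truth_congr (by simp only [Nat.lt_succ_iff]))⟩

theorem relaxTable_runs {i B : ℕ} (hoffset : s.reg Reg.offset = k) (hpos : s.reg Reg.pos = i)
    (hB : ∀ t ≤ 2 * k, s.mem t ≤ B) (hW : i + 2 * k + B + 3 < 2 ^ E.wordSize) :
    Runs E relaxTable s (200 * (2 * k + 1)) fun s' =>
      AgreeBelow Reg.shift s s' ∧ s'.drawn = s.drawn ∧
        Relaxed (mismatch E.charA E.charB k i) (2 * k) s.mem s'.mem := by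
  refine (Runs.seq <| (upSweep_runs hoffset hpos hB hW).mono le_rfl fun s₁ ⟨hs₁, hd₁, hm₁⟩ =>
    (downSweep_runs (B := B + 1) ((hs₁ _ (by decide)).trans hoffset) (fun t ht => ?_)
      (by omega)).mono le_rfl fun s₂ ⟨hs₂, hd₂, hm₂⟩ => ⟨hs₁.trans hs₂, hd₂.trans hd₁,
        relaxed_sweep (mismatch_le_one _ _ _ _ _) hm₁ hm₂⟩).mono (by omega) fun _ h => h
  rw [hm₁ t ht]
  exact (min_le_right _ _).trans (add_le_add (hB t ht) (mismatch_le_one _ _ _ _ _))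

theorem testGroup_runs {x γ g B : ℕ} (hoffset : s.reg Reg.offset = k)
    (hstart : s.reg Reg.start = x) (hgroup : s.reg Reg.group = γ)
    (hgroupLen : s.reg Reg.groupLen = g) (hg : 0 < g) (hB : ∀ t ≤ 2 * k, s.mem t ≤ B)
    (hW : x + (γ + 1) * g + 2 * k + B + 3 < 2 ^ E.wordSize) :
    Runs E testGroup s (211 * (2 * k + 1)) fun s' =>
      AgreeBelow Reg.pos s s' ∧ s'.drawn = s.drawn + 1 ∧
        Relaxed (mismatch E.charA E.charB k (x + γ * g + E.coin s.drawn % g)) (2 * k)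
          s.mem s'.mem := by
  have hmod : (E.coin s.drawn : ℕ) % g < g := Nat.mod_lt _ hg
  rw [add_one_mul] at hW
  refine (Runs.seq <| .rand <| .seq <| .assign (v := x + γ * g + E.coin s.drawn % g) ?_ ?_).mono
    (T := 1 + (10 + 200 * (2 * k + 1))) (by omega) fun _ h => h
  · exact eval_add (eval_add (a := .reg _) hstart (eval_mul (a := .reg _) (b := .reg _) hgroup
      hgroupLen (by omega)) (by omega)) (eval_mod (a := .reg _) (b := .reg _) rfl hgroupLen
        (E.coin s.drawn).isLt) (by omega)
  · refine (relaxTable_runs (k := k) (i := x + γ * g + E.coin s.drawn % g) (B := B)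
      ?_ rfl ?_ (by omega)).mono le_rfl ?_
    · exact hoffset
    · exact hB
    exact fun s' ⟨hs', hd, hr⟩ => ⟨(((AgreeBelow.refl _ s).update le_rfl).update le_rfl).trans
      (hs'.mono (by decide)), hd, hr⟩

end tables

/-- The positions that the test of a block samples: one from each of the `G` groups of length `g`
from `x` on, chosen by the words with the indices `D + γ`. -/
def sampled (coin : ℕ → ℕ) (D x g G : ℕ) : Set ℕ :=
  {i | ∃ γ < G, i = x + γ * g + coin (D + γ) % g}

theorem mem_sampled_iff {coin : ℕ → ℕ} {D x g G γ j : ℕ} (hγ : γ < G) (hj : x + γ * g ≤ j)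
    (hj' : j < x + (γ + 1) * g) :
    j ∈ sampled coin D x g G ↔ j = x + γ * g + coin (D + γ) % g := by
  refine ⟨?_, fun h => ⟨γ, hγ, h⟩⟩
  rintro ⟨γ', -, rfl⟩
  rw [add_one_mul] at hj'
  have hmod : coin (D + γ') % g < g := Nat.mod_lt _ (by omega)
  obtain rfl : γ' = γ := by
    rcases lt_trichotomy γ' γ with h | h | h
    · have := Nat.mul_le_mul_right g (Nat.succ_le_of_lt h)
      rw [Nat.succ_mul] at this; omega
    · exact h
    · have := Nat.mul_le_mul_right g (Nat.succ_le_of_lt h)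
      rw [Nat.succ_mul] at this; omega
  rfl

theorem isTable_step_sampled {coin : ℕ → ℕ} {D x g G γ m : ℕ} {c : ℕ → ℕ → ℕ} {f f' : ℕ → ℕ}
    (hg : 0 < g) (hγ : γ < G) (h : IsTable ((sampled coin D x g G).indicator c) m x (x + γ * g) f)
    (hr : Relaxed (c (x + γ * g + coin (D + γ) % g)) m f f') :
    IsTable ((sampled coin D x g G).indicator c) m x (x + (γ + 1) * g) f' := by
  have hmod : coin (D + γ) % g < g := Nat.mod_lt _ hg
  rw [add_one_mul, ← add_assoc]
  refine h.step (i := x + γ * g + coin (D + γ) % g) (by omega) (by omega) (by omega)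
    (fun j hj hjg hne => Set.indicator_of_notMem ?_ c) ?_
  · rwa [mem_sampled_iff hγ hj (by rw [add_one_mul]; omega)]
  · rwa [Set.indicator_of_mem (show _ ∈ sampled coin D x g G from ⟨γ, hγ, rfl⟩)]

theorem indicator_mismatch_le_one (S : Set ℕ) (f g : ℕ → ℕ) (k i t : ℕ) :
    S.indicator (mismatch f g k) i t ≤ 1 := by
  by_cases hi : i ∈ S
  · rw [Set.indicator_of_mem hi]; exact mismatch_le_one _ _ _ _ _
  · rw [Set.indicator_of_notMem hi]; exact Nat.zero_le _

variable {E : Env} {s : State} {k r x g G : ℕ}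

theorem testGroups_runs {S : Set ℕ} (hS : S = sampled (fun i => E.coin i) s.drawn x g G)
    (hoffset : s.reg Reg.offset = k) (hstart : s.reg Reg.start = x)
    (hgroupLen : s.reg Reg.groupLen = g) (hgroups : s.reg Reg.groups = G) (hg : 0 < g)
    (hmem : ∀ t ≤ 2 * k, s.mem t = 0) (hW : x + 2 * (G * g) + 2 * k + 3 < 2 ^ E.wordSize) :
    Runs E (forLt Reg.group (.reg Reg.groups) testGroup) s
      (G * (1 + 211 * (2 * k + 1) + 7) + 1 + 5) fun s' =>
        AgreeBelow Reg.group s s' ∧ s'.drawn = s.drawn + G ∧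
          IsTable (S.indicator (mismatch E.charA E.charB k)) (2 * k) x (x + G * g) s'.mem := by
  have hGg : G ≤ G * g := Nat.le_mul_of_pos_right G hg
  refine Runs.forLt (fun γ s' => s'.drawn = s.drawn + γ ∧
      IsTable (S.indicator (mismatch E.charA E.charB k)) (2 * k) x (x + γ * g) s'.mem)
    (by omega) (fun s' h => (h _ (by decide)).trans hgroups) ⟨rfl, ?_⟩ (fun _ _ _ h => h) ?_
  · simpa using IsTable.of_eq_zero _ x hmem
  · rintro γ hγ s' hs' hgroup ⟨hd, htable⟩
    have hlast : (γ + 1) * g ≤ G * g := Nat.mul_le_mul_right g hγ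
    refine (testGroup_runs (B := G * g) ((hs' _ (by decide)).trans hoffset)
      ((hs' _ (by decide)).trans hstart) hgroup ((hs' _ (by decide)).trans hgroupLen) hg
      (fun t ht => ?_) (by omega)).mono le_rfl
        fun s'' ⟨hs'', hd'', hr⟩ => ⟨hs'', by rw [hd'', hd, add_assoc], ?_⟩
    · have := htable.le_length (indicator_mismatch_le_one S _ _ _) ht
      rw [add_one_mul] at hlast
      omega
    · subst hS
      rw [hd] at hr
      exact isTable_step_sampled (coin := fun i => E.coin i) hg hγ htable hr

theorem testBlock_runs (hoffset : s.reg Reg.offset = k) (hthreshold : s.reg Reg.threshold = r)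
    (hstart : s.reg Reg.start = x) (hgroupLen : s.reg Reg.groupLen = g)
    (hgroups : s.reg Reg.groups = G) (hg : 0 < g)
    (hW : x + 2 * (G * g) + 2 * k + 3 < 2 ^ E.wordSize) :
    Runs E testBlock s ((G + 1) * (220 * (2 * k + 1))) fun s' =>
      AgreeBelow Reg.group s s' ∧ s'.drawn = s.drawn + G ∧
        s'.reg Reg.flag = truth (r ≤ minCost ((sampled (fun i => E.coin i) s.drawn x g G).indicator
          (mismatch E.charA E.charB k)) (2 * k) x (x + G * g)) := by
  refine Runs.mono (Runs.seq <| (clearTable_runs hoffset (by omega)).mono le_rfl ?_)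
      (T := 100 * (2 * k + 1) + (G * (1 + 211 * (2 * k + 1) + 7) + 1 + 5 + 100 * (2 * k + 1)))
      (by ring_nf; omega) fun _ h => h
  rintro s₁ ⟨hs₁, hd₁, hm₁⟩
  refine .seq <| (testGroups_runs (by rw [hd₁]) ((hs₁ _ (by decide)).trans hoffset)
    ((hs₁ _ (by decide)).trans hstart) ((hs₁ _ (by decide)).trans hgroupLen)
    ((hs₁ _ (by decide)).trans hgroups) hg hm₁ hW).mono le_rfl ?_
  rintro s₂ ⟨hs₂, hd₂, htable⟩
  have hs := (hs₁.mono (m' := Reg.group) (by decide)).trans hs₂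
  refine (checkTable_runs ((hs _ (by decide)).trans hoffset) ((hs _ (by decide)).trans hthreshold)
    (by omega)).mono le_rfl fun s₃ ⟨hs₃, hd₃, hflag⟩ =>
      ⟨hs.trans (hs₃.mono (by decide)), by rw [hd₃, hd₂, hd₁], ?_⟩
  rw [hflag]
  exact truth_congr htable.le_minCost_iff.symm

/-! ### The search -/

/-- The numerical parameters of the search. -/
structure Params where
  /-- the sampled cost from which on a block is flagged -/
  r : ℕ
  /-- the bound on the modulus of the shifts -/
  K : ℕ
  /-- the length of a group -/
  g : ℕ
  /-- the number of groups in a block of level `0` -/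
  G : ℕ
  /-- the highest level -/
  U : ℕ
  /-- the number of blocks of level `U` -/
  J : ℕ
  /-- the number of blocks sampled on level `U` -/
  L : ℕ
  /-- the number of repetitions -/
  R : ℕ

namespace Params

variable (P : Params)

/-- The number of groups in a block of level `u`. -/
def groups (u : ℕ) : ℕ := P.G * 2 ^ u

/-- The length of a block of level `u`. -/
def len (u : ℕ) : ℕ := P.groups u * P.g

/-- The number of blocks of level `u`. -/
def blocks (u : ℕ) : ℕ := P.J * 2 ^ (P.U - u)

/-- The number of blocks sampled on level `u`. -/
def samples (u : ℕ) : ℕ := 2 ^ (P.U - u) * P.L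

/-- The number of random words drawn on the levels below `u`. -/
def drawnBelow (u : ℕ) : ℕ := ∑ v ∈ Finset.range u, P.samples v * (1 + P.groups v)

/-- The number of random words drawn in one run of the search. -/
def period : ℕ := P.drawnBelow (P.U + 1)

/-- The first position of the block that the random word `v` selects on level `u`. -/
def blockStart (u v : ℕ) : ℕ := v % P.blocks u * P.len u

/-- The block of level `u` that is sampled with the random words from index `D` on is flagged. -/
def SampleHit (c : ℕ → ℕ → ℕ) (coin : ℕ → ℕ) (u D : ℕ) : Prop :=
  P.r ≤ minCost ((sampled coin (D + 1) (P.blockStart u (coin D)) P.g (P.groups u)).indicator c)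
    (2 * P.K) (P.blockStart u (coin D)) (P.blockStart u (coin D) + P.len u)

/-- Some block is flagged in the run of the search that uses the random words from index `D` on. -/
def SearchHit (c : ℕ → ℕ → ℕ) (coin : ℕ → ℕ) (D : ℕ) : Prop :=
  ∃ u ≤ P.U, ∃ a < P.samples u, P.SampleHit c coin u (D + P.drawnBelow u + a * (1 + P.groups u))

/-- The registers of `s` hold the parameters `P`. -/
structure Loaded (s : State) : Prop where
  threshold : s.reg Reg.threshold = P.r
  reps : s.reg Reg.reps = P.R
  offset : s.reg Reg.offset = P.K
  groupLen : s.reg Reg.groupLen = P.g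
  baseGroups : s.reg Reg.baseGroups = P.G
  topSamples : s.reg Reg.topSamples = P.L
  topFactor : s.reg Reg.topFactor = 2 ^ P.U
  topBlocks : s.reg Reg.topBlocks = P.J

/-- The parameters are positive, and small enough for the search not to overflow words below
`W`. -/
structure Fits (W : ℕ) : Prop where
  g_pos : 0 < P.g
  G_pos : 0 < P.G
  K_pos : 0 < P.K
  J_pos : 0 < P.J
  total_lt : P.J * P.len P.U + 2 * P.len P.U + 2 * P.K + 10 < W
  samples_lt : 2 ^ P.U * P.L + 1 < W
  reps_lt : P.R + 1 < W

variable {P} {s s' : State} {u W : ℕ}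

theorem Loaded.congr (h : P.Loaded s) (hs : AgreeBelow Reg.rep s s') : P.Loaded s' where
  threshold := (hs _ (by decide)).trans h.threshold
  reps := (hs _ (by decide)).trans h.reps
  offset := (hs _ (by decide)).trans h.offset
  groupLen := (hs _ (by decide)).trans h.groupLen
  baseGroups := (hs _ (by decide)).trans h.baseGroups
  topSamples := (hs _ (by decide)).trans h.topSamples
  topFactor := (hs _ (by decide)).trans h.topFactor
  topBlocks := (hs _ (by decide)).trans h.topBlocks

theorem two_pow_mul_groups (hu : u ≤ P.U) : 2 ^ (P.U - u) * P.groups u = P.groups P.U := by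
  rw [groups, groups, mul_left_comm, ← pow_add, Nat.sub_add_cancel hu]

theorem blocks_mul_len (hu : u ≤ P.U) : P.blocks u * P.len u = P.J * P.len P.U := by
  rw [blocks, len, len, mul_assoc, ← mul_assoc _ (P.groups u), two_pow_mul_groups hu]

theorem len_le (hu : u ≤ P.U) : P.len u ≤ P.len P.U := by
  rw [len, len, ← two_pow_mul_groups hu, mul_assoc]
  exact Nat.le_mul_of_pos_left _ (by positivity)

namespace Fits

theorem groups_pos (h : P.Fits W) (u : ℕ) : 0 < P.groups u :=
  Nat.mul_pos h.G_pos (by positivity)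

theorem len_pos (h : P.Fits W) (u : ℕ) : 0 < P.len u :=
  Nat.mul_pos (h.groups_pos u) h.g_pos

theorem blocks_pos (h : P.Fits W) (u : ℕ) : 0 < P.blocks u :=
  Nat.mul_pos h.J_pos (by positivity)

theorem blocks_lt (h : P.Fits W) (hu : u ≤ P.U) : P.blocks u < W := by
  have := h.total_lt
  have := blocks_mul_len hu ▸ Nat.le_mul_of_pos_right (P.blocks u) (h.len_pos u)
  omega

theorem blockStart_add_lt (h : P.Fits W) (hu : u ≤ P.U) (v : ℕ) :
    P.blockStart u v + 2 * P.len u + 2 * P.K + 3 < W := by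
  have := h.total_lt
  have := len_le hu
  have := blocks_mul_len hu ▸
    Nat.mul_le_mul_right (P.len u) (Nat.mod_lt v (h.blocks_pos u)).le
  rw [blockStart]; omega

end Fits

end Params

/-- Tests a random block of the current level, and sets `Reg.hit` if it is flagged. -/
def sampleBlock : Cmd :=
  .seq (.rand Reg.start) <|
  .seq (.assign Reg.start (.reg Reg.start % (.reg Reg.topBlocks * .reg Reg.factor) *
    (.reg Reg.groups * .reg Reg.groupLen))) <|
  .seq testBlock <|
  .assign Reg.hit ((Expr.reg Reg.hit).or (.reg Reg.flag))

/-- Tests the blocks sampled on the current level. -/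
def sampleLevel : Cmd := forLt Reg.sample (.reg Reg.factor * .reg Reg.topSamples) sampleBlock

/-- Tests the blocks sampled on the current level, and passes to the next level. -/
def searchLevel : Cmd :=
  .seq sampleLevel <|
  .seq (.assign Reg.factor (.reg Reg.factor / 2)) <|
  .assign Reg.groups (.reg Reg.groups + .reg Reg.groups)

/-- Runs through the levels, from the smallest blocks to the largest ones. -/
def search : Cmd :=
  .seq (.assign Reg.factor (.reg Reg.topFactor)) <|
  .seq (.assign Reg.groups (.reg Reg.baseGroups)) <|
  .while (.reg Reg.factor) searchLevel

/-- Repeats the search, and sets `Reg.clean` if one of the runs flags no block. -/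
def repeatSearch : Cmd :=
  .seq (.assign Reg.clean 0) <| forLt Reg.rep (.reg Reg.reps) <|
    .seq (.assign Reg.hit 0) <|
    .seq search <|
    .assign Reg.clean ((Expr.reg Reg.clean).or (Expr.reg Reg.hit).not)

namespace Params

variable (P : Params)

/-- A bound on the time that the search spends on the samples of one level. -/
def levelTime : ℕ := 1350 * (P.L * P.groups P.U * P.K) + 8

/-- A bound on the time of one run of the search. -/
def searchTime : ℕ := (P.U + 1) * (P.levelTime + 10) + 6

/-- A bound on the time of all runs of the search. -/
def repeatTime : ℕ := P.R * (P.searchTime + 18) + 8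

variable {P} {E : Env} {s : State} {u : ℕ}

theorem samples_mul_le_levelTime {W : ℕ} (hF : P.Fits W) (hu : u ≤ P.U) :
    P.samples u * (3 + ((P.groups u + 1) * (220 * (2 * P.K + 1)) + 17) + 7) + 3 + 5 ≤
      P.levelTime := by
  have hG := hF.groups_pos u
  have hK := hF.K_pos
  have hGK : 1 ≤ P.groups u * P.K := Nat.mul_pos hG hK
  have hblock := Nat.mul_le_mul (show P.groups u + 1 ≤ 2 * P.groups u by omega)
    (show 220 * (2 * P.K + 1) ≤ 660 * P.K by omega)
  calc _ ≤ P.samples u * (1350 * (P.groups u * P.K)) + 8 :=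
        Nat.add_le_add_right (Nat.mul_le_mul_left _ (by linarith)) 8
    _ = P.levelTime := by rw [levelTime, ← two_pow_mul_groups hu, samples]; ring

theorem sampleBlock_runs (hP : P.Loaded s) (hF : P.Fits (2 ^ E.wordSize)) (hu : u ≤ P.U)
    (hfactor : s.reg Reg.factor = 2 ^ (P.U - u)) (hgroups : s.reg Reg.groups = P.groups u)
    {q : Prop} (hhit : s.reg Reg.hit = truth q) :
    Runs E sampleBlock s ((P.groups u + 1) * (220 * (2 * P.K + 1)) + 17) fun s' =>
      AgreeBelow Reg.hit s s' ∧ s'.drawn = s.drawn + (1 + P.groups u) ∧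
        s'.reg Reg.hit = truth (q ∨
          P.SampleHit (mismatch E.charA E.charB P.K) (fun i => E.coin i) u s.drawn) := by
  have hstart := hF.blockStart_add_lt hu (E.coin s.drawn)
  refine (Runs.seq <| .rand <| .seq <| .assign (v := P.blockStart u (E.coin s.drawn)) ?_ <|
    .seq ?_).mono (T := 1 + (10 + ((P.groups u + 1) * (220 * (2 * P.K + 1)) + 6)))
      (by omega) fun _ h => h
  · exact eval_mul (eval_mod (a := .reg _) rfl (eval_mul (a := .reg _) (b := .reg _) hP.topBlocks
      hfactor (hF.blocks_lt hu)) (E.coin s.drawn).isLt) (eval_mul (a := .reg _) (b := .reg _)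
      hgroups hP.groupLen (by rw [← len]; omega)) (show P.blockStart u _ < _ by omega)
  refine (testBlock_runs (k := P.K) (r := P.r) (x := P.blockStart u (E.coin s.drawn)) (g := P.g)
    (G := P.groups u) ?_ ?_ ?_ ?_ ?_ hF.g_pos hstart).mono le_rfl ?_
  · exact hP.offset
  · exact hP.threshold
  · rfl
  · exact hP.groupLen
  · exact hgroups
  rintro s' ⟨hs', hd, hflag⟩
  refine .assign (eval_or (a := .reg _) (b := .reg _) ((hs' _ (by decide)).trans hhit) hflag
    (by omega)) ⟨?_, hd.trans (add_assoc ..), rfl⟩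
  exact ((((AgreeBelow.refl _ s).update (by decide)).update (by decide)).trans
    (hs'.mono (by decide))).update le_rfl

theorem sampleLevel_runs (hP : P.Loaded s) (hF : P.Fits (2 ^ E.wordSize)) (hu : u ≤ P.U)
    (hfactor : s.reg Reg.factor = 2 ^ (P.U - u)) (hgroups : s.reg Reg.groups = P.groups u)
    {q : Prop} (hhit : s.reg Reg.hit = truth q) :
    Runs E sampleLevel s P.levelTime fun s' =>
      AgreeBelow Reg.sample s s' ∧ s'.drawn = s.drawn + P.samples u * (1 + P.groups u) ∧
        s'.reg Reg.hit = truth (q ∨ ∃ a < P.samples u,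
          P.SampleHit (mismatch E.charA E.charB P.K) (fun i => E.coin i) u
            (s.drawn + a * (1 + P.groups u))) := by
  have hsamples : P.samples u + 1 < 2 ^ E.wordSize :=
    (Nat.add_le_add_right (Nat.mul_le_mul_right _ (Nat.pow_le_pow_right two_pos (Nat.sub_le _ _)))
      1).trans_lt hF.samples_lt
  refine (Runs.forLt (fun b s' => s'.drawn = s.drawn + b * (1 + P.groups u) ∧
      s'.reg Reg.hit = truth (q ∨ ∃ a < b,
        P.SampleHit (mismatch E.charA E.charB P.K) (fun i => E.coin i) u
          (s.drawn + a * (1 + P.groups u))))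
    hsamples (fun s' hs' => eval_mul (a := .reg _) (b := .reg _) ((hs' _ (by decide)).trans hfactor)
      ((hs' _ (by decide)).trans hP.topSamples) (by rw [← samples]; omega)) ?_ ?_ ?_).mono
    (samples_mul_le_levelTime hF hu) fun _ h => h
  · simpa using hhit
  · exact fun _ _ _ h => h
  · rintro b - s' hs' - ⟨hd, hh⟩
    refine (sampleBlock_runs (hP.congr (hs'.mono (by decide))) hF hu
      ((hs' _ (by decide)).trans hfactor) ((hs' _ (by decide)).trans hgroups) hh).mono le_rfl ?_
    rintro s'' ⟨hs'', hd', hh'⟩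
    refine ⟨hs'', by rw [hd', hd]; ring, ?_⟩
    rw [hh', hd, or_assoc, Nat.exists_lt_succ_right]

theorem searchLevel_runs (hP : P.Loaded s) (hF : P.Fits (2 ^ E.wordSize)) (hu : u ≤ P.U)
    (hfactor : s.reg Reg.factor = 2 ^ P.U / 2 ^ u) (hgroups : s.reg Reg.groups = P.groups u)
    {q : Prop} (hhit : s.reg Reg.hit = truth q) :
    Runs E searchLevel s (P.levelTime + 8) fun s' =>
      AgreeBelow Reg.factor s s' ∧ s'.drawn = s.drawn + P.samples u * (1 + P.groups u) ∧
        s'.reg Reg.factor = 2 ^ P.U / 2 ^ (u + 1) ∧ s'.reg Reg.groups = P.groups (u + 1) ∧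
        s'.reg Reg.hit = truth (q ∨ ∃ a < P.samples u,
          P.SampleHit (mismatch E.charA E.charB P.K) (fun i => E.coin i) u
            (s.drawn + a * (1 + P.groups u))) := by
  have hpow : 2 ^ P.U / 2 ^ u = 2 ^ (P.U - u) := Nat.pow_div hu two_pos
  have hlt : 2 ^ (P.U - u) < 2 ^ E.wordSize :=
    (Nat.le_mul_of_pos_left _ hF.J_pos).trans_lt (hF.blocks_lt hu)
  have hgroups_lt : 2 * P.groups u < 2 ^ E.wordSize := by
    have := hF.blockStart_add_lt hu 0
    have : P.groups u ≤ P.len u := Nat.le_mul_of_pos_right _ hF.g_pos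
    omega
  have htwo : 2 < 2 ^ E.wordSize := by have := hF.groups_pos u; omega
  refine (Runs.seq <| (sampleLevel_runs hP hF hu (hfactor.trans hpow) hgroups hhit).mono le_rfl
    ?_).mono (T := P.levelTime + (4 + 4)) (by omega) fun _ h => h
  rintro s' ⟨hs', hd, hh⟩
  refine .seq <| .assign (v := 2 ^ P.U / 2 ^ (u + 1)) ?_ <|
    .assign (v := P.groups (u + 1)) ?_ ⟨?_, hd, rfl, rfl, hh⟩
  · rw [pow_succ, ← Nat.div_div_eq_div_mul]
    exact eval_div (a := .reg _) ((hs' _ (by decide)).trans hfactor) (eval_ofNat htwo)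
      (hpow ▸ hlt)
  · have hg := (hs' Reg.groups (by decide)).trans hgroups
    refine (eval_add (a := .reg _) (b := .reg _) hg hg (by omega)).trans ?_
    rw [groups, groups, pow_succ]; ring
  · exact ((hs'.mono (by decide)).update le_rfl).update (by decide)

theorem search_runs (hP : P.Loaded s) (hF : P.Fits (2 ^ E.wordSize))
    (hhit : s.reg Reg.hit = 0) :
    Runs E search s P.searchTime fun s' =>
      AgreeBelow Reg.factor s s' ∧ s'.drawn = s.drawn + P.period ∧
        s'.reg Reg.hit = truth (P.SearchHit (mismatch E.charA E.charB P.K) (fun i => E.coin i)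
          s.drawn) := by
  refine (Runs.seq <| .assign (v := 2 ^ P.U) ?_ <| .seq <| .assign (v := P.G) ?_ <|
    Runs.loop (fun u s' => AgreeBelow Reg.factor s s' ∧ s'.drawn = s.drawn + P.drawnBelow u ∧
      s'.reg Reg.factor = 2 ^ P.U / 2 ^ u ∧ s'.reg Reg.groups = P.groups u ∧
      s'.reg Reg.hit = truth (∃ v < u, ∃ a < P.samples v,
        P.SampleHit (mismatch E.charA E.charB P.K) (fun i => E.coin i) v
          (s.drawn + P.drawnBelow v + a * (1 + P.groups v))))
    (P.U + 1) (T := P.levelTime + 8) ?_ ?_ ?_).mono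
    (T := 2 + (2 + ((P.U + 1) * (1 + 1 + (P.levelTime + 8)) + (1 + 1))))
    (by rw [searchTime]; ring_nf; omega) fun _ h => h
  · exact hP.topFactor
  · exact hP.baseGroups
  · refine ⟨((AgreeBelow.refl _ s).update le_rfl).update (by decide), rfl, ?_, ?_, ?_⟩
    · exact (Nat.div_one _).symm
    · exact (mul_one _).symm
    · simpa [truth] using hhit
  · rintro u hu s' ⟨hs', hd, hfactor, hgroups, hh⟩
    have hu : u ≤ P.U := Nat.le_of_lt_succ hu
    refine ⟨(hfactor.trans (Nat.pow_div hu two_pos)).trans_ne (by positivity), ?_⟩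
    refine (searchLevel_runs (hP.congr (hs'.mono (by decide))) hF hu hfactor hgroups hh).mono
      le_rfl ?_
    rintro s'' ⟨hs'', hd', hfactor', hgroups', hh'⟩
    refine ⟨hs'.trans hs'', ?_, hfactor', hgroups', ?_⟩
    · rw [hd', hd, add_assoc, drawnBelow, ← Finset.sum_range_succ, ← drawnBelow]
    · rw [hh', hd, Nat.exists_lt_succ_right]
  · rintro s' ⟨hs', hd, hfactor, -, hh⟩
    refine ⟨hfactor.trans (Nat.div_eq_of_lt (Nat.pow_lt_pow_right one_lt_two P.U.lt_succ_self)),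
      hs', hd, hh.trans (truth_congr ?_)⟩
    simp only [SearchHit, Nat.lt_succ_iff]

theorem repeatSearch_runs (hP : P.Loaded s) (hF : P.Fits (2 ^ E.wordSize))
    (hdrawn : s.drawn = 0) :
    Runs E repeatSearch s P.repeatTime fun s' =>
      s'.reg Reg.clean = truth (∃ i < P.R,
        ¬ P.SearchHit (mismatch E.charA E.charB P.K) (fun i => E.coin i) (i * P.period)) := by
  have htwo : 2 < 2 ^ E.wordSize := by have := hF.total_lt; omega
  have hone := one_lt_two.trans htwo
  refine (Runs.seq (T := 2) (T' := P.R * (P.searchTime + 18) + 6) <|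
    .assign (v := 0) (eval_ofNat (by omega)) ?_).mono (by rw [repeatTime]; omega) fun _ h => h
  refine (Runs.forLt (fun i s' => s'.drawn = i * P.period ∧ s'.reg Reg.clean = truth (∃ j < i,
      ¬ P.SearchHit (mismatch E.charA E.charB P.K) (fun i => E.coin i) (j * P.period)))
    (x := Reg.rep) (T := P.searchTime + 10) hF.reps_lt (fun s' hs' => ?_) ?_
    (fun _ _ _ h => h) ?_).mono ?_ fun _ h => h.2.2
  · exact (hs' _ (by decide)).trans hP.reps
  · exact ⟨by simpa using hdrawn, by simp [truth]⟩
  swap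
  · rw [show (Expr.reg Reg.reps).cost = 1 from rfl]; grind
  rintro i - s' hs' - ⟨hd, hclean⟩
  have hP' : P.Loaded s' := hP.congr (((AgreeBelow.refl _ s).update (by decide)).trans hs')
  refine (Runs.seq <| .assign (v := 0) (eval_ofNat (by omega)) <| .seq (T := P.searchTime)
    (T' := 8) ?_).mono (T := 2 + (P.searchTime + 8)) (by omega) fun _ h => h
  refine (search_runs (hP'.congr ((AgreeBelow.refl _ s').update (by decide))) hF rfl).mono
    le_rfl ?_
  rintro s'' ⟨hs'', hd', hh⟩
  have hs := ((AgreeBelow.refl Reg.factor s').update (by decide)).trans hs''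
  have hclean' : s''.reg Reg.clean = _ := (hs _ (by decide)).trans hclean
  refine .assign (eval_or (a := .reg _) hclean' (eval_not (a := .reg _) hh hone) htwo)
    ⟨(hs.mono (by decide)).update le_rfl, ?_, truth_congr ?_⟩
  · exact hd'.trans (by rw [show State.drawn _ = _ from hd, add_one_mul])
  · rw [show State.drawn _ = _ from hd, Nat.exists_lt_succ_right]

end Params

/-! ### The parameters -/

/-- The parameters that the program computes: `r = ⌊√k⌋`, `K = r ^ 2`, groups of length about
`r / (128 log n)`, blocks whose length grows from about `K` to about `n / l`, and `log n` runs of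
the search. -/
noncomputable def gapParams (n k l : ℕ) : Params :=
  let r := k.sqrt
  let K := r * r
  let g := r / (128 * n.size) + 1
  let G := K / g + 1
  let U := sInf {u | n ≤ G * 2 ^ u * g * l}
  { r, K, g, G, U, J := n / (G * 2 ^ U * g) + 1, L := 128 * (n.size * n.size), R := n.size }

section gapParams

variable {n k l : ℕ}

theorem size_le_self (n : ℕ) : n.size ≤ n := Nat.size_le.2 Nat.lt_two_pow_self

theorem Params.len_succ (P : Params) (u : ℕ) : P.len (u + 1) = 2 * P.len u := by
  simp only [len, groups, pow_succ]; ring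

theorem gapParams_K_le : (gapParams n k l).K ≤ k := Nat.sqrt_le k

theorem gapParams_r_pos (hk : 1 ≤ k) : 0 < (gapParams n k l).r := Nat.sqrt_pos.2 hk

theorem gapParams_K_pos (hk : 1 ≤ k) : 0 < (gapParams n k l).K :=
  Nat.mul_pos (gapParams_r_pos (n := n) (l := l) hk) (gapParams_r_pos (n := n) (l := l) hk)

theorem gapParams_g_le (hk : 1 ≤ k) (hn : 1 ≤ n) : (gapParams n k l).g ≤ (gapParams n k l).r := by
  have hr : 0 < k.sqrt := Nat.sqrt_pos.2 hk
  have hsize : 0 < n.size := Nat.size_pos.2 hn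
  exact Nat.div_lt_self hr (by omega)

theorem gapParams_len_zero_le (hk : 1 ≤ k) (hn : 1 ≤ n) :
    (gapParams n k l).len 0 ≤ 2 * (gapParams n k l).K := by
  have hgK : (gapParams n k l).g ≤ (gapParams n k l).K :=
    (gapParams_g_le hk hn).trans (Nat.le_mul_self _)
  have hlen : (gapParams n k l).len 0 =
      (gapParams n k l).K / (gapParams n k l).g * (gapParams n k l).g + (gapParams n k l).g := by
    rw [← add_one_mul]; exact congrArg (· * _) (mul_one _)
  have := Nat.div_mul_le_self (gapParams n k l).K (gapParams n k l).g
  omega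

theorem gapParams_len_pos (u : ℕ) : 0 < (gapParams n k l).len u :=
  Nat.mul_pos (Nat.mul_pos (Nat.succ_pos _) (by positivity)) (Nat.succ_pos _)

theorem two_pow_le_gapParams_len (u : ℕ) : 2 ^ u ≤ (gapParams n k l).len u :=
  (Nat.le_mul_of_pos_left _ (Nat.succ_pos _)).trans (Nat.le_mul_of_pos_right _ (Nat.succ_pos _))

theorem le_gapParams_len_mul (hl : 1 ≤ l) : n ≤ (gapParams n k l).len (gapParams n k l).U * l :=
  Nat.sInf_mem (s := {u | n ≤ (gapParams n k l).len u * l}) ⟨n, Nat.lt_two_pow_self.le.trans <|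
    (two_pow_le_gapParams_len n).trans (Nat.le_mul_of_pos_right _ hl)⟩

theorem gapParams_len_mul_lt {u : ℕ} (hu : u < (gapParams n k l).U) :
    (gapParams n k l).len u * l < n :=
  not_le.1 (Nat.notMem_of_lt_sInf (s := {u | n ≤ (gapParams n k l).len u * l}) hu)

theorem gapParams_len_U_mul_lt (hk : 1 ≤ k) (hn : 1 ≤ n)
    (hlong : 2 * (gapParams n k l).K * l < n) :
    (gapParams n k l).len (gapParams n k l).U * l < 2 * n := by
  cases hU : (gapParams n k l).U with
  | zero => have := Nat.mul_le_mul_right l (gapParams_len_zero_le (l := l) hk hn); omega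
  | succ v =>
    have := gapParams_len_mul_lt (n := n) (k := k) (l := l) (u := v) (by omega)
    rw [Params.len_succ, mul_assoc]; omega

theorem gapParams_U_le (hk : 1 ≤ k) (hn : 1 ≤ n) (hl : 1 ≤ l)
    (hlong : 2 * (gapParams n k l).K * l < n) : (gapParams n k l).U ≤ n.size := by
  have hlen := gapParams_len_U_mul_lt hk hn hlong
  have hpow := (two_pow_le_gapParams_len (n := n) (k := k) (l := l) (gapParams n k l).U).trans
    (Nat.le_mul_of_pos_right _ hl)
  have hlt : 2 ^ (gapParams n k l).U < 2 ^ (n.size + 1) := by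
    have := Nat.lt_size_self n
    rw [pow_succ]; omega
  exact Nat.le_of_lt_succ ((Nat.pow_lt_pow_iff_right one_lt_two).1 hlt)

theorem le_gapParams_J_mul : n ≤ (gapParams n k l).J * (gapParams n k l).len (gapParams n k l).U :=
  (Nat.lt_mul_of_div_lt (Nat.lt_succ_self _) (gapParams_len_pos _)).le

theorem gapParams_J_mul_le : (gapParams n k l).J * (gapParams n k l).len (gapParams n k l).U ≤
    n + (gapParams n k l).len (gapParams n k l).U :=
  (add_one_mul (n / (gapParams n k l).len (gapParams n k l).U) _).trans_le
    (Nat.add_le_add_right (Nat.div_mul_le_self _ _) _)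

theorem gapParams_J_le (hl : 1 ≤ l) : (gapParams n k l).J ≤ l + 1 :=
  Nat.succ_le_succ (Nat.div_le_of_le_mul (le_gapParams_len_mul hl))

theorem gapParams_fits {W : ℕ} (hk : 1 ≤ k) (hkn : k ≤ n) (hl : 1 ≤ l)
    (hlong : 2 * (gapParams n k l).K * l < n) (hW : 1000 * (n + 1) ^ 3 < W) :
    (gapParams n k l).Fits W := by
  have hn := hk.trans hkn
  have hlen := (Nat.le_mul_of_pos_right _ hl).trans_lt (gapParams_len_U_mul_lt hk hn hlong)
  have hn3 : n + 1 ≤ (n + 1) ^ 3 := Nat.le_self_pow (by norm_num) _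
  have hsize := size_le_self n
  refine ⟨Nat.succ_pos _, Nat.succ_pos _, gapParams_K_pos hk, Nat.succ_pos _, ?_, ?_, ?_⟩
  · have := gapParams_J_mul_le (n := n) (k := k) (l := l)
    have := (gapParams_K_le (n := n) (l := l)).trans hkn
    omega
  · have hpow := (two_pow_le_gapParams_len (n := n) (k := k) (l := l) _).trans hlen.le
    calc _ ≤ 2 * n * (128 * (n * n)) + 1 :=
        Nat.add_le_add_right (Nat.mul_le_mul hpow
          (Nat.mul_le_mul_left 128 (Nat.mul_le_mul hsize hsize))) 1
      _ < W := by nlinarith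
  · exact (Nat.add_le_add_right hsize 1).trans_lt (by omega)

end gapParams

/-- Computes `⌊√k⌋`. -/
def computeSqrt : Cmd :=
  .seq (.assign Reg.threshold 0) <|
  .while (((Expr.reg Reg.threshold + 1) * (.reg Reg.threshold + 1)).lt (.reg Reg.budget + 1)) <|
    .assign Reg.threshold (.reg Reg.threshold + 1)

/-- Computes the bit length of `n`. -/
def computeSize : Cmd :=
  .seq (.assign Reg.reps 0) <| .seq (.assign Reg.power 1) <|
  .while ((Expr.reg Reg.power).lt (.reg Reg.length + 1)) <|
    .seq (.assign Reg.power (.reg Reg.power + .reg Reg.power)) <|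
    .assign Reg.reps (.reg Reg.reps + 1)

/-- Computes the parameters that do not depend on the number of levels. -/
def setup : Cmd :=
  .seq computeSqrt <| .seq computeSize <|
  .seq (.assign Reg.offset (.reg Reg.threshold * .reg Reg.threshold)) <|
  .seq (.assign Reg.groupLen (.reg Reg.threshold / (128 * .reg Reg.reps) + 1)) <|
  .seq (.assign Reg.baseGroups (.reg Reg.offset / .reg Reg.groupLen + 1)) <|
  .assign Reg.topSamples (128 * (.reg Reg.reps * .reg Reg.reps))

/-- The length of a block of the level that `Reg.topFactor` stands for. -/
def topLen : Expr := .reg Reg.baseGroups * .reg Reg.topFactor * .reg Reg.groupLen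

/-- Computes the number of levels and the number of blocks of the highest level. -/
def setupLevels : Cmd :=
  .seq (.assign Reg.topFactor 1) <|
  .seq (.while ((topLen * .reg Reg.gap).lt (.reg Reg.length)) <|
    .assign Reg.topFactor (.reg Reg.topFactor + .reg Reg.topFactor)) <|
  .assign Reg.topBlocks (.reg Reg.length / topLen + 1)

/-- The program for gap edit distance. Large distances only exist if `2 K l < n`. -/
def gapProgram : Cmd :=
  .seq setup <|
  .ite (((Expr.reg Reg.offset + .reg Reg.offset) * .reg Reg.gap).lt (.reg Reg.length))
    (.seq setupLevels <| .seq repeatSearch <| .assign Reg.length (.reg Reg.clean))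
    (.assign Reg.length 1)

section runs

variable {E : Env} {s : State} {n σ k l : ℕ}

theorem computeSqrt_runs (hbudget : s.reg Reg.budget = k)
    (hW : (k + 1) * (k + 1) + 1 < 2 ^ E.wordSize) :
    Runs E computeSqrt s (20 * k.sqrt + 20) fun s' =>
      AgreeBelow Reg.threshold s s' ∧ s'.drawn = s.drawn ∧ s'.reg Reg.threshold = k.sqrt := by
  have hcond : ∀ s' : State, ∀ j ≤ k.sqrt, AgreeBelow Reg.threshold s s' →
      s'.reg Reg.threshold = j →
      Expr.eval E s' (((Expr.reg Reg.threshold + 1) * (.reg Reg.threshold + 1)).lt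
        (.reg Reg.budget + 1)) = truth ((j + 1) * (j + 1) < k + 1) := by
    intro s' j hj hs' hthreshold
    have hjk := hj.trans (Nat.sqrt_le_self k)
    have hsq : (j + 1) * (j + 1) ≤ (k + 1) * (k + 1) := by gcongr
    have hk : k + 1 ≤ (k + 1) * (k + 1) := Nat.le_mul_self _
    have hsucc : (Expr.reg Reg.threshold + 1).eval E s' = j + 1 :=
      eval_add (a := .reg _) hthreshold (eval_ofNat (by omega)) (by omega)
    exact eval_lt (eval_mul hsucc hsucc (by omega)) (eval_add (a := .reg _)
      ((hs' _ (by decide)).trans hbudget) (eval_ofNat (by omega)) (by omega)) (by omega)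
  refine (Runs.seq <| .assign (v := 0) (eval_ofNat (by omega)) <| Runs.loop (fun j s' =>
    AgreeBelow Reg.threshold s s' ∧ s'.drawn = s.drawn ∧ s'.reg Reg.threshold = j) k.sqrt (T := 4)
    ⟨(AgreeBelow.refl _ s).update le_rfl, rfl, rfl⟩ ?_ ?_).mono
    (T := 2 + (k.sqrt * (11 + 1 + 4) + (11 + 1))) (by omega) fun _ h => h
  · rintro j hj s' ⟨hs', hd, hthreshold⟩
    have hjk := Nat.sqrt_le_self k
    have hk : k + 1 ≤ (k + 1) * (k + 1) := Nat.le_mul_self _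
    refine ⟨?_, .assign (v := j + 1) (eval_add (a := .reg _) hthreshold (eval_ofNat (by omega))
      (by omega)) ⟨hs'.update le_rfl, hd, rfl⟩⟩
    rw [hcond s' j hj.le hs' hthreshold, truth_true (Nat.lt_succ_of_le (Nat.le_sqrt.1 hj))]
    exact one_ne_zero
  · rintro s' ⟨hs', hd, hthreshold⟩
    refine ⟨?_, hs', hd, hthreshold⟩
    rw [hcond s' _ le_rfl hs' hthreshold,
      truth_false (not_lt.2 (Nat.succ_le_of_lt (Nat.lt_succ_sqrt k)))]

theorem computeSize_runs (hlength : s.reg Reg.length = n) (hW : 2 * n + 4 < 2 ^ E.wordSize) :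
    Runs E computeSize s (20 * n.size + 20) fun s' =>
      AgreeBelow Reg.reps s s' ∧ s'.drawn = s.drawn ∧ s'.reg Reg.reps = n.size := by
  have hcond : ∀ s' : State, ∀ j, AgreeBelow Reg.reps s s' → s'.reg Reg.power = 2 ^ j →
      ((Expr.reg Reg.power).lt (.reg Reg.length + 1)).eval E s' = truth (2 ^ j < n + 1) :=
    fun s' j hs' hpower => eval_lt (a := .reg _) hpower (eval_add (a := .reg _)
      ((hs' _ (by decide)).trans hlength) (eval_ofNat (by omega)) (by omega)) (by omega)
  refine Runs.mono (T := 2 + (2 + (n.size * (5 + 1 + 8) + (5 + 1))))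
    (.seq <| .assign (v := 0) (eval_ofNat (by omega)) <| .seq <|
      .assign (v := 1) (eval_ofNat (by omega)) <| Runs.loop (fun j s' =>
        AgreeBelow Reg.reps s s' ∧ s'.drawn = s.drawn ∧ s'.reg Reg.reps = j ∧
        s'.reg Reg.power = 2 ^ j) n.size (T := 8) ?_ ?_ ?_) (by omega) fun _ h => h
  · exact ⟨((AgreeBelow.refl _ s).update le_rfl).update (by decide), rfl, rfl, rfl⟩
  · rintro j hj s' ⟨hs', hd, hreps, hpower⟩
    have hjn := Nat.lt_size.1 hj
    have hjlt : j < 2 ^ j := Nat.lt_two_pow_self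
    refine ⟨?_, .seq <| .assign (v := 2 ^ (j + 1)) ?_ <| .assign (v := j + 1) ?_
      ⟨(hs'.update (by decide)).update le_rfl, hd, rfl, rfl⟩⟩
    · rw [hcond s' j hs' hpower, truth_true (Nat.lt_succ_of_le hjn)]
      exact one_ne_zero
    · rw [pow_succ, mul_two]
      exact eval_add (a := .reg _) (b := .reg _) hpower hpower (by omega)
    · exact eval_add (a := .reg _) (x := j) hreps (eval_ofNat (by omega)) (by omega)
  · rintro s' ⟨hs', hd, hreps, hpower⟩
    refine ⟨?_, hs', hd, hreps⟩
    rw [hcond s' _ hs' hpower, truth_false (not_lt.2 (Nat.succ_le_of_lt (Nat.lt_size_self n)))]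

end runs

/-- The input and the parameters that do not depend on the number of levels are in their
registers, and no random words have been drawn. -/
structure Prepared (n k l : ℕ) (s : State) : Prop where
  length : s.reg Reg.length = n
  gap : s.reg Reg.gap = l
  threshold : s.reg Reg.threshold = (gapParams n k l).r
  reps : s.reg Reg.reps = (gapParams n k l).R
  offset : s.reg Reg.offset = (gapParams n k l).K
  groupLen : s.reg Reg.groupLen = (gapParams n k l).g
  baseGroups : s.reg Reg.baseGroups = (gapParams n k l).G
  topSamples : s.reg Reg.topSamples = (gapParams n k l).L
  drawn : s.drawn = 0

section

variable {E : Env} {s : State} {n σ k l : ℕ}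

theorem Prepared.loaded (h : Prepared n k l s) {s' : State}
    (hs : AgreeBelow Reg.topFactor s s') (hfactor : s'.reg Reg.topFactor = 2 ^ (gapParams n k l).U)
    (hblocks : s'.reg Reg.topBlocks = (gapParams n k l).J) : (gapParams n k l).Loaded s' where
  threshold := (hs _ (by decide)).trans h.threshold
  reps := (hs _ (by decide)).trans h.reps
  offset := (hs _ (by decide)).trans h.offset
  groupLen := (hs _ (by decide)).trans h.groupLen
  baseGroups := (hs _ (by decide)).trans h.baseGroups
  topSamples := (hs _ (by decide)).trans h.topSamples
  topFactor := hfactor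
  topBlocks := hblocks

theorem setup_runs (hkn : k ≤ n) (hW : 1000 * (n + 1) ^ 3 < 2 ^ E.wordSize) :
    Runs E setup (gapInit n σ k l) (20 * k.sqrt + 20 * n.size + 80) (Prepared n k l) := by
  have hlin : n + 1 ≤ (n + 1) ^ 3 := Nat.le_self_pow (by norm_num) _
  have hsquare : (n + 1) * (n + 1) ≤ (n + 1) ^ 3 := by
    rw [← sq]; exact Nat.pow_le_pow_right n.succ_pos (by norm_num)
  have hkk : (k + 1) * (k + 1) ≤ (n + 1) * (n + 1) := by gcongr
  have hsize := size_le_self n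
  have hsizes : n.size * n.size ≤ (n + 1) * (n + 1) := Nat.mul_le_mul (by omega) (by omega)
  have hsqrt := Nat.sqrt_le_self k
  have hK := Nat.sqrt_le k
  have hgroup := Nat.div_le_self k.sqrt (128 * n.size)
  have hgroups := Nat.div_le_self (k.sqrt * k.sqrt) (k.sqrt / (128 * n.size) + 1)
  refine Runs.mono (T := (20 * k.sqrt + 20) + ((20 * n.size + 20) + (4 + (8 + (6 + 6)))))
    (.seq <| (computeSqrt_runs (s := gapInit n σ k l) (k := k) rfl (by omega)).mono le_rfl ?_)
    (by omega) fun _ h => h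
  rintro s₁ ⟨hs₁, hd₁, hr₁⟩
  refine .seq <| (computeSize_runs (n := n) (hs₁ _ (by decide)) (by omega)).mono le_rfl ?_
  rintro s₂ ⟨hs₂, hd₂, hreps⟩
  have hr : s₂.reg Reg.threshold = k.sqrt := (hs₂ _ (by decide)).trans hr₁
  refine .seq <| .assign (v := k.sqrt * k.sqrt)
    (eval_mul (a := .reg _) (b := .reg _) hr hr (by omega)) ?_
  refine .seq <| .assign (v := k.sqrt / (128 * n.size) + 1)
    (eval_add (eval_div (a := .reg _) hr (eval_mul (eval_ofNat (by omega)) (b := .reg _) hreps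
      (by omega)) (by omega)) (eval_ofNat (by omega)) (by omega)) ?_
  refine .seq <| .assign (v := k.sqrt * k.sqrt / (k.sqrt / (128 * n.size) + 1) + 1)
    (eval_add (eval_div (a := .reg _) (b := .reg _) rfl rfl
      (show k.sqrt * k.sqrt < 2 ^ E.wordSize by omega)) (eval_ofNat (by omega))
      (show k.sqrt * k.sqrt / (k.sqrt / (128 * n.size) + 1) + 1 < 2 ^ E.wordSize by omega)) ?_
  refine .assign (v := 128 * (n.size * n.size)) (eval_mul (eval_ofNat (by omega))
    (eval_mul (a := .reg _) (b := .reg _) hreps hreps (by omega)) (by omega)) ?_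
  exact ⟨(hs₂ _ (by decide)).trans (hs₁ _ (by decide)),
    (hs₂ _ (by decide)).trans (hs₁ _ (by decide)), hr, hreps, rfl, rfl, rfl, rfl, hd₂.trans hd₁⟩

theorem eval_topLen {s' : State} {u : ℕ} (hs : Prepared n k l s)
    (hs' : AgreeBelow Reg.topFactor s s') (hfactor : s'.reg Reg.topFactor = 2 ^ u)
    (hW : (gapParams n k l).len u < 2 ^ E.wordSize) :
    topLen.eval E s' = (gapParams n k l).len u := by
  have hgroups : (gapParams n k l).G * 2 ^ u ≤ (gapParams n k l).len u :=
    Nat.le_mul_of_pos_right _ (Nat.succ_pos _)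
  exact eval_mul (eval_mul (a := .reg _) (b := .reg _) ((hs' _ (by decide)).trans hs.baseGroups)
    hfactor (by omega)) (b := .reg _) ((hs' _ (by decide)).trans hs.groupLen) hW

theorem eval_topLen_mul_lt {s' : State} {u : ℕ} (hl : 1 ≤ l) (hs : Prepared n k l s)
    (hs' : AgreeBelow Reg.topFactor s s') (hfactor : s'.reg Reg.topFactor = 2 ^ u)
    (hone : 1 < 2 ^ E.wordSize) (hW : (gapParams n k l).len u * l < 2 ^ E.wordSize) :
    Expr.eval E s' ((topLen * .reg Reg.gap).lt (.reg Reg.length)) =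
      truth ((gapParams n k l).len u * l < n) := by
  have hlen := Nat.le_mul_of_pos_right ((gapParams n k l).len u) hl
  exact eval_lt (eval_mul (eval_topLen hs hs' hfactor (by omega)) (b := .reg _)
    ((hs' _ (by decide)).trans hs.gap) hW) (b := .reg _)
    ((hs' _ (by decide)).trans hs.length) hone

theorem setupLevels_runs (hk : 1 ≤ k) (hn : 1 ≤ n) (hl : 1 ≤ l)
    (hlong : 2 * (gapParams n k l).K * l < n) (hW : 1000 * (n + 1) ^ 3 < 2 ^ E.wordSize)
    (hs : Prepared n k l s) :
    Runs E setupLevels s (20 * n.size + 50) fun s' =>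
      (gapParams n k l).Loaded s' ∧ s'.drawn = 0 := by
  have hlin : n + 1 ≤ (n + 1) ^ 3 := Nat.le_self_pow (by norm_num) _
  have hU := gapParams_U_le hk hn hl hlong
  have hlen : ∀ u ≤ (gapParams n k l).U, (gapParams n k l).len u * l < 2 ^ E.wordSize :=
    fun u hu => ((Nat.mul_le_mul_right l (Params.len_le hu)).trans_lt
      (gapParams_len_U_mul_lt hk hn hlong)).trans (by omega)
  refine Runs.mono (T := 2 + (((gapParams n k l).U * (9 + 1 + 4) + (9 + 1)) + 10))
    (.seq <| .assign (v := 1) (eval_ofNat (by omega)) <| .seq <| .loop (T := 4)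
      (fun u s' => AgreeBelow Reg.topFactor s s' ∧ s'.drawn = s.drawn ∧
        s'.reg Reg.topFactor = 2 ^ u) (gapParams n k l).U
      ⟨(AgreeBelow.refl _ s).update le_rfl, rfl, rfl⟩ ?_ ?_) (by omega) fun _ h => h
  · rintro u hu s' ⟨hs', hd, hfactor⟩
    have hpow : 2 ^ u + 2 ^ u < 2 ^ E.wordSize := by
      have := ((two_pow_le_gapParams_len (n := n) (k := k) (l := l) (u + 1)).trans
        (Nat.le_mul_of_pos_right _ hl)).trans_lt (hlen (u + 1) hu)
      rwa [pow_succ, mul_two] at this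
    refine ⟨?_, .assign (v := 2 ^ (u + 1)) ?_ ⟨hs'.update le_rfl, hd, rfl⟩⟩
    · rw [eval_topLen_mul_lt hl hs hs' hfactor (by omega) (hlen u hu.le),
        truth_true (gapParams_len_mul_lt hu)]
      exact one_ne_zero
    · rw [pow_succ, mul_two]
      exact eval_add (a := .reg _) (b := .reg _) hfactor hfactor hpow
  · rintro s' ⟨hs', hd, hfactor⟩
    have hdiv := Nat.div_le_self n ((gapParams n k l).len (gapParams n k l).U)
    have htop := (Nat.le_mul_of_pos_right _ hl).trans_lt (hlen _ le_rfl)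
    refine ⟨?_, .assign (eval_add (eval_div (a := .reg _) ((hs' _ (by decide)).trans hs.length)
      (eval_topLen hs hs' hfactor htop) (by omega)) (eval_ofNat (by omega))
      (by omega)) ⟨hs.loaded (hs'.update (by decide)) hfactor rfl, hd.trans hs.drawn⟩⟩
    rw [eval_topLen_mul_lt hl hs hs' hfactor (by omega) (hlen _ le_rfl),
      truth_false (not_lt.2 (le_gapParams_len_mul hl))]

theorem eval_long (hkn : k ≤ n) (hln : l ≤ n) (hW : 1000 * (n + 1) ^ 3 < 2 ^ E.wordSize)
    (hs : Prepared n k l s) : Expr.eval E s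
      (((Expr.reg Reg.offset + .reg Reg.offset) * .reg Reg.gap).lt (.reg Reg.length)) =
        truth (2 * (gapParams n k l).K * l < n) := by
  have hlin : n + 1 ≤ (n + 1) ^ 3 := Nat.le_self_pow (by norm_num) _
  have hsquare : (n + 1) * (n + 1) ≤ (n + 1) ^ 3 := by
    rw [← sq]; exact Nat.pow_le_pow_right n.succ_pos (by norm_num)
  have hK := (gapParams_K_le (n := n) (l := l)).trans hkn
  have hKl : (gapParams n k l).K * l ≤ (n + 1) * (n + 1) := Nat.mul_le_mul (by omega) (by omega)
  have hmul : ((gapParams n k l).K + (gapParams n k l).K) * l < 2 ^ E.wordSize := by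
    rw [add_mul]; omega
  rw [two_mul]
  exact eval_lt (eval_mul (eval_add (a := .reg _) (b := .reg _) hs.offset hs.offset (by omega))
    (b := .reg _) hs.gap hmul) (b := .reg _) hs.length (by omega)

theorem gapProgram_runs_of_le (hkn : k ≤ n) (hln : l ≤ n)
    (hW : 1000 * (n + 1) ^ 3 < 2 ^ E.wordSize) (hshort : n ≤ 2 * (gapParams n k l).K * l) :
    Runs E gapProgram (gapInit n σ k l) (20 * k.sqrt + 20 * n.size + 100) fun s' =>
      s'.reg Reg.length = 1 := by
  have hlin : n + 1 ≤ (n + 1) ^ 3 := Nat.le_self_pow (by norm_num) _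
  refine Runs.mono (T := (20 * k.sqrt + 20 * n.size + 80) + (7 + 1 + 2))
    (.seq <| (setup_runs hkn hW).mono le_rfl fun s hs => .ite (fun h => ?_) fun _ =>
      .assign (eval_ofNat (by omega)) rfl) (by omega) fun _ h => h
  rw [eval_long hkn hln hW hs, truth_false (not_lt.2 hshort)] at h
  exact absurd rfl h

theorem gapProgram_runs_of_lt (hk : 1 ≤ k) (hkn : k ≤ n) (hl : 1 ≤ l) (hln : l ≤ n)
    (hW : 1000 * (n + 1) ^ 3 < 2 ^ E.wordSize) (hlong : 2 * (gapParams n k l).K * l < n) :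
    Runs E gapProgram (gapInit n σ k l)
      (20 * k.sqrt + 40 * n.size + 160 + (gapParams n k l).repeatTime) fun s' =>
        s'.reg Reg.length = truth (∃ i < (gapParams n k l).R, ¬ (gapParams n k l).SearchHit
          (mismatch E.charA E.charB (gapParams n k l).K) (fun i => E.coin i)
          (i * (gapParams n k l).period)) := by
  refine Runs.mono (T := (20 * k.sqrt + 20 * n.size + 80) +
      (7 + 1 + ((20 * n.size + 50) + ((gapParams n k l).repeatTime + 2))))
    (.seq <| (setup_runs hkn hW).mono le_rfl fun s hs => .ite (fun _ => .seq ?_) fun h => ?_)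
    (by omega) fun _ h => h
  · refine (setupLevels_runs hk (hk.trans hkn) hl hlong hW hs).mono le_rfl fun s₁ hs₁ => ?_
    refine .seq <| (Params.repeatSearch_runs hs₁.1 (gapParams_fits hk hkn hl hlong hW) hs₁.2).mono
      le_rfl fun s₂ hs₂ => ?_
    exact .assign (a := .reg Reg.clean) hs₂ rfl
  · rw [eval_long hkn hln hW hs, truth_true hlong] at h
    exact absurd h one_ne_zero

end

/-! ### Error probabilities -/

theorem coinLaw_exists_lt_le {w n : ℕ} {p : ℕ → (ℕ → Fin (2 ^ w)) → Prop} {e : ENNReal}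
    (h : ∀ i < n, coinLaw w {ω | p i ω} ≤ e) : coinLaw w {ω | ∃ i < n, p i ω} ≤ n * e := by
  have hUnion : {ω | ∃ i < n, p i ω} = ⋃ i ∈ Finset.range n, {ω | p i ω} := by
    ext; simp
  rw [hUnion]
  refine (measure_biUnion_finset_le _ _).trans ?_
  refine (Finset.sum_le_card_nsmul _ _ e fun i hi => h i (Finset.mem_range.1 hi)).trans_eq ?_
  rw [Finset.card_range, nsmul_eq_mul]

section Sampled

variable {c : ℕ → ℕ → ℕ} {m q w g : ℕ}

theorem hitsStretches_sampled_one (c : ℕ → ℕ → ℕ) (m : ℕ) (hq : 0 < q) (coin : ℕ → ℕ)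
    (D x G : ℕ) : HitsStretches (sampled coin D x 1 G) c m q x (x + G) := by
  intro u v s hu hv _ hsum
  obtain ⟨i, hi, hne⟩ := Finset.exists_ne_zero_of_sum_ne_zero (hq.trans_le hsum).ne'
  rw [Finset.mem_Ico] at hi
  exact ⟨i, ⟨i - x, by omega, by rw [Nat.mod_one]; omega⟩, hi.1, hi.2, hne⟩

theorem coinLaw_missed_stretch_le (hg : 0 < g) (hW : g ≤ 2 ^ w) (hc : ∀ i s, c i s ≤ 1)
    {x G u v s : ℕ} (D : ℕ) (hu : x ≤ u) (hv : v ≤ x + G * g)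
    (hq : q ≤ ∑ i ∈ Finset.Ico u v, c i s) :
    coinLaw w {ω | ∀ i ∈ sampled (fun j => ω j) D x g G, u ≤ i → i < v → c i s = 0} ≤
      ENNReal.ofReal (Real.exp (-(q / (2 * g)))) := by
  set hits : ℕ → Finset ℕ := fun γ => {t ∈ Finset.range g |
    u ≤ x + (γ * g + t) ∧ x + (γ * g + t) < v ∧ c (x + (γ * g + t)) s ≠ 0} with hhits
  have hcard : q ≤ ∑ γ ∈ Finset.range G, (hits γ).card := calc
    q ≤ ∑ i ∈ Finset.Ico u v, c i s := hq
    _ ≤ ∑ i ∈ Finset.Ico u v, if u ≤ i ∧ i < v ∧ c i s ≠ 0 then 1 else 0 := by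
      refine Finset.sum_le_sum fun i hi => ?_
      rw [Finset.mem_Ico] at hi
      have := hc i s
      split_ifs <;> omega
    _ ≤ ∑ i ∈ Finset.Ico x (x + G * g), if u ≤ i ∧ i < v ∧ c i s ≠ 0 then 1 else 0 :=
      Finset.sum_le_sum_of_subset (Finset.Ico_subset_Ico hu hv)
    _ = ∑ γ ∈ Finset.range G, (hits γ).card := by
      rw [Finset.sum_Ico_eq_sum_range, Nat.add_sub_cancel_left, sum_range_mul]
      simp only [hhits, Finset.card_filter]
  refine (measure_mono fun ω hω γ hγ hmem => ?_).trans
    ((coinLaw_forall_mod_notMem_le hg hW (R := G) (add_right_injective D) (bad := hits)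
      fun γ t ht => Finset.mem_range.1 (Finset.mem_filter.1 ht).1).trans
      (ENNReal.ofReal_le_ofReal (Real.exp_le_exp.2 (neg_le_neg ?_))))
  · obtain ⟨hle, hlt, hne⟩ := (Finset.mem_filter.1 hmem).2
    exact hne (hω _ ⟨γ, hγ, (add_assoc _ _ _).symm⟩ hle hlt)
  · gcongr

theorem coinLaw_not_hitsStretches_le (hg : 0 < g) (hW : g ≤ 2 ^ w) (hc : ∀ i s, c i s ≤ 1)
    (m : ℕ) (hq : 0 < q) (D x G : ℕ) :
    coinLaw w {ω | ¬ HitsStretches (sampled (fun j => ω j) D x g G) c m q x (x + G * g)} ≤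
      (G * g + 1 : ℕ) * ((G * g + 1 : ℕ) *
        ((m + 1 : ℕ) * ENNReal.ofReal (Real.exp (-(q / (2 * g)))))) := by
  set misses : ℕ → ℕ → ℕ → (ℕ → Fin (2 ^ w)) → Prop := fun u v s ω =>
    v ≤ G * g ∧ q ≤ ∑ i ∈ Finset.Ico (x + u) (x + v), c i s ∧
      ∀ i ∈ sampled (fun j => ω j) D x g G, x + u ≤ i → i < x + v → c i s = 0
  have hmiss (u v s) : coinLaw w {ω | misses u v s ω} ≤
      ENNReal.ofReal (Real.exp (-(q / (2 * g)))) := by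
    by_cases h : v ≤ G * g ∧ q ≤ ∑ i ∈ Finset.Ico (x + u) (x + v), c i s
    · exact (measure_mono fun ω hω => hω.2.2).trans (coinLaw_missed_stretch_le hg hW hc D
        (Nat.le_add_right x u) (Nat.add_le_add_left h.1 x) h.2)
    · have hempty : {ω | misses u v s ω} = ∅ :=
        Set.eq_empty_of_forall_notMem fun ω hω => h ⟨hω.1, hω.2.1⟩
      simp [hempty]
  refine (measure_mono fun ω hω => ?_).trans (coinLaw_exists_lt_le fun u _ =>
    coinLaw_exists_lt_le fun v _ => coinLaw_exists_lt_le fun s _ => hmiss u v s)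
  simp only [Set.mem_ofPred_eq, HitsStretches, not_forall] at hω
  obtain ⟨u, v, s, hu, hv, hs, hsum, hnone⟩ := hω
  have huv : u < v := by
    by_contra hvu
    rw [Finset.Ico_eq_empty hvu, Finset.sum_empty] at hsum
    omega
  refine ⟨u - x, by omega, v - x, by omega, s, by omega, by omega, ?_⟩
  rw [Nat.add_sub_cancel' hu, Nat.add_sub_cancel' (hu.trans huv.le)]
  exact ⟨hsum, fun i hi hui hiv => by_contra fun hne => hnone ⟨i, hi, hui, hiv, hne⟩⟩

end Sampled

namespace Params

variable {P : Params} {c : ℕ → ℕ → ℕ} {coin : ℕ → ℕ} {u w D : ℕ}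

theorem blockCost_mod_blocks (P : Params) (c : ℕ → ℕ → ℕ) (m u v : ℕ) :
    blockCost c m (P.len u) (v % P.blocks u) =
      minCost c m (P.blockStart u v) (P.blockStart u v + P.len u) := by
  rw [blockCost, Nat.succ_mul, blockStart]

theorem SampleHit.le_blockCost (h : P.SampleHit c coin u D) :
    P.r ≤ blockCost c (2 * P.K) (P.len u) (coin D % P.blocks u) := by
  rw [blockCost_mod_blocks]
  exact h.trans (minCost_mono fun i s => Set.indicator_le_self' (f := c) (fun _ _ => zero_le) i s)

theorem sampleHit_of_hitsStretches (hc : ∀ i s, c i s ≤ 1) (hr : 1 ≤ P.r) (hK : P.K = P.r * P.r)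
    (hheavy : 2 * P.K ≤ blockCost c (2 * P.K) (P.len u) (coin D % P.blocks u))
    (hS : HitsStretches (sampled coin (D + 1) (P.blockStart u (coin D)) P.g (P.groups u)) c
      (2 * P.K) P.r (P.blockStart u (coin D)) (P.blockStart u (coin D) + P.len u)) :
    P.SampleHit c coin u D := by
  have hcost := hS.minCost_le hc (Nat.le_add_right _ _)
  rw [blockCost_mod_blocks] at hheavy
  by_contra hnot
  have hsampled := Nat.mul_le_mul_left (P.r + 1) (Nat.le_sub_one_of_lt (not_le.1 hnot))
  have hbelow := hheavy.trans (hcost.trans (Nat.add_le_add_right hsampled P.r))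
  obtain ⟨r, hr'⟩ : ∃ r, P.r = r + 1 := ⟨P.r - 1, by omega⟩
  rw [hK, hr', Nat.add_sub_cancel] at hbelow
  nlinarith

theorem drawnBelow_add_lt_period {a : ℕ} (hu : u ≤ P.U) (ha : a < P.samples u) :
    P.drawnBelow u + a * (1 + P.groups u) < P.period := calc
  _ < P.drawnBelow u + P.samples u * (1 + P.groups u) :=
    Nat.add_lt_add_left (Nat.mul_lt_mul_of_pos_right ha (by omega)) _
  _ = P.drawnBelow (u + 1) := (Finset.sum_range_succ _ _).symm
  _ ≤ P.period := Finset.sum_le_sum_of_subset (Finset.range_mono (by omega))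

theorem samples_mul_J (P : Params) (u : ℕ) : P.samples u * P.J = P.blocks u * P.L := by
  rw [samples, blocks]
  ring

section FalseHit

variable {d : ℕ}

theorem samples_mul_card_heavyBlocks_le (hF : P.Fits (2 ^ w)) (hr : 1 ≤ P.r) (u : ℕ)
    (hd : ∀ N, minCost c (2 * P.K) 0 N ≤ d) :
    (P.samples u : ℝ) * (2 * (heavyBlocks c (2 * P.K) P.r (P.len u) (P.blocks u)).card /
      P.blocks u) ≤ 2 * P.L * d / (P.J * P.r) := by
  set h := (heavyBlocks c (2 * P.K) P.r (P.len u) (P.blocks u)).card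
  have hJ : (0 : ℝ) < P.J := by exact_mod_cast hF.J_pos
  have : (0 : ℝ) < P.r := by exact_mod_cast hr
  have hblocks : (0 : ℝ) < P.blocks u := by exact_mod_cast hF.blocks_pos u
  have hcard : (h : ℝ) * P.r ≤ d := by
    exact_mod_cast (card_heavyBlocks_mul_le_minCost c _ _ _ _).trans (hd _)
  have hsamples : (P.samples u : ℝ) * P.J = P.blocks u * P.L := by
    exact_mod_cast P.samples_mul_J u
  rw [← mul_div_assoc, div_le_div_iff₀ hblocks (by positivity)]
  calc (P.samples u : ℝ) * (2 * h) * (P.J * P.r) = 2 * (P.samples u * P.J) * (h * P.r) := by ring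
    _ ≤ 2 * (P.samples u * P.J) * d := by gcongr
    _ = 2 * P.L * d * P.blocks u := by rw [hsamples]; ring

theorem sum_samples_mul_card_heavyBlocks_le (hF : P.Fits (2 ^ w)) (hr : 1 ≤ P.r)
    (hd : ∀ N, minCost c (2 * P.K) 0 N ≤ d) (hle : 4 * ((P.U + 1) * P.L * d) ≤ P.J * P.r) :
    ∑ u ∈ Finset.range (P.U + 1), (P.samples u : ℝ) *
      (2 * (heavyBlocks c (2 * P.K) P.r (P.len u) (P.blocks u)).card / P.blocks u) ≤ 1 / 2 := by
  have hJr : (0 : ℝ) < P.J * P.r := by exact_mod_cast Nat.mul_pos hF.J_pos hr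
  have hle' : (4 : ℝ) * ((P.U + 1) * P.L * d) ≤ P.J * P.r := by exact_mod_cast hle
  refine (Finset.sum_le_card_nsmul _ _ _ fun u _ =>
    samples_mul_card_heavyBlocks_le hF hr u hd).trans ?_
  rw [Finset.card_range, nsmul_eq_mul, ← mul_div_assoc, div_le_div_iff₀ hJr two_pos]
  push_cast
  linarith

/-- The draws of one run of the search, as pairs of a level and the number of a sample on it. -/
def draws (P : Params) : Finset (Σ _ : ℕ, ℕ) :=
  (Finset.range (P.U + 1)).sigma fun u => Finset.range (P.samples u)

theorem mem_draws {P : Params} {a : Σ _ : ℕ, ℕ} :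
    a ∈ P.draws ↔ a.1 ≤ P.U ∧ a.2 < P.samples a.1 := by
  rw [draws, Finset.mem_sigma, Finset.mem_range, Finset.mem_range, Nat.lt_succ_iff]

theorem sum_draws_uniform_mod_mem_heavyBlocks_le (hF : P.Fits (2 ^ w)) (hr : 1 ≤ P.r)
    (hd : ∀ N, minCost c (2 * P.K) 0 N ≤ d) (hle : 4 * ((P.U + 1) * P.L * d) ≤ P.J * P.r) :
    ∑ a ∈ P.draws, (PMF.uniformOfFintype (Fin (2 ^ w))).toMeasure {v | (v : ℕ) % P.blocks a.1 ∈
      heavyBlocks c (2 * P.K) P.r (P.len a.1) (P.blocks a.1)} ≤ ENNReal.ofReal (1 / 2) := by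
  calc _ ≤ ∑ a ∈ P.draws, ENNReal.ofReal (2 * (heavyBlocks c (2 * P.K) P.r (P.len a.1)
          (P.blocks a.1)).card / P.blocks a.1) :=
        Finset.sum_le_sum fun a ha =>
          uniform_mod_mem_le (hF.blocks_pos _) (hF.blocks_lt (mem_draws.1 ha).1).le _
    _ = ENNReal.ofReal (∑ u ∈ Finset.range (P.U + 1), (P.samples u : ℝ) *
          (2 * (heavyBlocks c (2 * P.K) P.r (P.len u) (P.blocks u)).card / P.blocks u)) := by
        rw [← ENNReal.ofReal_sum_of_nonneg fun _ _ => by positivity, draws, Finset.sum_sigma]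
        simp only [Finset.sum_const, Finset.card_range, nsmul_eq_mul]
    _ ≤ ENNReal.ofReal (1 / 2) :=
        ENNReal.ofReal_le_ofReal (sum_samples_mul_card_heavyBlocks_le hF hr hd hle)

/-- A run that finds something has drawn a block of cost at least `r`, and Markov's inequality
bounds the proportion of such blocks. -/
theorem coinLaw_forall_searchHit_le (hF : P.Fits (2 ^ w)) (hr : 1 ≤ P.r)
    (hd : ∀ N, minCost c (2 * P.K) 0 N ≤ d) (hle : 4 * ((P.U + 1) * P.L * d) ≤ P.J * P.r) :
    coinLaw w {ω | ∀ i < P.R, P.SearchHit c (fun j => ω j) (i * P.period)} ≤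
      ENNReal.ofReal ((1 / 2) ^ P.R) := by
  set idx : ℕ → (Σ _ : ℕ, ℕ) → ℕ := fun i a =>
    i * P.period + (P.drawnBelow a.1 + a.2 * (1 + P.groups a.1))
  have hidx : ∀ i < P.R, ∀ i' < P.R, ∀ a ∈ P.draws, ∀ a' ∈ P.draws,
      idx i a = idx i' a' → i = i' := by
    intro i _ i' _ a ha a' ha' h
    have hlt := drawnBelow_add_lt_period (mem_draws.1 ha).1 (mem_draws.1 ha).2
    have hlt' := drawnBelow_add_lt_period (mem_draws.1 ha').1 (mem_draws.1 ha').2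
    have := congrArg (· / P.period) h
    simpa [idx, mul_comm _ P.period, Nat.mul_add_div (Nat.zero_lt_of_lt hlt),
      Nat.div_eq_of_lt hlt, Nat.div_eq_of_lt hlt'] using this
  rw [ENNReal.ofReal_pow (by norm_num)]
  refine (measure_mono fun ω hω i hi => ?_).trans ((coinLaw_forall_exists_mem_le hidx _).trans
    (pow_le_pow_left' (sum_draws_uniform_mod_mem_heavyBlocks_le hF hr hd hle) _))
  obtain ⟨u, hu, a, ha, hhit⟩ := hω i hi
  refine ⟨⟨u, a⟩, mem_draws.2 ⟨hu, ha⟩, Finset.mem_filter.2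
    ⟨Finset.mem_range.2 (Nat.mod_lt _ (hF.blocks_pos u)), ?_⟩⟩
  simpa only [idx, add_assoc] using hhit.le_blockCost

end FalseHit

section MissedHit

theorem coinLaw_forall_notMem_heavyBlocks_le (hF : P.Fits (2 ^ w)) (hu : u ≤ P.U) (D h : ℕ) :
    coinLaw w {ω | ∀ a < P.samples u, (ω (D + a * (1 + P.groups u)) : ℕ) % P.blocks u ∉
        heavyBlocks c (2 * P.K) h (P.len u) (P.blocks u)} ≤
      ENNReal.ofReal (Real.exp (-(P.L * (heavyBlocks c (2 * P.K) h (P.len u)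
        (P.blocks u)).card / (2 * P.J)))) := by
  set heavy := heavyBlocks c (2 * P.K) h (P.len u) (P.blocks u)
  have hJ : (0 : ℝ) < P.J := by exact_mod_cast hF.J_pos
  have hblocks : (0 : ℝ) < P.blocks u := by exact_mod_cast hF.blocks_pos u
  have hinj : Function.Injective fun a => D + a * (1 + P.groups u) := fun a a' h =>
    Nat.eq_of_mul_eq_mul_right (by omega) (Nat.add_left_cancel h)
  refine (coinLaw_forall_mod_notMem_le (hF.blocks_pos u) (hF.blocks_lt hu).le hinj
    (bad := fun _ => heavy)
    fun _ b hb => Finset.mem_range.1 (Finset.mem_filter.1 hb).1).trans_eq ?_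
  have hsamples : (P.samples u : ℝ) * P.J = P.blocks u * P.L := by
    exact_mod_cast P.samples_mul_J u
  congr 3
  rw [Finset.sum_const, Finset.card_range, smul_eq_mul,
    div_eq_div_iff (by positivity) (by positivity)]
  push_cast
  linear_combination (2 * (heavy.card : ℝ)) * hsamples

/-- A run that finds nothing has either drawn no heavy block of level `u`, or has missed a stretch
of mismatches inside one of the blocks that it has drawn. -/
theorem coinLaw_exists_not_searchHit_le (hF : P.Fits (2 ^ w)) (hc : ∀ i s, c i s ≤ 1)
    (hr : 1 ≤ P.r) (hK : P.K = P.r * P.r) (hu : u ≤ P.U) {ε δ : ENNReal}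
    (hε : ENNReal.ofReal (Real.exp (-(P.L * (heavyBlocks c (2 * P.K) (2 * P.K) (P.len u)
      (P.blocks u)).card / (2 * P.J)))) ≤ ε)
    (hδ : ∀ D x, coinLaw w {ω | ¬ HitsStretches (sampled (fun j => ω j) D x P.g (P.groups u)) c
      (2 * P.K) P.r x (x + P.len u)} ≤ δ) :
    coinLaw w {ω | ∃ i < P.R, ¬ P.SearchHit c (fun j => ω j) (i * P.period)} ≤
      P.R * (ε + P.samples u * (P.blocks u * δ)) := by
  set start : ℕ → ℕ → ℕ := fun i a =>
    i * P.period + P.drawnBelow u + a * (1 + P.groups u)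
  refine coinLaw_exists_lt_le fun i _ => ?_
  refine (measure_mono fun ω hω => ?_).trans ((measure_union_le
    {ω | ∀ a < P.samples u, (ω (start i a) : ℕ) % P.blocks u ∉
      heavyBlocks c (2 * P.K) (2 * P.K) (P.len u) (P.blocks u)}
    {ω | ∃ a < P.samples u, ∃ j < P.blocks u,
      ¬ HitsStretches (sampled (fun j => ω j) (start i a + 1) (j * P.len u) P.g (P.groups u)) c
        (2 * P.K) P.r (j * P.len u) (j * P.len u + P.len u)}).trans (add_le_add
      ((coinLaw_forall_notMem_heavyBlocks_le hF hu _ _).trans hε)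
      (coinLaw_exists_lt_le fun a _ => coinLaw_exists_lt_le fun j _ => hδ _ _)))
  refine or_iff_not_imp_left.2 fun hdrawn => ?_
  simp only [Set.mem_ofPred_eq, not_forall, not_not] at hdrawn
  obtain ⟨a, ha, hdrawn⟩ := hdrawn
  obtain ⟨hblock, hcost⟩ := Finset.mem_filter.1 hdrawn
  refine ⟨a, ha, _, Finset.mem_range.1 hblock, fun hS => hω ⟨u, hu, a, ha, ?_⟩⟩
  exact sampleHit_of_hitsStretches hc hr hK hcost hS

end MissedHit

end Params

section RunningTime

variable {n k l : ℕ}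

theorem gapParams_K_le_sqrt_mul (hn : 1 ≤ n) :
    (gapParams n k l).K ≤ k.sqrt * (128 * n.size * (gapParams n k l).g) :=
  Nat.mul_le_mul_left _ (Nat.lt_mul_div_succ k.sqrt
    (Nat.mul_pos (by norm_num) (Nat.size_pos.2 hn))).le

theorem gapParams_size_sq_mul_groups_mul_K_le (hk : 1 ≤ k) (hn : 1 ≤ n)
    (hlong : 2 * (gapParams n k l).K * l < n) :
    n.size ^ 2 * (gapParams n k l).groups (gapParams n k l).U * (gapParams n k l).K * l ≤
      256 * n.size ^ 3 * (n * k.sqrt) := by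
  have hlen := (gapParams_len_U_mul_lt hk hn hlong).le
  have hK := gapParams_K_le_sqrt_mul (n := n) (k := k) (l := l) hn
  rw [Params.len] at hlen
  set G := (gapParams n k l).groups (gapParams n k l).U
  set g := (gapParams n k l).g
  calc n.size ^ 2 * G * (gapParams n k l).K * l
      ≤ n.size ^ 2 * G * (k.sqrt * (128 * n.size * g)) * l := by gcongr
    _ = 128 * n.size ^ 3 * k.sqrt * (G * g * l) := by ring
    _ ≤ 128 * n.size ^ 3 * k.sqrt * (2 * n) := by gcongr
    _ = _ := by ring

theorem gapParams_repeatTime_le (hk : 1 ≤ k) (hn : 1 ≤ n) (hl : 1 ≤ l)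
    (hlong : 2 * (gapParams n k l).K * l < n) : (gapParams n k l).repeatTime ≤
      345668 * (n.size ^ 2 *
        (n.size ^ 2 * (gapParams n k l).groups (gapParams n k l).U * (gapParams n k l).K)) := by
  have hsize : 1 ≤ n.size := Nat.size_pos.2 hn
  have hU := gapParams_U_le hk hn hl hlong
  have hL : (gapParams n k l).L = 128 * (n.size * n.size) := rfl
  have hR : (gapParams n k l).R = n.size := rfl
  have hgroups : 0 < (gapParams n k l).groups (gapParams n k l).U :=
    Nat.pos_of_mul_pos_right (gapParams_len_pos _)
  have hX : 0 < n.size ^ 2 * (gapParams n k l).groups (gapParams n k l).U *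
      (gapParams n k l).K :=
    Nat.mul_pos (Nat.mul_pos (by positivity) hgroups) (gapParams_K_pos hk)
  set X := n.size ^ 2 * (gapParams n k l).groups (gapParams n k l).U * (gapParams n k l).K with hXd
  have hlevel : (gapParams n k l).levelTime + 10 ≤ 172818 * X := by
    rw [Params.levelTime, hL, show 128 * (n.size * n.size) * (gapParams n k l).groups _ *
      (gapParams n k l).K = 128 * X by rw [hXd]; ring]
    omega
  have hsearch : (gapParams n k l).searchTime + 18 ≤ 345660 * (n.size * X) := calc
    (gapParams n k l).searchTime + 18 ≤ 2 * n.size * (172818 * X) + 24 * (n.size * X) := by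
      rw [Params.searchTime]
      have hprod : 1 ≤ n.size * X := Nat.mul_pos hsize hX
      have := Nat.mul_le_mul (show (gapParams n k l).U + 1 ≤ 2 * n.size by omega) hlevel
      omega
    _ = 345660 * (n.size * X) := by ring
  calc (gapParams n k l).repeatTime ≤ n.size * (345660 * (n.size * X)) + 8 * (n.size ^ 2 * X) := by
        rw [Params.repeatTime, hR]
        exact Nat.add_le_add (Nat.mul_le_mul_left _ hsearch)
          (Nat.le_mul_of_pos_right 8 (by positivity))
    _ = 345668 * (n.size ^ 2 * X) := by ring

theorem gapParams_totalTime_mul_le (hk : 1 ≤ k) (hn : 1 ≤ n) (hl : 1 ≤ l)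
    (hlong : 2 * (gapParams n k l).K * l < n) :
    (20 * k.sqrt + 40 * n.size + 160 + (gapParams n k l).repeatTime) * l ≤
      10 ^ 8 * n.size ^ 5 * (n * k.sqrt) := by
  have hsize : 1 ≤ n.size := Nat.size_pos.2 hn
  have hgroups : 0 < (gapParams n k l).groups (gapParams n k l).U :=
    Nat.pos_of_mul_pos_right (gapParams_len_pos _)
  have hrepeat := gapParams_repeatTime_le hk hn hl hlong
  have hXl := gapParams_size_sq_mul_groups_mul_K_le hk hn hlong
  have hsqrt : k.sqrt ≤ (gapParams n k l).K := Nat.le_mul_self _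
  have hKX : (gapParams n k l).K ≤ n.size ^ 2 *
      (gapParams n k l).groups (gapParams n k l).U * (gapParams n k l).K :=
    Nat.le_mul_of_pos_left _ (Nat.mul_pos (by positivity) hgroups)
  have hK := gapParams_K_pos (n := n) (l := l) hk
  set X := n.size ^ 2 * (gapParams n k l).groups (gapParams n k l).U * (gapParams n k l).K
  have hsize2 : n.size ≤ n.size ^ 2 * X :=
    (Nat.le_self_pow two_ne_zero _).trans (Nat.le_mul_of_pos_right _ (by omega))
  have hX2 : X ≤ n.size ^ 2 * X := Nat.le_mul_of_pos_left _ (by positivity)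
  calc (20 * k.sqrt + 40 * n.size + 160 + (gapParams n k l).repeatTime) * l
      ≤ 345888 * (n.size ^ 2 * X) * l := Nat.mul_le_mul_right l (by omega)
    _ = 345888 * n.size ^ 2 * (X * l) := by ring
    _ ≤ 345888 * n.size ^ 2 * (256 * n.size ^ 3 * (n * k.sqrt)) := by gcongr
    _ = 88547328 * n.size ^ 5 * (n * k.sqrt) := by ring
    _ ≤ 10 ^ 8 * n.size ^ 5 * (n * k.sqrt) := by gcongr; norm_num

end RunningTime

section SmallDistance

variable {n k l d : ℕ}

theorem lt_two_mul_gapParams_J (hk : 1 ≤ k) (hn : 1 ≤ n)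
    (hlong : 2 * (gapParams n k l).K * l < n) : l < 2 * (gapParams n k l).J := by
  refine Nat.lt_of_mul_lt_mul_left (a := (gapParams n k l).len (gapParams n k l).U) ?_
  have hJ := le_gapParams_J_mul (n := n) (k := k) (l := l)
  calc _ < 2 * n := gapParams_len_U_mul_lt hk hn hlong
    _ ≤ 2 * ((gapParams n k l).J * (gapParams n k l).len (gapParams n k l).U) := by omega
    _ = _ := by ring

theorem gapParams_U_mul_L_mul_le (hk : 1 ≤ k) (hn : 1 ≤ n) (hl : 1 ≤ l)
    (hlong : 2 * (gapParams n k l).K * l < n) (hd : 4096 * n.size ^ 3 * d ≤ k.sqrt * l) :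
    4 * (((gapParams n k l).U + 1) * (gapParams n k l).L * (2 * d)) ≤
      (gapParams n k l).J * (gapParams n k l).r := by
  have hU : (gapParams n k l).U + 1 ≤ 2 * n.size := by
    have := Nat.size_pos.2 hn
    have := gapParams_U_le hk hn hl hlong
    omega
  have hJ := (lt_two_mul_gapParams_J hk hn hlong).le
  refine Nat.le_of_mul_le_mul_left (c := 2) ?_ two_pos
  calc 2 * (4 * (((gapParams n k l).U + 1) * (128 * (n.size * n.size)) * (2 * d)))
      ≤ 2 * (4 * (2 * n.size * (128 * (n.size * n.size)) * (2 * d))) := by gcongr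
    _ = 4096 * n.size ^ 3 * d := by ring
    _ ≤ k.sqrt * l := hd
    _ ≤ k.sqrt * (2 * (gapParams n k l).J) := Nat.mul_le_mul_left _ hJ
    _ = 2 * ((gapParams n k l).J * k.sqrt) := by ring

end SmallDistance

section LargeDistance

variable {n k l w : ℕ} {c : ℕ → ℕ → ℕ}

theorem exp_neg_le_inv_two_pow {x : ℝ} {m : ℕ} (h : m ≤ x) : Real.exp (-x) ≤ (2 ^ m)⁻¹ := by
  have htwo : (2 : ℝ) ≤ Real.exp 1 := by
    have := Real.add_one_le_exp (1 : ℝ)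
    linarith
  rw [Real.exp_neg]
  refine inv_anti₀ (by positivity) ?_
  calc (2 : ℝ) ^ m ≤ Real.exp 1 ^ m := by gcongr
    _ = Real.exp m := by rw [← Real.exp_nat_mul, mul_one]
    _ ≤ Real.exp x := Real.exp_le_exp.2 h

theorem natCast_mul_ofReal_inv_le {m n N : ℕ} (hn : 0 < n) (hN : 0 < N) (h : m * n ≤ N) :
    (m : ENNReal) * ENNReal.ofReal (N : ℝ)⁻¹ ≤ ENNReal.ofReal (1 / n) := by
  rw [← ENNReal.ofReal_natCast, ← ENNReal.ofReal_mul (Nat.cast_nonneg m)]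
  refine ENNReal.ofReal_le_ofReal ?_
  rw [← div_eq_mul_inv, div_le_div_iff₀ (by exact_mod_cast hN) (by exact_mod_cast hn), one_mul]
  exact_mod_cast h

theorem gapParams_g_eq_one_or_le (hn : 1 ≤ n) :
    (gapParams n k l).g = 1 ∨ 32 * n.size * (2 * (gapParams n k l).g) ≤ (gapParams n k l).r := by
  have := Nat.size_pos.2 hn
  change k.sqrt / (128 * n.size) + 1 = 1 ∨
    32 * n.size * (2 * (k.sqrt / (128 * n.size) + 1)) ≤ k.sqrt
  rcases Nat.eq_zero_or_pos (k.sqrt / (128 * n.size)) with h | h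
  · exact .inl (by rw [h])
  · have hdiv := Nat.mul_div_le k.sqrt (128 * n.size)
    exact .inr (by nlinarith [Nat.mul_le_mul_left n.size h])

theorem coinLaw_not_hitsStretches_gapParams_le (hk : 1 ≤ k) (hn : 1 ≤ n)
    (hF : (gapParams n k l).Fits (2 ^ w)) {u : ℕ} (hu : u ≤ (gapParams n k l).U)
    (hc : ∀ i s, c i s ≤ 1) (D x : ℕ) :
    coinLaw w {ω | ¬ HitsStretches (sampled (fun j => ω j) D x (gapParams n k l).g
        ((gapParams n k l).groups u)) c (2 * (gapParams n k l).K) (gapParams n k l).r x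
        (x + (gapParams n k l).len u)} ≤
      ((gapParams n k l).len u + 1 : ℕ) * (((gapParams n k l).len u + 1 : ℕ) *
        ((2 * (gapParams n k l).K + 1 : ℕ) * ENNReal.ofReal (2 ^ (32 * n.size))⁻¹)) := by
  rcases gapParams_g_eq_one_or_le (k := k) (l := l) hn with hg | hg
  · have hempty : {ω : ℕ → Fin (2 ^ w) | ¬ HitsStretches (sampled (fun j => ω j) D x
        (gapParams n k l).g ((gapParams n k l).groups u)) c (2 * (gapParams n k l).K)
        (gapParams n k l).r x (x + (gapParams n k l).len u)} = ∅ := by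
      refine Set.eq_empty_of_forall_notMem fun ω hω => hω ?_
      rw [Params.len, hg, mul_one]
      exact hitsStretches_sampled_one c _ (gapParams_r_pos hk) _ _ _ _
    rw [hempty, measure_empty]
    exact zero_le
  · have hgW : (gapParams n k l).g ≤ 2 ^ w := by
      have := Nat.le_mul_of_pos_left (gapParams n k l).g (hF.groups_pos u)
      have := Params.len_le hu
      have := hF.total_lt
      rw [← Params.len] at *
      omega
    refine (coinLaw_not_hitsStretches_le hF.g_pos hgW hc _ (gapParams_r_pos hk) D x _).trans ?_
    rw [← Params.len]
    gcongr
    refine exp_neg_le_inv_two_pow ?_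
    have hgpos : (0 : ℝ) < 2 * (gapParams n k l).g := by
      exact_mod_cast Nat.mul_pos two_pos hF.g_pos
    rw [le_div_iff₀ hgpos]
    exact_mod_cast hg

theorem gapParams_unionBound_le (hk : 1 ≤ k) (hkn : k ≤ n) (hl : 1 ≤ l)
    (hlong : 2 * (gapParams n k l).K * l < n) {u : ℕ} (hu : u ≤ (gapParams n k l).U) :
    (gapParams n k l).R * (1 + (gapParams n k l).samples u * ((gapParams n k l).blocks u *
      (((gapParams n k l).len u + 1) * (((gapParams n k l).len u + 1) *
        (2 * (gapParams n k l).K + 1))))) * n ≤ 2 ^ (32 * n.size) := by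
  have hn := hk.trans hkn
  have hlen : (gapParams n k l).len (gapParams n k l).U < 2 * n :=
    (Nat.le_mul_of_pos_right _ hl).trans_lt (gapParams_len_U_mul_lt hk hn hlong)
  have hK := (gapParams_K_le (n := n) (l := l)).trans hkn
  have hsize := size_le_self n
  have hsamples : (gapParams n k l).samples u ≤ 256 * n ^ 3 := calc
    _ ≤ 2 * n * (128 * (n * n)) := Nat.mul_le_mul
      ((Nat.pow_le_pow_right two_pos (Nat.sub_le _ u)).trans
        ((two_pow_le_gapParams_len _).trans hlen.le))
      (Nat.mul_le_mul_left 128 (Nat.mul_le_mul hsize hsize))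
    _ = 256 * n ^ 3 := by ring
  have hblocks : (gapParams n k l).blocks u ≤ 3 * n := by
    have := Params.blocks_mul_len hu ▸
      Nat.le_mul_of_pos_right ((gapParams n k l).blocks u) (gapParams_len_pos u)
    have := gapParams_J_mul_le (n := n) (k := k) (l := l)
    omega
  have hlenu : (gapParams n k l).len u + 1 ≤ 3 * n := by
    have := Params.len_le hu
    omega
  have hnΛ : n ≤ 2 ^ n.size := (Nat.lt_size_self n).le
  have htwo : 2 ≤ 2 ^ n.size := Nat.le_self_pow (Nat.size_pos.2 hn).ne' 2
  rw [mul_comm 32, pow_mul]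
  set Λ := 2 ^ n.size
  calc _ ≤ n * (n ^ 7 + 256 * n ^ 3 * (3 * n * (3 * n * (3 * n * (3 * n))))) * n := by
        gcongr
        · exact hsize
        · exact Nat.one_le_pow _ _ hn
        · omega
    _ = 20737 * n ^ 9 := by ring
    _ ≤ 2 ^ 23 * Λ ^ 9 := by gcongr; norm_num
    _ ≤ Λ ^ 23 * Λ ^ 9 := by gcongr
    _ = Λ ^ 32 := by ring

theorem gapParams_len_eq (u : ℕ) :
    (gapParams n k l).len u = (gapParams n k l).len 0 * 2 ^ u := by
  simp only [Params.len, Params.groups, pow_zero]; ring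

theorem gapParams_exists_level_le_card_heavyBlocks (hk : 1 ≤ k) (hn : 1 ≤ n) (hl : 1 ≤ l)
    (hlong : 2 * (gapParams n k l).K * l < n) (hc : ∀ i s, c i s ≤ 1)
    (hD : 12 * (gapParams n k l).K * l < minCost c (2 * (gapParams n k l).K) 0 n) :
    ∃ u ≤ (gapParams n k l).U, l ≤ n.size * (heavyBlocks c (2 * (gapParams n k l).K)
      (2 * (gapParams n k l).K) ((gapParams n k l).len u) ((gapParams n k l).blocks u)).card := by
  have hJ : (gapParams n k l).J + l ≤ 3 * l := by
    have := gapParams_J_le (n := n) (k := k) hl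
    omega
  obtain ⟨u, hu, hcard⟩ := exists_le_mul_card_heavyBlocks (m := 2 * (gapParams n k l).K)
    (b := (gapParams n k l).len 0) (J := (gapParams n k l).J) (U := (gapParams n k l).U)
    (n := n) (l := l) hc (gapParams_len_zero_le hk hn)
    (by rw [← gapParams_len_eq]; exact le_gapParams_J_mul) <| calc
      _ ≤ 2 * (2 * (gapParams n k l).K) * (3 * l) := Nat.mul_le_mul_left _ hJ
      _ = 12 * (gapParams n k l).K * l := by ring
      _ < _ := hD
  rw [← gapParams_len_eq, ← Params.blocks] at hcard
  exact ⟨u, hu, hcard.trans (Nat.mul_le_mul_right _ (gapParams_U_le hk hn hl hlong))⟩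

theorem coinLaw_exists_not_searchHit_gapParams_le (hk : 1 ≤ k) (hkn : k ≤ n) (hl : 1 ≤ l)
    (hlong : 2 * (gapParams n k l).K * l < n) (hF : (gapParams n k l).Fits (2 ^ w))
    (hc : ∀ i s, c i s ≤ 1)
    (hD : 12 * (gapParams n k l).K * l < minCost c (2 * (gapParams n k l).K) 0 n) :
    coinLaw w {ω | ∃ i < (gapParams n k l).R, ¬ (gapParams n k l).SearchHit c (fun j => ω j)
      (i * (gapParams n k l).period)} ≤ ENNReal.ofReal (1 / n) := by
  have hn := hk.trans hkn
  obtain ⟨u, hu, hheavy⟩ := gapParams_exists_level_le_card_heavyBlocks hk hn hl hlong hc hD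
  have hJ := gapParams_J_le (n := n) (k := k) hl
  refine (Params.coinLaw_exists_not_searchHit_le hF hc (gapParams_r_pos hk) rfl hu
    (ε := ENNReal.ofReal (2 ^ (32 * n.size))⁻¹) (ENNReal.ofReal_le_ofReal <|
      exp_neg_le_inv_two_pow ?_) (coinLaw_not_hitsStretches_gapParams_le hk hn hF hu hc)).trans ?_
  · have hJ0 : (0 : ℝ) < 2 * (gapParams n k l).J := by
      exact_mod_cast Nat.mul_pos two_pos hF.J_pos
    rw [le_div_iff₀ hJ0]
    norm_cast
    set h := (heavyBlocks c (2 * (gapParams n k l).K) (2 * (gapParams n k l).K)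
      ((gapParams n k l).len u) ((gapParams n k l).blocks u)).card
    calc 32 * n.size * (2 * (gapParams n k l).J)
        ≤ 32 * n.size * (4 * (n.size * h)) := Nat.mul_le_mul_left _ (by omega)
      _ = 128 * (n.size * n.size) * h := by ring
  · refine le_of_eq_of_le ?_ (natCast_mul_ofReal_inv_le hn (N := 2 ^ (32 * n.size))
      (by positivity) (gapParams_unionBound_le hk hkn hl hlong hu))
    push_cast
    ring

end LargeDistance

theorem size_le_log {n : ℕ} (hn : 1 ≤ n) : (n.size : ℝ) ≤ 3 * Real.log (n + 2) := by
  have hpow : 2 ^ n.size ≤ 2 * n := by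
    have := Nat.lt_size.1 (Nat.sub_one_lt (Nat.size_pos.2 hn).ne')
    have : 2 * 2 ^ (n.size - 1) = 2 ^ n.size := mul_pow_sub_one (Nat.size_pos.2 hn).ne' 2
    omega
  have hlog : (n.size : ℝ) * Real.log 2 ≤ Real.log 2 + Real.log (n + 2) := by
    rw [← Real.log_pow, ← Real.log_mul two_ne_zero (by positivity)]
    refine Real.log_le_log (by positivity) ?_
    have : (2 : ℝ) ^ n.size ≤ 2 * n := by exact_mod_cast hpow
    linarith
  have htwo : Real.log 2 ≤ Real.log (n + 2) := Real.log_le_log two_pos (by simp)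
  have := Real.log_two_gt_d9
  nlinarith [Nat.cast_nonneg (α := ℝ) n.size]

theorem ofReal_one_sub_le_of_compl_subset {Ω : Type*} [MeasurableSpace Ω] {μ : Measure Ω}
    [IsProbabilityMeasure μ] {S T : Set Ω} {ε : ℝ} (hT : μ T ≤ ENNReal.ofReal ε)
    (hε : 0 ≤ ε) (hST : Tᶜ ⊆ S) : ENNReal.ofReal (1 - ε) ≤ μ S := by
  rw [ENNReal.ofReal_sub 1 hε, ENNReal.ofReal_one, tsub_le_iff_right]
  calc 1 = μ (S ∪ T) := by
        rw [Set.union_comm, Set.compl_subset_iff_union.1 hST, measure_univ]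
    _ ≤ μ S + μ T := measure_union_le S T
    _ ≤ μ S + ENNReal.ofReal ε := by gcongr

theorem lt_two_pow_wordBits {n : ℕ} (hn : 1 ≤ n) (σ : ℕ) :
    1000 * (n + 1) ^ 3 < 2 ^ wordBits 16 n σ := by
  have htwo : 2 ≤ 2 ^ n.size := Nat.le_self_pow (Nat.size_pos.2 hn).ne' 2
  have hle : n + 1 ≤ 2 ^ n.size := Nat.lt_size_self n
  calc 1000 * (n + 1) ^ 3 < 2 ^ 10 * (n + 1) ^ 3 := by gcongr; norm_num
    _ ≤ (2 ^ n.size) ^ 10 * (2 ^ n.size) ^ 3 := by gcongr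
    _ = 2 ^ (13 * n.size) := by ring
    _ ≤ 2 ^ wordBits 16 n σ := Nat.pow_le_pow_right two_pos <|
        Nat.mul_le_mul (by norm_num) (Nat.size_le_size (Nat.le_add_right n σ))

theorem _root_.HaltsWithin.mono {P : Cmd} {κ k l n σ : ℕ} {A B : Fin n → Fin σ}
    {ω : ℕ → Fin (2 ^ wordBits κ n σ)} {T T' : ℝ} (h : HaltsWithin P κ k l A B ω T)
    (hT : T ≤ T') : HaltsWithin P κ k l A B ω T' :=
  let ⟨s, t, hexec, ht⟩ := h
  ⟨s, t, hexec, ht.trans hT⟩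

section gapProgram

variable {n σ k l κ : ℕ} {A B : Fin n → Fin σ}

theorem gapProgram_halts (hk : 1 ≤ k) (hkn : k ≤ n) (hl : 1 ≤ l) (hln : l ≤ n)
    (hW : 1000 * (n + 1) ^ 3 < 2 ^ wordBits κ n σ) (A B : Fin n → Fin σ)
    (ω : ℕ → Fin (2 ^ wordBits κ n σ)) :
    HaltsWithin gapProgram κ k l A B ω (10 ^ 8 * n.size ^ 5 * (n * k.sqrt) / l) := by
  have hn := hk.trans hkn
  have hsqrt := Nat.sqrt_pos.2 hk
  have hsize : 1 ≤ n.size := Nat.size_pos.2 hn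
  suffices ∃ s t, Exec (gapEnv κ A B ω) gapProgram (gapInit n σ k l) s t ∧
      t * l ≤ 10 ^ 8 * n.size ^ 5 * (n * k.sqrt) by
    obtain ⟨s, t, hexec, ht⟩ := this
    refine ⟨s, t, hexec, ?_⟩
    rw [le_div_iff₀ (by exact_mod_cast hl)]
    exact_mod_cast ht
  rcases le_or_gt n (2 * (gapParams n k l).K * l) with hshort | hlong
  · obtain ⟨s, t, hexec, ht, -⟩ :=
      gapProgram_runs_of_le (E := gapEnv κ A B ω) (σ := σ) hkn hln hW hshort
    have hsize5 : n.size ≤ n.size ^ 5 * k.sqrt :=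
      (Nat.le_self_pow (by norm_num) _).trans (Nat.le_mul_of_pos_right _ hsqrt)
    have hsqrt5 : k.sqrt ≤ n.size ^ 5 * k.sqrt := Nat.le_mul_of_pos_left _ (by positivity)
    refine ⟨s, t, hexec, ?_⟩
    calc t * l ≤ 10 ^ 8 * (n.size ^ 5 * k.sqrt) * n := Nat.mul_le_mul (by omega) hln
      _ = _ := by ring
  · obtain ⟨s, t, hexec, ht, -⟩ :=
      gapProgram_runs_of_lt (E := gapEnv κ A B ω) (σ := σ) hk hkn hl hln hW hlong
    exact ⟨s, t, hexec,
      (Nat.mul_le_mul_right l ht).trans (gapParams_totalTime_mul_le hk hn hl hlong)⟩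

theorem gapProgram_outputs_small (hk : 1 ≤ k) (hkn : k ≤ n) (hl : 1 ≤ l) (hln : l ≤ n)
    (hW : 1000 * (n + 1) ^ 3 < 2 ^ wordBits κ n σ)
    (hd : 4096 * n.size ^ 3 * stringED A B ≤ k.sqrt * min k.sqrt l) :
    ENNReal.ofReal (1 - 1 / n) ≤ probOutputs gapProgram κ k l A B .small := by
  have hn := hk.trans hkn
  rcases le_or_gt n (2 * (gapParams n k l).K * l) with hshort | hlong
  · refine ofReal_one_sub_le_of_compl_subset (T := ∅) (by simp) (by positivity) fun ω _ => ?_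
    obtain ⟨s, t, hexec, -, hs⟩ :=
      gapProgram_runs_of_le (E := gapEnv κ A B ω) (σ := σ) hkn hln hW hshort
    exact ⟨s, t, hexec, hs⟩
  have hED : 2 * stringED A B ≤ (gapParams n k l).K := calc
    _ ≤ 4096 * n.size ^ 3 * stringED A B := Nat.mul_le_mul_right _ <| by
      have := Nat.one_le_pow 3 n.size (Nat.size_pos.2 hn)
      omega
    _ ≤ k.sqrt * k.sqrt := hd.trans (Nat.mul_le_mul_left _ (min_le_left _ _))
  refine ofReal_one_sub_le_of_compl_subset ((Params.coinLaw_forall_searchHit_le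
    (gapParams_fits hk hkn hl hlong hW) (gapParams_r_pos hk)
    (minCost_charAt_le_two_mul_stringED hED) (gapParams_U_mul_L_mul_le hk hn hl hlong
      (hd.trans (Nat.mul_le_mul_left _ (min_le_right _ _))))).trans
    (ENNReal.ofReal_le_ofReal ?_)) (by positivity) fun ω hω => ?_
  · have hpow : (n : ℝ) ≤ 2 ^ n.size := by exact_mod_cast (Nat.lt_size_self n).le
    rw [div_pow, one_pow]
    exact one_div_le_one_div_of_le (by exact_mod_cast hn) hpow
  · obtain ⟨s, t, hexec, -, hs⟩ :=
      gapProgram_runs_of_lt (E := gapEnv κ A B ω) (σ := σ) hk hkn hl hln hW hlong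
    refine ⟨s, t, hexec, hs.trans (truth_true ?_)⟩
    by_contra! hall
    exact hω hall

theorem gapProgram_outputs_large (hk : 1 ≤ k) (hkn : k ≤ n) (hl : 1 ≤ l) (hln : l ≤ n)
    (hW : 1000 * (n + 1) ^ 3 < 2 ^ wordBits κ n σ) (hd : 17 * (k * l) ≤ stringED A B) :
    ENNReal.ofReal (1 - 1 / n) ≤ probOutputs gapProgram κ k l A B .large := by
  have hc : ∀ i s, mismatch (charAt A) (charAt B) (gapParams n k l).K i s ≤ 1 :=
    mismatch_le_one _ _ _
  have hcost : 14 * (gapParams n k l).K * l ≤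
      minCost (mismatch (charAt A) (charAt B) (gapParams n k l).K)
        (2 * (gapParams n k l).K) 0 n := by
    have := stringED_le_minCost A B (gapParams n k l).K
    have : (gapParams n k l).K * l ≤ k * l := Nat.mul_le_mul_right _ gapParams_K_le
    have : (gapParams n k l).K ≤ (gapParams n k l).K * l := Nat.le_mul_of_pos_right _ hl
    rw [mul_assoc]
    omega
  have hKl : 0 < (gapParams n k l).K * l := Nat.mul_pos (gapParams_K_pos hk) hl
  have hlong : 2 * (gapParams n k l).K * l < n := by
    have := minCost_le_length hc (2 * (gapParams n k l).K) 0 n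
    rw [mul_assoc] at *
    omega
  refine ofReal_one_sub_le_of_compl_subset (coinLaw_exists_not_searchHit_gapParams_le hk hkn hl
    hlong (gapParams_fits hk hkn hl hlong hW) hc ?_) (by positivity) fun ω hω => ?_
  · rw [mul_assoc] at *
    omega
  · obtain ⟨s, t, hexec, -, hs⟩ :=
      gapProgram_runs_of_lt (E := gapEnv κ A B ω) (σ := σ) hk hkn hl hln hW hlong
    exact ⟨s, t, hexec, hs.trans (truth_false hω)⟩

end gapProgram

theorem sqrt_le_two_mul_nat_sqrt {k : ℕ} (hk : 1 ≤ k) : √(k : ℝ) ≤ 2 * k.sqrt := by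
  have hsqrt : (1 : ℝ) ≤ k.sqrt := by exact_mod_cast Nat.sqrt_pos.2 hk
  linarith [Real.real_sqrt_lt_nat_sqrt_succ (a := k)]

theorem min_sqrt_mul_le {k : ℕ} (hk : 1 ≤ k) (l : ℕ) :
    min (k : ℝ) (√k * l) ≤ 4 * (k.sqrt * min k.sqrt l : ℕ) := by
  have hsqrt := sqrt_le_two_mul_nat_sqrt hk
  calc min (k : ℝ) (√k * l) = √k * min √k (l : ℝ) := by
        rw [mul_min_of_nonneg _ _ (Real.sqrt_nonneg _), Real.mul_self_sqrt (Nat.cast_nonneg k)]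
    _ ≤ 2 * k.sqrt * (2 * min (k.sqrt : ℝ) l) := by
        gcongr
        rw [mul_min_of_nonneg _ _ zero_le_two]
        exact min_le_min hsqrt (le_mul_of_one_le_left (Nat.cast_nonneg l) one_le_two)
    _ = 4 * (k.sqrt * min k.sqrt l : ℕ) := by push_cast; ring

end WordRAM

theorem mainTheorem3_general :
    ∃ (P : WordRAM.Cmd) (κ c : ℕ) (C : ℝ), 0 < κ ∧ 0 < C ∧
      ∀ n σ k ℓ : ℕ, 1 ≤ k → k ≤ n → 1 ≤ ℓ → ℓ ≤ n →
        ∀ A B : Fin n → Fin σ,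
          (∀ ω, HaltsWithin P κ k ℓ A B ω (C * Real.log (n + 2) ^ c * (n * √k / ℓ))) ∧
          ((stringED A B : ℝ) ≤ min (k : ℝ) (√k * ℓ) / (C * Real.log (n + 2) ^ c) →
            ENNReal.ofReal (1 - 1 / n) ≤ probOutputs P κ k ℓ A B .small) ∧
          (C * (k * ℓ) ≤ (stringED A B : ℝ) →
            ENNReal.ofReal (1 - 1 / n) ≤ probOutputs P κ k ℓ A B .large) := by
  refine ⟨WordRAM.gapProgram, 16, 5, 10 ^ 11, by norm_num, by norm_num, ?_⟩
  intro n σ k ℓ hk hkn hl hln A B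
  have hn := hk.trans hkn
  have hW := WordRAM.lt_two_pow_wordBits hn σ
  have hsize : (1 : ℝ) ≤ n.size := by exact_mod_cast Nat.size_pos.2 hn
  have hlog : (n.size : ℝ) ^ 5 ≤ 243 * Real.log (n + 2) ^ 5 := calc
    _ ≤ (3 * Real.log (n + 2)) ^ 5 := by gcongr; exact WordRAM.size_le_log hn
    _ = _ := by ring
  have : 0 < Real.log ((n : ℝ) + 2) := Real.log_pos (by linarith [Nat.cast_nonneg (α := ℝ) n])
  refine ⟨fun ω => ?_, fun hd => ?_, fun hd => ?_⟩
  · refine (WordRAM.gapProgram_halts hk hkn hl hln hW A B ω).mono ?_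
    rw [← mul_div_assoc]
    calc (10 ^ 8 * n.size ^ 5 * (n * k.sqrt) / ℓ : ℝ)
        ≤ 10 ^ 8 * (243 * Real.log (n + 2) ^ 5) * (n * √k) / ℓ := by
          gcongr
          exact Real.nat_sqrt_le_real_sqrt
      _ = 243 * 10 ^ 8 * Real.log (n + 2) ^ 5 * (n * √k) / ℓ := by ring
      _ ≤ 10 ^ 11 * Real.log (n + 2) ^ 5 * (n * √k) / ℓ := by gcongr; norm_num
  · refine WordRAM.gapProgram_outputs_small hk hkn hl hln hW ?_
    rw [le_div_iff₀ (by positivity)] at hd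
    have hmin := hd.trans (WordRAM.min_sqrt_mul_le hk ℓ)
    suffices (4096 * n.size ^ 3 * stringED A B : ℝ) ≤ (k.sqrt * min k.sqrt ℓ : ℕ) by
      exact_mod_cast this
    calc (4096 * n.size ^ 3 * stringED A B : ℝ)
        ≤ 4096 * n.size ^ 5 * stringED A B := by gcongr; norm_num
      _ ≤ 4096 * (243 * Real.log (n + 2) ^ 5) * stringED A B := by gcongr
      _ = 995328 * (stringED A B * Real.log (n + 2) ^ 5) := by ring
      _ ≤ 10 ^ 11 / 4 * (stringED A B * Real.log (n + 2) ^ 5) := by gcongr; norm_num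
      _ ≤ _ := by linarith
  · refine WordRAM.gapProgram_outputs_large hk hkn hl hln hW ?_
    have : (17 * (k * ℓ) : ℝ) ≤ stringED A B := le_trans (by gcongr; norm_num) hd
    exact_mod_cast this

theorem mainTheorem3 :
    ∃ (P : WordRAM.Cmd) (κ c : ℕ) (C : ℝ), 0 < κ ∧ 0 < C ∧
      ∀ n σ k ℓ : ℕ, 1 ≤ k → k ≤ n → Real.sqrt k ≤ ℓ → ℓ ≤ n →
        ∀ A B : Fin n → Fin σ,
          (∀ ω, HaltsWithin P κ k ℓ A B ω
            (C * Real.log (n + 2) ^ c * (((n : ℝ) + (k : ℝ) ^ 2) * Real.sqrt k / ℓ))) ∧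
          ((stringED A B : ℝ) ≤ k / (C * Real.log (n + 2) ^ c) →
            ENNReal.ofReal (1 - 1 / n) ≤ probOutputs P κ k ℓ A B .small) ∧
          (C * (k * ℓ) ≤ (stringED A B : ℝ) →
            ENNReal.ofReal (1 - 1 / n) ≤ probOutputs P κ k ℓ A B .large) := by
  obtain ⟨P, κ, c, C, hκ, hC, h⟩ := mainTheorem3_general
  refine ⟨P, κ, c, C, hκ, hC, fun n σ k ℓ hk hkn hkl hln A B => ?_⟩
  have hl : 1 ≤ ℓ := by
    exact_mod_cast (Real.one_le_sqrt.2 (by exact_mod_cast hk)).trans hkl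
  have hmin : min (k : ℝ) (√k * ℓ) = k := min_eq_left <|
    (Real.mul_self_sqrt (Nat.cast_nonneg k)).ge.trans (by gcongr)
  have : 0 ≤ Real.log ((n : ℝ) + 2) := Real.log_nonneg (by linarith [Nat.cast_nonneg (α := ℝ) n])
  obtain ⟨hhalts, hsmall, hlarge⟩ := h n σ k ℓ hk hkn hl hln A B
  rw [hmin] at hsmall
  refine ⟨fun ω => (hhalts ω).mono ?_, hsmall, hlarge⟩
  gcongr
  exact le_add_of_nonneg_right (by positivity)
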